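/- Conventions. Hilbert spaces are real; $H$ is an infinite-dimensional separable Hilbert space and $E$ an infinite-dimensional Hilbert space; Hilbert manifolds are Hausdorff and paracompact. A set is pre-compact if its closure is compact. For closed subspaces $V,W\subset H$ with orthogonal projections $P_V,P_W$, $V$ is a compact perturbation of $W$ if $P_V-P_W$ is compact, and then $\dim(V,W):=\dim (V\cap W^\perp)-\dim (V^\perp\cap W)$. For $m\in\mathbb N=\{0,1,2,\dots\}$, $\mathrm{Gr}_{(m)}(H)$ is the set of closed subspaces of $H$ modulo the relation "$V$ is a compact perturbation of $W$ and $\dim(V,W)\in m\mathbb Z$", with the quotient topology (from the operator norm topology on projections); $[V]_{(m)}$ is the class of $V$. The map $[V]_{(1)}\mapsto P_V+\mathcal L_c(H)$ identifies $\mathrm{Gr}_{(1)}(H)$ with an analytic submanifold of the Calkin algebra $\mathcal L(H)/\mathcal L_c(H)$, and $\mathrm{Gr}_{(m)}(H)$ carries the analytic structure lifted by the covering $\mathrm{Gr}_{(m)}(H)\to\mathrm{Gr}_{(1)}(H)$. A $C^r$ $(m)$-essential subbundle of $TM$ is a $C^r$ section of $\mathrm{Gr}_{(m)}(TM)\to M$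 ("essential subbundle" if $m=1$). A bounded operator is semi-Fredholm if it has closed range and finite-dimensional kernel or cokernel; its index is $\dim\ker-\dim\mathrm{coker}\in\mathbb Z\cup\{\pm\infty\}$. Let $k\in\{1,2,\dots,\infty\}$, let $M$ be a $C^k$ manifold modeled on $H$ with an open covering $\{M_i\}_{i\in I}$, let $N_i$ ($i\in I$) be $C^k$ manifolds modeled on $E$, and let $\mathcal Q_i:M_i\to N_i$ be $C^k$ maps such that all differentials $D\mathcal Q_i(p)$ ($i\in I$, $p\in M_i$) are semi-Fredholm with one and the same index, which is non-negative (possibly $+\infty$). Assume that for all $i,j\in I$ and all $A\subset M_i\cap M_j$, $\mathcal Q_i(A)$ is pre-compact if and only if $\mathcal Q_j(A)$ is pre-compact. Then: (1) There is a (unique) $C^{k-1}$ essential subbundle $\mathcal E$ of $TM$ with $\mathcal E(p)=[\ker D\mathcal Q_i(p)]_{(1)}$ for all $i\in I$, $p\in M_i$. (2) For all $i,j$ and $p\in M_i\cap M_j$ the operator $D\mathcal Q_i(p)\,D\mathcal Q_j(p)^*:T_{\mathcal Q_j(p)}N_j\to T_{\mathcal Q_i(p)}N_i$ is Fredholm,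 the adjoint being taken with respect to any inner products that make the tangent spaces Hilbert spaces with their given topology. (3) Given a bounded projector $Q\in\mathcal L(H)$ with kernel $V$, call a $C^k$ chart $\varphi$ of $M$ adapted to $\mathcal Q_i$ if $\mathrm{dom}(\varphi)\subset M_i$ and (i) the image of $\varphi$ is bounded; (ii) for every $\xi$ in the image of $\varphi$, $\ker D(\mathcal Q_i\circ\varphi^{-1})(\xi)$ is a compact perturbation of $V$ with $\dim(\ker D(\mathcal Q_i\circ\varphi^{-1})(\xi),V)=\dim\mathrm{coker}\,D\mathcal Q_i(\varphi^{-1}(\xi))$; (iii) for every subset $A$ of the image of $\varphi$, $\mathcal Q_i(\varphi^{-1}(A))$ is pre-compact if and only if $QA$ is. There is a projector $Q$ such that for every $i\in I$ every point of $M_i$ lies in the domain of a chart adapted to $\mathcal Q_i$. For every such $Q$, with $V=\ker Q$, the set $\mathcal A$ of all charts adapted to some $\mathcal Q_i$ is a strong integrable structure modeled on $(H,V)$ for $\mathcal E$: it is an atlas, $D\varphi(p)\mathcal E(p)=[V]_{(1)}$ for all $\varphi\in\mathcal A$, $p\in\mathrm{dom}(\varphi)$, and for every transition map $\tau=\varphi\circ\psi^{-1}$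 ($\varphi,\psi\in\mathcal A$) and every bounded $A\subset\mathrm{dom}(\tau)$, $QA$ is pre-compact if and only if $Q\tau(A)$ is. Moreover, for $\varphi\in\mathcal A$, $i\in I$ and $A\subset\mathrm{dom}(\varphi)\subset M_i$, $Q\varphi(A)$ is pre-compact if and only if $\mathcal Q_i(A)$ is. (4) For every such $Q$ and every $m\in\mathbb N$, $\mathcal E$ lifts along the atlas $\mathcal A$ to an $(m)$-essential subbundle, i.e. there is a $C^{k-1}$ $(m)$-essential subbundle $\mathcal E'$ of $TM$ which projects to $\mathcal E$ and satisfies $D\varphi(p)\mathcal E'(p)=[V]_{(m)}$ for all $\varphi\in\mathcal A$, $p\in\mathrm{dom}(\varphi)$, if and only if \[ \mathrm{ind}\,\bigl(D\mathcal Q_i(p)\,D\mathcal Q_j(p)^*\bigr)\equiv 0 \mod m\qquad\forall\, i,j\in I,\ \forall\, p\in M_i\cap M_j . \] -/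

import Mathlib

open Set Topology
open scoped Manifold ContDiff

noncomputable section

namespace EssentialSubbundle

/-! ### Pre-compact sets, semi-Fredholm and Fredholm operators -/

/-- A subset of a topological space is pre-compact if its closure is compact. -/
def IsPrecompact {X : Type*} [TopologicalSpace X] (A : Set X) : Prop :=
  IsCompact (closure A)

section Operators

variable {X Y : Type*}
  [AddCommGroup X] [Module ℝ X] [TopologicalSpace X]
  [AddCommGroup Y] [Module ℝ Y] [TopologicalSpace Y]

/-- Semi-Fredholm operators: closed range, and finite dimensional kernel or cokernel. -/
structure IsSemiFredholm (T : X →L[ℝ] Y) : Prop where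
  isClosed_range : IsClosed (LinearMap.range (T : X →ₗ[ℝ] Y) : Set Y)
  finite : FiniteDimensional ℝ (LinearMap.ker (T : X →ₗ[ℝ] Y)) ∨
    FiniteDimensional ℝ (Y ⧸ LinearMap.range (T : X →ₗ[ℝ] Y))

/-- The dimension of a real vector space, as an element of `ℕ ∪ {∞}`, seen in `[-∞, ∞]`. -/
def extDim (V : Type*) [AddCommGroup V] [Module ℝ V] : EReal :=
  (((Cardinal.toENat (Module.rank ℝ V) : ℕ∞) : ENNReal) : EReal)

/-- The index `dim ker T - dim coker T ∈ ℤ ∪ {-∞, ∞}` of a semi-Fredholm operator. -/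
def semiFredholmIndex (T : X →L[ℝ] Y) : EReal :=
  extDim (LinearMap.ker (T : X →ₗ[ℝ] Y)) - extDim (Y ⧸ LinearMap.range (T : X →ₗ[ℝ] Y))

/-- The (finite) dimension of the cokernel. -/
def cokerDim (T : X →L[ℝ] Y) : ℕ :=
  Module.finrank ℝ (Y ⧸ LinearMap.range (T : X →ₗ[ℝ] Y))

/-- The index of a Fredholm operator. -/
def fredholmIndex (T : X →L[ℝ] Y) : ℤ :=
  (Module.finrank ℝ (LinearMap.ker (T : X →ₗ[ℝ] Y)) : ℤ) - (cokerDim T : ℤ)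

variable {H E : Type*}
  [NormedAddCommGroup H] [InnerProductSpace ℝ H] [CompleteSpace H]
  [NormedAddCommGroup E] [InnerProductSpace ℝ E] [CompleteSpace E]

/-- The adjoint `Y → X` of `T : X → Y` with respect to the inner products
`⟪a x, a x'⟫` on `X` and `⟪b y, b y'⟫` on `Y`. -/
def adjointVia (a : X ≃L[ℝ] H) (b : Y ≃L[ℝ] E) (T : X →L[ℝ] Y) : Y →L[ℝ] X :=
  (a.symm : H →L[ℝ] X) ∘L
    (ContinuousLinearMap.adjoint ((b : Y →L[ℝ] E) ∘L T ∘L (a.symm : H →L[ℝ] X)) : E →L[ℝ] H) ∘L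
      (b : Y →L[ℝ] E)

end Operators

/-! ### Grassmannians and essential Grassmannians of a Hilbert space -/

section Grassmannian

variable {H : Type*} [NormedAddCommGroup H] [InnerProductSpace ℝ H] [CompleteSpace H]

/-- The orthogonal projection `P_V` onto a closed subspace, as an operator on `H`. -/
def orthProj (V : ClosedSubmodule ℝ H) : H →L[ℝ] H :=
  V.toSubmodule.starProjection

/-- The Grassmannian of `H` carries the topology of the operator norm distance of the
orthogonal projections. -/
instance : TopologicalSpace (ClosedSubmodule ℝ H) :=
  TopologicalSpace.induced orthProj inferInstance

/-- `V` is a compact perturbation of `W`. -/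
def CompactPerturbation (V W : ClosedSubmodule ℝ H) : Prop :=
  IsCompactOperator (orthProj V - orthProj W)

/-- The relative dimension `dim (V, W) = dim (V ∩ W^⊥) - dim (V^⊥ ∩ W)`. Both dimensions are
finite when `V` is a compact perturbation of `W`. -/
def relDim (V W : ClosedSubmodule ℝ H) : ℤ :=
  (Module.finrank ℝ (V.toSubmodule ⊓ W.toSubmoduleᗮ : Submodule ℝ H) : ℤ) -
    (Module.finrank ℝ (V.toSubmoduleᗮ ⊓ W.toSubmodule : Submodule ℝ H) : ℤ)

/-- The equivalence relation defining the `(m)`-essential Grassmannian. -/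
def EssRel (m : ℕ) (V W : ClosedSubmodule ℝ H) : Prop :=
  CompactPerturbation V W ∧ (m : ℤ) ∣ relDim V W

variable (H) in
/-- The `(m)`-essential Grassmannian `Gr_(m)(H)`. -/
def EssGr (m : ℕ) : Type _ := Quot (EssRel (H := H) m)

/-- The quotient topology. -/
instance (m : ℕ) : TopologicalSpace (EssGr H m) :=
  inferInstanceAs (TopologicalSpace (Quot (EssRel (H := H) m)))

/-- The class `[V]` in `Gr_(m)(H)`. -/
def EssGr.mk (m : ℕ) (V : ClosedSubmodule ℝ H) : EssGr H m := Quot.mk _ V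

/-- The natural projection `Gr_(m)(H) → Gr_(1)(H)`. -/
def EssGr.forget {m : ℕ} : EssGr H m → EssGr H 1 :=
  Quot.map id fun _ _ h => ⟨h.1, by simp⟩

/-- The action of a linear isomorphism `T` on classes, `T [W] = [T W]`. The class on the right
does not depend on the representative `W`, so one may be chosen. (`ClosedSubmodule.map` takes the
closure of the image, which is the image itself when `T` is an isomorphism.) -/
def EssGr.map {m : ℕ} (T : H →L[ℝ] H) (x : EssGr H m) : EssGr H m :=
  EssGr.mk m ((Quot.out x).map T)

/-- The space of compact operators is closed. -/
instance isClosed_compactOperator :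
    IsClosed (compactOperator (RingHom.id ℝ) H H : Set (H →L[ℝ] H)) :=
  isClosed_setOfPred_isCompactOperator

variable (H) in
/-- The Calkin algebra of `H` (as a normed space): bounded operators modulo compact ones. -/
abbrev Calkin : Type _ := (H →L[ℝ] H) ⧸ compactOperator (RingHom.id ℝ) H H

/-- The map `Gr_(m)(H) → L(H) / L_c(H)`, `[V] ↦ [P_V]`. For `m = 1` it identifies `Gr_(1)(H)` with
the set of symmetric idempotents, an analytic submanifold; the analytic structure of `Gr_(m)(H)`
is the lift of that of `Gr_(1)(H)` by the covering map `Gr_(m)(H) → Gr_(1)(H)`. -/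
def EssGr.toCalkin {m : ℕ} : EssGr H m → Calkin H :=
  Quot.lift (fun V => Submodule.Quotient.mk (orthProj V)) fun _ _ h =>
    (Submodule.Quotient.eq _).2 h.1

end Grassmannian

/-! ### Essential subbundles of the tangent bundle -/

section Manifold

variable {H : Type*} [NormedAddCommGroup H] [InnerProductSpace ℝ H] [CompleteSpace H]
  {E : Type*} [NormedAddCommGroup E] [InnerProductSpace ℝ E] [CompleteSpace E]
  {M : Type*} [TopologicalSpace M] [ChartedSpace H M]
  {N : Type*} [TopologicalSpace N] [ChartedSpace E N]

/-- The differential `D f(p) : T_p M → T_{f(p)} N`. The tangent spaces of a manifold modeled on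
`H` are, as topological vector spaces, equal to `H`. -/
def diff (f : M → N) (p : M) : H →L[ℝ] E :=
  mfderiv 𝓘(ℝ, H) 𝓘(ℝ, E) f p

/-- The kernel of a bounded operator, as a point of the Grassmannian. -/
def kerGr (T : H →L[ℝ] E) : ClosedSubmodule ℝ H :=
  ⟨LinearMap.ker (T : H →ₗ[ℝ] E), T.isClosed_ker⟩

/-- The expression in the chart `φ` of a section `ℰ` of `Gr_(m)(TM)`:
`ξ ↦ Dφ(p) ℰ(p) ∈ Gr_(m)(H)`, where `p = φ⁻¹(ξ)`. -/
def localExpr {m : ℕ} (ℰ : M → EssGr H m) (φ : OpenPartialHomeomorph M H) (ξ : H) : EssGr H m :=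
  (ℰ (φ.symm ξ)).map (diff φ (φ.symm ξ))

/-- `ℰ`, which assigns to each `p` an element of `Gr_(m)(T_p M)`, is a `C^r` `(m)`-essential
subbundle of the tangent bundle of the `C^k` manifold `M`: its expression in every `C^k` chart is
a `C^r` map into `Gr_(m)(H)`. -/
def IsEssentialSubbundle (k r : ℕ∞) {m : ℕ} (ℰ : M → EssGr H m) : Prop :=
  ∀ φ ∈ IsManifold.maximalAtlas 𝓘(ℝ, H) (k : WithTop ℕ∞) M,
    ContinuousOn (localExpr ℰ φ) φ.target ∧
    ContDiffOn ℝ (r : WithTop ℕ∞) (fun ξ => (localExpr ℰ φ ξ).toCalkin) φ.target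

/-- The atlas `𝒜` is a strong integrable structure modeled on `(H, V)` for the essential
subbundle `ℰ` of `TM`. -/
structure IsStrongIntegrableStructure (k : ℕ∞) (ℰ : M → EssGr H 1) (V : ClosedSubmodule ℝ H)
    (𝒜 : Set (OpenPartialHomeomorph M H)) : Prop where
  subset_maximalAtlas : 𝒜 ⊆ IsManifold.maximalAtlas 𝓘(ℝ, H) (k : WithTop ℕ∞) M
  covers : ∀ p : M, ∃ φ ∈ 𝒜, p ∈ φ.source
  map_eq : ∀ φ ∈ 𝒜, ∀ p ∈ φ.source, (ℰ p).map (diff φ p) = EssGr.mk 1 V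
  precompact_iff : ∀ Q : H →L[ℝ] H, IsIdempotentElem Q → kerGr Q = V →
    ∀ φ ∈ 𝒜, ∀ ψ ∈ 𝒜, ∀ A : Set H, A ⊆ (ψ.symm.trans φ).source → Bornology.IsBounded A →
      (IsPrecompact (Q '' A) ↔ IsPrecompact (Q '' ((ψ.symm.trans φ) '' A)))

/-- `φ` is a `C^k` chart of `M`, with domain inside the open set `U` on which the map `f` into `N`
is considered, which is adapted to `f` and to the projector `Q` (with kernel `V`):
* `φ` has bounded image;
* `ker D(f ∘ φ⁻¹)(ξ)` is a compact perturbation of `V`, of relative dimension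
  `dim coker Df(φ⁻¹(ξ))`, for every `ξ` in the image of `φ`;
* for `A` in the image of `φ`, the set `f(φ⁻¹(A))` is pre-compact iff `Q A` is. -/
structure IsAdaptedChart (k : ℕ∞) (U : Set M) (f : M → N) (Q : H →L[ℝ] H)
    (φ : OpenPartialHomeomorph M H) : Prop where
  mem_maximalAtlas : φ ∈ IsManifold.maximalAtlas 𝓘(ℝ, H) (k : WithTop ℕ∞) M
  source_subset : φ.source ⊆ U
  isBounded_target : Bornology.IsBounded φ.target
  compactPerturbation : ∀ ξ ∈ φ.target,
    CompactPerturbation (kerGr (diff (E := E) (f ∘ φ.symm) ξ)) (kerGr Q)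
  relDim_eq : ∀ ξ ∈ φ.target,
    relDim (kerGr (diff (E := E) (f ∘ φ.symm) ξ)) (kerGr Q) =
      (cokerDim (diff (H := H) (E := E) f (φ.symm ξ)) : ℤ)
  precompact_iff : ∀ A : Set H, A ⊆ φ.target →
    (IsPrecompact (f '' (φ.symm '' A)) ↔ IsPrecompact (Q '' A))

/-- The set of all charts adapted to one of the maps `f i : U i → N i` and to the projector `Q`. -/
def adaptedAtlas {ι : Type*} {N : ι → Type*} [∀ i, TopologicalSpace (N i)]
    [∀ i, ChartedSpace E (N i)] (k : ℕ∞) (U : ι → Set M) (f : ∀ i, M → N i) (Q : H →L[ℝ] H) :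
    Set (OpenPartialHomeomorph M H) :=
  {φ | ∃ i, IsAdaptedChart (E := E) k (U i) (f i) Q φ}

end Manifold

end EssentialSubbundle

end

set_option linter.unusedSectionVars false

noncomputable section

namespace EssentialSubbundle

/-! ### The index of linear maps with finite dimensional kernel and cokernel -/

section AlgebraicIndex

variable {X Y Z : Type*} [AddCommGroup X] [Module ℝ X] [AddCommGroup Y] [Module ℝ Y]
  [AddCommGroup Z] [Module ℝ Z]

/-! Local form. Non-negativity of the index forces finite cokernels. Let `T` be the differential of
`f i` at a point, `K` its kernel and `B` a pseudo-inverse, so that `B T` is the orthogonal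
projection onto `K^⊥` and `ker B` has the dimension of the cokernel. In local coordinates `x ↦ B (f
x) + P_K x` has derivative the identity, and in the new coordinates `B ∘ f` is the linear projection
onto `K^⊥` (`exists_straightening`). As `ker B` is finite dimensional, `f` and this projection have
pre-compact images on the same sets. Choose `V ≤ K` of codimension `dim coker T`. Then `dim V` is
the common index and `V` has infinite codimension, so by separability all these `V`, at all points
and for all `i`, correspond under linear isomorphisms of `H`. This makes one projector `Q` serve
everywhere (`exists_isAdaptedChart`).

Comparison of kernels. A small piece of an affine space `ξ + ker Q` has a single point as its image
under `Q`. Hence `f i`, and by hypothesis also `f j`, maps it to a pre-compact set, which makes the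
differential of `f j` compact on the kernel of that of `f i`. Exchanging `i` and `j` and using
closed ranges, the two kernels are compact perturbations of each other
(`CompactPerturbation.of_isCompactOperator_comp`), so `ℰ` is well defined. It is constant in adapted
charts, and in any other chart it is the image of `V` under the derivative of a transition map. The
projection onto `g V` depends smoothly on `g`, which gives regularity `C^{k-1}`.

Index. With `T`, `S` the differentials of `f i`, `f j`, the operator `T S^*` factors through the
projection `(ker S)^⊥ → (ker T)^⊥`. It is thus Fredholm of index `dim (ker T, ker S) + dim coker S -
dim coker T`. The condition on relative dimension in adapted charts absorbs the cokernel terms: the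
index is the relative dimension of the two pullbacks of `V` by adapted charts for `f i` and `f j`.
All pullbacks define one class in `Gr_(m)` exactly when all these indices vanish mod `m`.

Underlying this is the description of relative dimension as the index of any operator `V → W` equal
to the inclusion of `V` modulo compact operators (`CompactPerturbation.algIndex_eq_relDim`), from
which additivity and invariance under isomorphisms follow. -/

/-- Linear maps with finite dimensional kernel and cokernel. -/
structure AlgFredholm (f : X →ₗ[ℝ] Y) : Prop where
  finite_ker : FiniteDimensional ℝ (LinearMap.ker f)
  finite_coker : FiniteDimensional ℝ (Y ⧸ LinearMap.range f)

/-- `dim ker f - dim coker f`. -/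
def algIndex (f : X →ₗ[ℝ] Y) : ℤ :=
  (Module.finrank ℝ (LinearMap.ker f) : ℤ) - (Module.finrank ℝ (Y ⧸ LinearMap.range f) : ℤ)

/-- The map `ker (g ∘ f) → Y` induced by `f`. -/
def kerCompMap (f : X →ₗ[ℝ] Y) (g : Y →ₗ[ℝ] Z) : LinearMap.ker (g ∘ₗ f) →ₗ[ℝ] Y :=
  f.domRestrict _

theorem range_kerCompMap (f : X →ₗ[ℝ] Y) (g : Y →ₗ[ℝ] Z) :
    LinearMap.range (kerCompMap f g) = LinearMap.ker g ⊓ LinearMap.range f := by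
  ext y
  constructor
  · rintro ⟨⟨x, hx⟩, rfl⟩
    exact ⟨hx, x, rfl⟩
  · rintro ⟨hy, x, rfl⟩
    exact ⟨⟨x, hy⟩, rfl⟩

theorem map_subtype_ker_kerCompMap (f : X →ₗ[ℝ] Y) (g : Y →ₗ[ℝ] Z) :
    (LinearMap.ker (kerCompMap f g)).map (LinearMap.ker (g ∘ₗ f)).subtype = LinearMap.ker f := by
  ext x
  constructor
  · rintro ⟨⟨x, hx⟩, h, rfl⟩
    exact h
  · intro hx
    have hx' : f x = 0 := hx
    exact ⟨⟨x, by simp [hx']⟩, hx', rfl⟩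

/-- The map `Y → Z / range (g ∘ f)` induced by `g`. -/
def toCokerComp (f : X →ₗ[ℝ] Y) (g : Y →ₗ[ℝ] Z) : Y →ₗ[ℝ] Z ⧸ LinearMap.range (g ∘ₗ f) :=
  (LinearMap.range (g ∘ₗ f)).mkQ ∘ₗ g

theorem ker_toCokerComp (f : X →ₗ[ℝ] Y) (g : Y →ₗ[ℝ] Z) :
    LinearMap.ker (toCokerComp f g) = LinearMap.range f ⊔ LinearMap.ker g := by
  ext y
  simp only [toCokerComp, LinearMap.mem_ker, LinearMap.comp_apply, Submodule.mkQ_apply,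
    Submodule.Quotient.mk_eq_zero, Submodule.mem_sup]
  constructor
  · rintro ⟨x, hx⟩
    exact ⟨f x, ⟨x, rfl⟩, y - f x, by simp [← hx], by abel⟩
  · rintro ⟨_, ⟨x, rfl⟩, z, hz, rfl⟩
    exact ⟨x, by simp [hz]⟩

theorem range_comp_le (f : X →ₗ[ℝ] Y) (g : Y →ₗ[ℝ] Z) :
    LinearMap.range (g ∘ₗ f) ≤ LinearMap.range g :=
  LinearMap.range_comp_le_range f g

theorem ker_factor_range (f : X →ₗ[ℝ] Y) (g : Y →ₗ[ℝ] Z) :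
    LinearMap.ker (Submodule.factor (range_comp_le f g)) = LinearMap.range (toCokerComp f g) := by
  ext z
  obtain ⟨z, rfl⟩ := Submodule.Quotient.mk_surjective _ z
  have h : Submodule.Quotient.mk z ∈ LinearMap.ker (Submodule.factor (range_comp_le f g)) ↔
      z ∈ LinearMap.range g := Submodule.Quotient.mk_eq_zero _
  rw [h]
  constructor
  · rintro ⟨y, rfl⟩
    exact ⟨y, rfl⟩
  · rintro ⟨y, hy⟩
    obtain ⟨x, hx⟩ := (Submodule.Quotient.eq _).1 hy
    exact ⟨y - f x, by rw [map_sub, ← LinearMap.comp_apply, hx]; abel⟩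

/-- The map `ker g → Y / range f`. -/
def kerToCoker (f : X →ₗ[ℝ] Y) (g : Y →ₗ[ℝ] Z) :
    LinearMap.ker g →ₗ[ℝ] Y ⧸ LinearMap.range f :=
  (LinearMap.range f).mkQ ∘ₗ (LinearMap.ker g).subtype

theorem map_subtype_ker_kerToCoker (f : X →ₗ[ℝ] Y) (g : Y →ₗ[ℝ] Z) :
    (LinearMap.ker (kerToCoker f g)).map (LinearMap.ker g).subtype =
      LinearMap.ker g ⊓ LinearMap.range f := by
  ext y
  constructor
  · rintro ⟨⟨y, hy⟩, h, rfl⟩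
    exact ⟨hy, (Submodule.Quotient.mk_eq_zero _).1 h⟩
  · rintro ⟨hy, h⟩
    exact ⟨⟨y, hy⟩, (Submodule.Quotient.mk_eq_zero _).2 h, rfl⟩

theorem ker_factor_sup (f : X →ₗ[ℝ] Y) (g : Y →ₗ[ℝ] Z) :
    LinearMap.ker (Submodule.factor
      (le_sup_left : LinearMap.range f ≤ LinearMap.range f ⊔ LinearMap.ker g)) =
      LinearMap.range (kerToCoker f g) := by
  ext z
  obtain ⟨z, rfl⟩ := Submodule.Quotient.mk_surjective _ z
  have h : Submodule.Quotient.mk z ∈ LinearMap.ker (Submodule.factor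
      (le_sup_left : LinearMap.range f ≤ LinearMap.range f ⊔ LinearMap.ker g)) ↔
      z ∈ LinearMap.range f ⊔ LinearMap.ker g := Submodule.Quotient.mk_eq_zero _
  rw [h, Submodule.mem_sup]
  constructor
  · rintro ⟨_, ⟨x, rfl⟩, y, hy, rfl⟩
    exact ⟨⟨y, hy⟩, (Submodule.Quotient.eq _).2 ⟨-x, by simp⟩⟩
  · rintro ⟨⟨y, hy⟩, h⟩
    obtain ⟨x, hx⟩ := (Submodule.Quotient.eq _).1 h
    exact ⟨f (-x), ⟨_, rfl⟩, y, hy, by rw [map_neg, hx]; simp⟩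

theorem finite_of_ker_range {f : X →ₗ[ℝ] Y} (h₁ : FiniteDimensional ℝ (LinearMap.ker f))
    (h₂ : FiniteDimensional ℝ (LinearMap.range f)) : FiniteDimensional ℝ X := by
  have : FiniteDimensional ℝ (X ⧸ LinearMap.ker f) := f.quotKerEquivRange.symm.finiteDimensional
  exact Module.Finite.of_submodule_quotient (LinearMap.ker f)

theorem AlgFredholm.comp {f : X →ₗ[ℝ] Y} {g : Y →ₗ[ℝ] Z} (hg : AlgFredholm g)
    (hf : AlgFredholm f) : AlgFredholm (g ∘ₗ f) := by
  have := hf.finite_ker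
  have := hf.finite_coker
  have := hg.finite_ker
  have := hg.finite_coker
  constructor
  · refine finite_of_ker_range (f := kerCompMap f g) ?_ ?_
    · have e := Submodule.equivMapOfInjective (LinearMap.ker (g ∘ₗ f)).subtype
        (Submodule.injective_subtype _) (LinearMap.ker (kerCompMap f g))
      rw [map_subtype_ker_kerCompMap] at e
      exact e.symm.finiteDimensional
    · rw [range_kerCompMap]
      infer_instance
  · refine finite_of_ker_range (f := Submodule.factor (range_comp_le f g)) ?_ ?_
    · rw [ker_factor_range]
      have : FiniteDimensional ℝ (Y ⧸ LinearMap.ker (toCokerComp f g)) := by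
        rw [ker_toCokerComp]
        exact Module.Finite.of_surjective _
          (Submodule.factor_surjective (le_sup_left (a := LinearMap.range f)))
      exact (toCokerComp f g).quotKerEquivRange.finiteDimensional
    · infer_instance

/-- The exact sequence `0 → ker f → ker gf → ker g → coker f → coker gf → coker g → 0`, cut into
four rank-nullity identities. The dimensions of `ker g ∩ range f`, of `Y / (range f + ker g)` and of
the image of `ker g` in `coker f` each occur twice and cancel. -/
theorem algIndex_comp {f : X →ₗ[ℝ] Y} {g : Y →ₗ[ℝ] Z} (hg : AlgFredholm g)
    (hf : AlgFredholm f) : algIndex (g ∘ₗ f) = algIndex g + algIndex f := by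
  have := (hg.comp hf).finite_ker
  have := (hg.comp hf).finite_coker
  have := hf.finite_ker
  have := hf.finite_coker
  have := hg.finite_ker
  have := hg.finite_coker
  have h1 := (kerCompMap f g).finrank_range_add_finrank_ker
  rw [← Submodule.finrank_map_subtype_eq, map_subtype_ker_kerCompMap, range_kerCompMap] at h1
  have h2 := (Submodule.factor (range_comp_le f g)).finrank_range_add_finrank_ker
  rw [ker_factor_range, ← (toCokerComp f g).quotKerEquivRange.finrank_eq, ker_toCokerComp,
    LinearMap.range_eq_top.2 (Submodule.factor_surjective _), finrank_top] at h2
  have h3 := (Submodule.factor (le_sup_left :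
    LinearMap.range f ≤ LinearMap.range f ⊔ LinearMap.ker g)).finrank_range_add_finrank_ker
  rw [ker_factor_sup, LinearMap.range_eq_top.2 (Submodule.factor_surjective _), finrank_top] at h3
  have h4 := (kerToCoker f g).finrank_range_add_finrank_ker
  rw [← Submodule.finrank_map_subtype_eq, map_subtype_ker_kerToCoker] at h4
  simp only [algIndex]
  omega

theorem AlgFredholm.of_bijective {f : X →ₗ[ℝ] Y} (hf : Function.Bijective f) : AlgFredholm f := by
  constructor
  · rw [LinearMap.ker_eq_bot.2 hf.1]
    infer_instance
  · rw [LinearMap.range_eq_top.2 hf.2]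
    infer_instance

theorem algIndex_of_surjective {f : X →ₗ[ℝ] Y} (hf : Function.Surjective f) :
    algIndex f = Module.finrank ℝ (LinearMap.ker f) := by
  have : Subsingleton (Y ⧸ LinearMap.range f) := by
    rw [Submodule.Quotient.subsingleton_iff]; exact LinearMap.range_eq_top.2 hf
  simp [algIndex, Module.finrank_zero_of_subsingleton]

theorem algIndex_of_injective {f : X →ₗ[ℝ] Y} (hf : Function.Injective f) :
    algIndex f = -(Module.finrank ℝ (Y ⧸ LinearMap.range f) : ℤ) := by
  rw [algIndex, LinearMap.ker_eq_bot.2 hf]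
  simp

theorem algIndex_of_bijective {f : X →ₗ[ℝ] Y} (hf : Function.Bijective f) : algIndex f = 0 := by
  rw [algIndex_of_surjective hf.2, LinearMap.ker_eq_bot.2 hf.1]
  simp

/-! ### Finite rank perturbations of the identity. -/

section FiniteRank

variable {F : X →ₗ[ℝ] X}

/-- The restriction of `1 + F` to the range of `F`. -/
def oneAddRestrict (F : X →ₗ[ℝ] X) : LinearMap.range F →ₗ[ℝ] LinearMap.range F :=
  LinearMap.id + F.restrict (p := LinearMap.range F) (q := LinearMap.range F)
    (fun x _ => ⟨x, rfl⟩)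

theorem coe_oneAddRestrict (x : LinearMap.range F) :
    (oneAddRestrict F x : X) = (LinearMap.id + F : X →ₗ[ℝ] X) (x : X) := by
  rfl

/-- A vector with `x + F x = 0` is `F (-x)`, so the kernel of `1 + F` already lies in the range of
`F`. -/
theorem map_subtype_ker_oneAddRestrict :
    (LinearMap.ker (oneAddRestrict F)).map (LinearMap.range F).subtype =
      LinearMap.ker (LinearMap.id + F) := by
  ext x
  constructor
  · rintro ⟨⟨x, hx⟩, h, rfl⟩
    have := congrArg Subtype.val h
    rw [coe_oneAddRestrict] at this
    exact this
  · intro hx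
    have hx' : x + F x = 0 := hx
    have hmem : x ∈ LinearMap.range F :=
      ⟨-x, by rw [map_neg]; exact (eq_neg_of_add_eq_zero_left hx').symm⟩
    exact ⟨⟨x, hmem⟩, Subtype.ext (by rw [coe_oneAddRestrict]; exact hx'), rfl⟩

/-- The map from the range of `F` to the cokernel of `1 + F`. -/
def rangeToCokerOneAdd (F : X →ₗ[ℝ] X) :
    LinearMap.range F →ₗ[ℝ] X ⧸ LinearMap.range (LinearMap.id + F) :=
  (LinearMap.range (LinearMap.id + F)).mkQ ∘ₗ (LinearMap.range F).subtype

/-- Modulo the range of `1 + F`, every `z` is congruent to `F (-z)`. -/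
theorem rangeToCokerOneAdd_surjective : Function.Surjective (rangeToCokerOneAdd F) := by
  intro z
  obtain ⟨z, rfl⟩ := Submodule.Quotient.mk_surjective _ z
  exact ⟨⟨F (-z), ⟨_, rfl⟩⟩, (Submodule.Quotient.eq _).2 ⟨-z, by simp; abel⟩⟩

theorem ker_rangeToCokerOneAdd :
    LinearMap.ker (rangeToCokerOneAdd F) = LinearMap.range (oneAddRestrict F) := by
  ext ⟨y, hy⟩
  simp only [rangeToCokerOneAdd, LinearMap.mem_ker, LinearMap.comp_apply, Submodule.mkQ_apply,
    Submodule.Quotient.mk_eq_zero, Submodule.subtype_apply, LinearMap.mem_range]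
  constructor
  · rintro ⟨x, hx⟩
    obtain ⟨z, rfl⟩ := hy
    have hx' : x + F x = F z := hx
    refine ⟨⟨x, z - x, ?_⟩, Subtype.ext ?_⟩
    · rw [map_sub, ← hx']; abel
    · rw [coe_oneAddRestrict]; exact hx
  · rintro ⟨x, hx⟩
    exact ⟨x, by rw [← coe_oneAddRestrict, hx]⟩

theorem AlgFredholm.id_add (hF : FiniteDimensional ℝ (LinearMap.range F)) :
    AlgFredholm (LinearMap.id + F) := by
  constructor
  · rw [← map_subtype_ker_oneAddRestrict]
    infer_instance
  · exact Module.Finite.of_surjective _ (rangeToCokerOneAdd_surjective (F := F))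

/-- Kernel and cokernel of `1 + F` are those of its restriction to the range of `F`, and an
endomorphism of a finite dimensional space has index zero. -/
theorem algIndex_id_add (hF : FiniteDimensional ℝ (LinearMap.range F)) :
    algIndex (LinearMap.id + F) = 0 := by
  have h1 := (oneAddRestrict F).finrank_range_add_finrank_ker
  rw [← Submodule.finrank_map_subtype_eq (LinearMap.range F) (LinearMap.ker _), map_subtype_ker_oneAddRestrict] at h1
  have h2 := (rangeToCokerOneAdd F).finrank_range_add_finrank_ker
  rw [ker_rangeToCokerOneAdd, LinearMap.range_eq_top.2 rangeToCokerOneAdd_surjective,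
    finrank_top] at h2
  simp only [algIndex]
  omega

end FiniteRank

end AlgebraicIndex

/-! ### Compact operators on Hilbert spaces and the Fredholm index -/

section CompactOperators

variable {X Y Z : Type*} [NormedAddCommGroup X] [InnerProductSpace ℝ X] [CompleteSpace X]
  [NormedAddCommGroup Y] [InnerProductSpace ℝ Y] [CompleteSpace Y]
  [NormedAddCommGroup Z] [InnerProductSpace ℝ Z] [CompleteSpace Z]

theorem isCompactOperator_of_finite_range (F : X →L[ℝ] Y)
    (hF : FiniteDimensional ℝ (LinearMap.range (F : X →ₗ[ℝ] Y))) : IsCompactOperator F := by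
  have : ProperSpace (LinearMap.range (F : X →ₗ[ℝ] Y)) := FiniteDimensional.proper ℝ _
  have h := isCompactOperator_of_locallyCompactSpace_dom
    (F.codRestrict (LinearMap.range (F : X →ₗ[ℝ] Y)) fun x => ⟨x, rfl⟩)
  exact h.clm_comp (LinearMap.range (F : X →ₗ[ℝ] Y)).subtypeL

theorem isCompactOperator_starProjection (W : Submodule ℝ Y) [FiniteDimensional ℝ W] :
    IsCompactOperator W.starProjection :=
  isCompactOperator_of_finite_range _ (by rw [Submodule.range_starProjection]; infer_instance)

/-- Compact operators into a Hilbert space are limits of operators of finite rank. -/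
theorem exists_starProjection_comp_approx {K : X →L[ℝ] Y} (hK : IsCompactOperator K)
    {ε : ℝ} (hε : 0 < ε) : ∃ W : Submodule ℝ Y, ∃ _ : FiniteDimensional ℝ W,
      ‖K - W.starProjection ∘L K‖ ≤ ε := by
  have hc := IsCompactOperator.isCompact_closure_image_closedBall (f := (K : X →ₗ[ℝ] Y)) hK 1
  obtain ⟨t, ht, hcov⟩ := Metric.totallyBounded_iff.1 hc.totallyBounded ε hε
  have hfin : FiniteDimensional ℝ (Submodule.span ℝ t) := FiniteDimensional.span_of_finite ℝ ht
  refine ⟨Submodule.span ℝ t, hfin, ContinuousLinearMap.opNorm_le_of_unit_norm hε.le ?_⟩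
  intro x hx
  have hmem : K x ∈ closure ((K : X →ₗ[ℝ] Y) '' Metric.closedBall 0 1) :=
    subset_closure ⟨x, by simp [hx], rfl⟩
  obtain ⟨y, hy, hxy⟩ := mem_iUnion₂.1 (hcov hmem)
  -- The projection of `K x` is its nearest point in the span, hence no farther away than the net
  -- point `y`.
  have hmin : ‖K x - (Submodule.span ℝ t).starProjection (K x)‖ ≤ ‖K x - y‖ := by
    rw [Submodule.starProjection_minimal]
    exact ciInf_le (f := fun z : Submodule.span ℝ t => ‖K x - z‖)
      ⟨0, by rintro _ ⟨z, rfl⟩; exact norm_nonneg _⟩ ⟨y, Submodule.subset_span hy⟩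
  exact hmin.trans (by rw [← dist_eq_norm]; exact hxy.le)

/-- Since taking adjoints is isometric, approximations `P_W K` of `K` give approximations `K^* P_W`
of `K^*`, and these have finite rank. -/
theorem isCompactOperator_adjoint {K : X →L[ℝ] Y} (hK : IsCompactOperator K) :
    IsCompactOperator (ContinuousLinearMap.adjoint K) := by
  choose W hW hWK using fun n : ℕ =>
    exists_starProjection_comp_approx hK (ε := 1 / ((n : ℝ) + 1)) (by positivity)
  refine isCompactOperator_of_tendsto (l := Filter.atTop)
    (F := fun n : ℕ => ContinuousLinearMap.adjoint K ∘L
      (haveI := hW n; (W n).starProjection)) ?_ (Filter.Eventually.of_forall fun n => ?_)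
  · rw [tendsto_iff_norm_sub_tendsto_zero]
    refine squeeze_zero (fun _ => norm_nonneg _) (fun n => ?_) tendsto_one_div_add_atTop_nhds_zero_nat
    have := hW n
    have h : ContinuousLinearMap.adjoint K ∘L (W n).starProjection - ContinuousLinearMap.adjoint K
        = - ContinuousLinearMap.adjoint (K - (W n).starProjection ∘L K) := by
      rw [map_sub, ContinuousLinearMap.adjoint_comp,
        (isSelfAdjoint_starProjection (W n)).adjoint_eq]
      abel
    rw [h, norm_neg, LinearIsometryEquiv.norm_map]
    exact hWK n
  · have := hW n
    exact (isCompactOperator_starProjection (W n)).clm_comp (ContinuousLinearMap.adjoint K)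

/-- With `R = K - P_W K` of norm at most `1/2`, the operator `U = 1 + R` is invertible and `1 + K =
U (1 + U⁻¹ P_W K)`. This reduces the claim to finite rank perturbations of the identity. -/
theorem algFredholm_id_add_compact {K : X →L[ℝ] X} (hK : IsCompactOperator K) :
    AlgFredholm (LinearMap.id + (K : X →ₗ[ℝ] X)) ∧
      algIndex (LinearMap.id + (K : X →ₗ[ℝ] X)) = 0 := by
  obtain ⟨W, hW, hWK⟩ := exists_starProjection_comp_approx hK (ε := 1 / 2) (by norm_num)
  set R : X →L[ℝ] X := K - W.starProjection ∘L K with hR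
  have hR1 : ‖-R‖ < 1 := by rw [norm_neg]; linarith
  set u : (X →L[ℝ] X)ˣ := Units.oneSub (-R) hR1 with hu
  set U : X ≃L[ℝ] X := ContinuousLinearEquiv.ofUnit u
  have hU : ∀ x, U x = x + R x := by
    intro x
    change (u : X →L[ℝ] X) x = _
    simp [hu]
  set F : X →ₗ[ℝ] X := (U.symm : X →ₗ[ℝ] X) ∘ₗ (W.starProjection : X →ₗ[ℝ] X) ∘ₗ (K : X →ₗ[ℝ] X)
    with hF
  have hfin : FiniteDimensional ℝ (LinearMap.range F) := by
    have h1 : FiniteDimensional ℝ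
        (LinearMap.range ((W.starProjection : X →ₗ[ℝ] X) ∘ₗ (K : X →ₗ[ℝ] X))) :=
      Submodule.finiteDimensional_of_le (S₂ := W) (by
        rintro _ ⟨x, rfl⟩
        exact W.starProjection_apply_mem _)
    rw [hF, LinearMap.range_comp]
    infer_instance
  have hcomp : LinearMap.id + (K : X →ₗ[ℝ] X) = (U : X →ₗ[ℝ] X) ∘ₗ (LinearMap.id + F) := by
    ext x
    have h1 : U (F x) = W.starProjection (K x) := U.apply_symm_apply _
    have h2 : (U : X →ₗ[ℝ] X) (F x) = U (F x) := rfl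
    have h3 : (U : X →ₗ[ℝ] X) x = U x := rfl
    simp only [LinearMap.add_apply, LinearMap.id_apply, LinearMap.comp_apply, map_add]
    rw [h2, h3, h1, hU]
    simp [hR]
    abel
  have hUb : Function.Bijective (U : X →ₗ[ℝ] X) := U.bijective
  rw [hcomp]
  refine ⟨(AlgFredholm.of_bijective hUb).comp (AlgFredholm.id_add hfin), ?_⟩
  rw [algIndex_comp (AlgFredholm.of_bijective hUb) (AlgFredholm.id_add hfin),
    algIndex_of_bijective hUb, algIndex_id_add hfin, add_zero]

/-- `S` is an inverse of `T` modulo compact operators. -/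
structure IsEssInverse (S : Y →L[ℝ] X) (T : X →L[ℝ] Y) : Prop where
  left : IsCompactOperator (S ∘L T - ContinuousLinearMap.id ℝ X)
  right : IsCompactOperator (T ∘L S - ContinuousLinearMap.id ℝ Y)

theorem IsEssInverse.symm {S : Y →L[ℝ] X} {T : X →L[ℝ] Y} (h : IsEssInverse S T) :
    IsEssInverse T S := ⟨h.right, h.left⟩

theorem IsEssInverse.algFredholm_comp {S : Y →L[ℝ] X} {T : X →L[ℝ] Y} (h : IsEssInverse S T) :
    AlgFredholm ((S : Y →ₗ[ℝ] X) ∘ₗ (T : X →ₗ[ℝ] Y)) ∧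
      algIndex ((S : Y →ₗ[ℝ] X) ∘ₗ (T : X →ₗ[ℝ] Y)) = 0 := by
  have h1 := algFredholm_id_add_compact h.left
  have h2 : LinearMap.id + ((S ∘L T - ContinuousLinearMap.id ℝ X : X →L[ℝ] X) : X →ₗ[ℝ] X) =
      (S : Y →ₗ[ℝ] X) ∘ₗ (T : X →ₗ[ℝ] Y) := by
    ext x
    simp
  rwa [h2] at h1

/-- The kernel of `T` lies in that of `S T`, and the cokernel of `T` is a quotient of that of `T S`.
-/
theorem IsEssInverse.algFredholm {S : Y →L[ℝ] X} {T : X →L[ℝ] Y} (h : IsEssInverse S T) :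
    AlgFredholm (T : X →ₗ[ℝ] Y) := by
  have h1 := h.algFredholm_comp.1.finite_ker
  have h2 := h.symm.algFredholm_comp.1.finite_coker
  constructor
  · exact Submodule.finiteDimensional_of_le (LinearMap.ker_le_ker_comp (T : X →ₗ[ℝ] Y) (S : Y →ₗ[ℝ] X))
  · exact Module.Finite.of_surjective _ (Submodule.factor_surjective
      (LinearMap.range_comp_le_range (S : Y →ₗ[ℝ] X) (T : X →ₗ[ℝ] Y)))

theorem IsEssInverse.algIndex_add {S : Y →L[ℝ] X} {T : X →L[ℝ] Y} (h : IsEssInverse S T) :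
    algIndex (S : Y →ₗ[ℝ] X) + algIndex (T : X →ₗ[ℝ] Y) = 0 := by
  rw [← algIndex_comp h.symm.algFredholm h.algFredholm, h.algFredholm_comp.2]

theorem IsEssInverse.of_compact_sub {S : Y →L[ℝ] X} {T T' : X →L[ℝ] Y} (h : IsEssInverse S T)
    (hT : IsCompactOperator (T' - T)) : IsEssInverse S T' := by
  constructor
  · refine cast (congrArg IsCompactOperator ?_) ((hT.clm_comp S).add h.left)
    funext x
    simp
  · refine cast (congrArg IsCompactOperator ?_) ((hT.comp_clm S).add h.right)
    funext x
    simp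

/-- The index is invariant under compact perturbations. -/
theorem IsEssInverse.algIndex_eq {S : Y →L[ℝ] X} {T T' : X →L[ℝ] Y} (h : IsEssInverse S T)
    (hT : IsCompactOperator (T' - T)) :
    algIndex (T' : X →ₗ[ℝ] Y) = algIndex (T : X →ₗ[ℝ] Y) := by
  -- `S` is an essential inverse of both operators, so both indices equal minus that of `S`.
  have h1 := h.algIndex_add
  have h2 := (h.of_compact_sub hT).algIndex_add
  omega

/-- Restricted to the orthogonal complement of its kernel, `T` is injective with the same range, and
this range has a finite dimensional, hence closed, algebraic complement. -/
theorem AlgFredholm.isClosed_range {T : X →L[ℝ] Y} (hT : AlgFredholm (T : X →ₗ[ℝ] Y)) :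
    IsClosed (LinearMap.range (T : X →ₗ[ℝ] Y) : Set Y) := by
  have := hT.finite_coker
  set A := (LinearMap.ker (T : X →ₗ[ℝ] Y))ᗮ with hA
  have : (LinearMap.ker (T : X →ₗ[ℝ] Y)).HasOrthogonalProjection :=
    haveI := T.isClosed_ker.completeSpace_coe; inferInstance
  have hrange : LinearMap.range ((T ∘L A.subtypeL : A →L[ℝ] Y) : A →ₗ[ℝ] Y) =
      LinearMap.range (T : X →ₗ[ℝ] Y) := by
    apply le_antisymm
    · rintro _ ⟨x, rfl⟩
      exact ⟨x, rfl⟩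
    · rintro _ ⟨x, rfl⟩
      obtain ⟨y, hy, z, hz, rfl⟩ :=
        (LinearMap.ker (T : X →ₗ[ℝ] Y)).exists_add_mem_mem_orthogonal x
      have hy' : T y = 0 := hy
      exact ⟨⟨z, hz⟩, by simp [hy']⟩
  obtain ⟨C, hC⟩ := Submodule.exists_isCompl (LinearMap.range (T : X →ₗ[ℝ] Y))
  have hCfin : FiniteDimensional ℝ C :=
    (Submodule.quotientEquivOfIsCompl _ _ hC).finiteDimensional
  rw [← hrange] at hC ⊢
  refine ContinuousLinearMap.closed_complemented_range_of_isCompl_of_ker_eq_bot _ C hC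
    C.closed_of_finiteDimensional ?_
  rw [LinearMap.ker_eq_bot']
  rintro ⟨x, hx⟩ h
  have h' : x ∈ LinearMap.ker (T : X →ₗ[ℝ] Y) := h
  exact Subtype.ext (inner_self_eq_zero.1 (hx x h'))

/-- Between the orthogonal complement of the kernel and the range, both closed of finite
codimension, `T` restricts to an isomorphism. -/
theorem AlgFredholm.isFredholm {T : X →L[ℝ] Y} (hT : AlgFredholm (T : X →ₗ[ℝ] Y)) :
    T.IsFredholm := by
  have hker := hT.finite_ker
  have hcoker := hT.finite_coker
  have hcl := hT.isClosed_range
  have := hcl.completeSpace_coe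
  have hmaps : MapsTo T ((LinearMap.ker (T : X →ₗ[ℝ] Y))ᗮ : Submodule ℝ X)
      (LinearMap.range (T : X →ₗ[ℝ] Y)) := fun x _ => ⟨x, rfl⟩
  have : (LinearMap.ker (T : X →ₗ[ℝ] Y))ᗮ.CoFG := by
    exact (Submodule.quotientEquivOfIsCompl _ _
      (Submodule.isCompl_orthogonal (K := LinearMap.ker (T : X →ₗ[ℝ] Y))).symm).symm.finiteDimensional
  refine ContinuousLinearMap.IsFredholm.of_isInvertible_restrict
    (Submodule.isClosed_orthogonal (LinearMap.ker (T : X →ₗ[ℝ] Y))) hcl hmaps ?_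
  have hinj : LinearMap.ker (T.restrict hmaps).toLinearMap = ⊥ := by
    rw [LinearMap.ker_eq_bot']
    rintro ⟨x, hx⟩ h
    have h' : x ∈ LinearMap.ker (T : X →ₗ[ℝ] Y) := congrArg Subtype.val h
    exact Subtype.ext (inner_self_eq_zero.1 (hx x h'))
  have hsurj : LinearMap.range (T.restrict hmaps).toLinearMap = ⊤ := by
    rw [LinearMap.range_eq_top]
    rintro ⟨_, x, rfl⟩
    obtain ⟨y, hy, z, hz, rfl⟩ :=
      (LinearMap.ker (T : X →ₗ[ℝ] Y)).exists_add_mem_mem_orthogonal x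
    have hy' : T y = 0 := hy
    exact ⟨⟨z, hz⟩, Subtype.ext (by
      change T z = T (y + z)
      simp [hy'])⟩
  exact ⟨ContinuousLinearEquiv.ofBijective _ hinj hsurj, by ext; rfl⟩

theorem finrank_coker_eq_ker_adjoint {T : X →L[ℝ] Y}
    (hT : IsClosed (LinearMap.range (T : X →ₗ[ℝ] Y) : Set Y)) :
    Module.finrank ℝ (Y ⧸ LinearMap.range (T : X →ₗ[ℝ] Y)) =
      Module.finrank ℝ (LinearMap.ker (ContinuousLinearMap.adjoint T : Y →ₗ[ℝ] X)) := by
  have := hT.completeSpace_coe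
  rw [(Submodule.quotientEquivOfIsCompl _ _
    (Submodule.isCompl_orthogonal (K := LinearMap.range (T : X →ₗ[ℝ] Y)))).finrank_eq]
  rw [T.orthogonal_range]

end CompactOperators

/-! ### Compact perturbations and relative dimension -/

section RelativeDimension

variable {H : Type*} [NormedAddCommGroup H] [InnerProductSpace ℝ H] [CompleteSpace H]

instance completeSpace_toSubmodule (V : ClosedSubmodule ℝ H) : CompleteSpace V.toSubmodule :=
  V.isClosed.completeSpace_coe

theorem orthProj_mem (V : ClosedSubmodule ℝ H) (x : H) : orthProj V x ∈ V.toSubmodule :=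
  V.toSubmodule.starProjection_apply_mem x

theorem orthProj_of_mem {V : ClosedSubmodule ℝ H} {x : H} (hx : x ∈ V.toSubmodule) :
    orthProj V x = x :=
  Submodule.starProjection_eq_self_iff.2 hx

theorem orthProj_orthProj (V : ClosedSubmodule ℝ H) (x : H) :
    orthProj V (orthProj V x) = orthProj V x :=
  orthProj_of_mem (orthProj_mem V x)

theorem adjoint_orthProj (V : ClosedSubmodule ℝ H) :
    ContinuousLinearMap.adjoint (orthProj V) = orthProj V :=
  (isSelfAdjoint_starProjection V.toSubmodule).adjoint_eq

theorem isCompactOperator_congr {X Y : Type*} [TopologicalSpace X] [TopologicalSpace Y] [Zero X]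
    {f g : X → Y} (hf : IsCompactOperator f) (h : ∀ x, f x = g x) : IsCompactOperator g :=
  funext h ▸ hf

theorem CompactPerturbation.refl (V : ClosedSubmodule ℝ H) : CompactPerturbation V V := by
  simpa [CompactPerturbation] using isCompactOperator_zero

theorem CompactPerturbation.symm {V W : ClosedSubmodule ℝ H} (h : CompactPerturbation V W) :
    CompactPerturbation W V :=
  isCompactOperator_congr (IsCompactOperator.neg h) (by simp)

theorem CompactPerturbation.trans {V W Z : ClosedSubmodule ℝ H} (h : CompactPerturbation V W)
    (h' : CompactPerturbation W Z) : CompactPerturbation V Z :=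
  isCompactOperator_congr (IsCompactOperator.add h h') (by simp)

theorem CompactPerturbation.compact_on {V W : ClosedSubmodule ℝ H} (h : CompactPerturbation V W) :
    IsCompactOperator (orthProj V - orthProj W ∘L orthProj V) := by
  refine isCompactOperator_congr (IsCompactOperator.comp_clm h (orthProj V)) fun x => ?_
  simp [orthProj_orthProj]

/-- Subtracting the adjoint `P_W - P_W P_V` of the second operator from the first, `P_V - P_W P_V`,
leaves `P_V - P_W`. These one-sided conditions are easier to verify than the symmetric one. -/
theorem CompactPerturbation.of_compact_on {V W : ClosedSubmodule ℝ H}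
    (h₁ : IsCompactOperator (orthProj V - orthProj W ∘L orthProj V))
    (h₂ : IsCompactOperator (orthProj W - orthProj V ∘L orthProj W)) :
    CompactPerturbation V W := by
  have h₃ := isCompactOperator_adjoint h₂
  rw [map_sub, ContinuousLinearMap.adjoint_comp, adjoint_orthProj, adjoint_orthProj] at h₃
  exact isCompactOperator_congr (h₁.sub h₃) (by simp)

/-- The orthogonal projection of `V` to `W`. -/
def transfer (V W : ClosedSubmodule ℝ H) : V.toSubmodule →L[ℝ] W.toSubmodule :=
  W.toSubmodule.orthogonalProjectionOnto ∘L V.toSubmodule.subtypeL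

theorem adjoint_transfer (V W : ClosedSubmodule ℝ H) :
    ContinuousLinearMap.adjoint (transfer V W) = transfer W V := by
  rw [transfer, ContinuousLinearMap.adjoint_comp, Submodule.adjoint_subtypeL,
    Submodule.adjoint_orthogonalProjectionOnto, transfer]

/-- For `x` in `V` one has `P_V P_W x - x = P_V (P_W - P_V) x`, and likewise with `V` and `W`
exchanged. -/
theorem CompactPerturbation.isEssInverse {V W : ClosedSubmodule ℝ H}
    (h : CompactPerturbation V W) : IsEssInverse (transfer W V) (transfer V W) := by
  have aux : ∀ {V W : ClosedSubmodule ℝ H}, CompactPerturbation V W →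
      IsCompactOperator (transfer W V ∘L transfer V W - ContinuousLinearMap.id ℝ V.toSubmodule) := by
    intro V W h
    have h1 := (IsCompactOperator.comp_clm h.symm V.toSubmodule.subtypeL).clm_comp
      V.toSubmodule.orthogonalProjectionOnto
    refine isCompactOperator_congr h1 fun x => Subtype.ext ?_
    change orthProj V (orthProj W x - orthProj V x) = orthProj V (orthProj W x) - x
    rw [map_sub, orthProj_orthProj, orthProj_of_mem x.2]
  exact ⟨aux h, aux h.symm⟩

theorem map_subtype_ker_transfer (V W : ClosedSubmodule ℝ H) :
    (LinearMap.ker (transfer V W : V.toSubmodule →ₗ[ℝ] W.toSubmodule)).map V.toSubmodule.subtype =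
      V.toSubmodule ⊓ W.toSubmoduleᗮ := by
  have key : ∀ x : V.toSubmodule, transfer V W x = 0 ↔ (x : H) ∈ W.toSubmoduleᗮ := fun x =>
    Submodule.orthogonalProjectionOnto_eq_zero_iff (K := W.toSubmodule) (v := (x : H))
  ext x
  constructor
  · rintro ⟨⟨x, hx⟩, h, rfl⟩
    exact ⟨hx, (key _).1 h⟩
  · rintro ⟨hx, h⟩
    exact ⟨⟨x, hx⟩, (key ⟨x, hx⟩).2 h, rfl⟩

/-- The kernel is `V ∩ W^⊥`; the cokernel has the dimension of the kernel of the adjoint, which is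
the projection `W → V`, namely of `W ∩ V^⊥`. -/
theorem CompactPerturbation.algIndex_transfer {V W : ClosedSubmodule ℝ H}
    (h : CompactPerturbation V W) :
    algIndex (transfer V W : V.toSubmodule →ₗ[ℝ] W.toSubmodule) = relDim V W := by
  rw [algIndex, finrank_coker_eq_ker_adjoint h.isEssInverse.algFredholm.isClosed_range,
    adjoint_transfer, ← Submodule.finrank_map_subtype_eq,
    ← Submodule.finrank_map_subtype_eq W.toSubmodule, map_subtype_ker_transfer,
    map_subtype_ker_transfer, relDim, inf_comm W.toSubmodule]

/-- The relative dimension is the index of any operator `V → W` which is, modulo compact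
operators, the inclusion of `V`. -/
theorem CompactPerturbation.algIndex_eq_relDim {V W : ClosedSubmodule ℝ H}
    (h : CompactPerturbation V W) (S : V.toSubmodule →L[ℝ] W.toSubmodule)
    (hS : IsCompactOperator (W.toSubmodule.subtypeL ∘L S - V.toSubmodule.subtypeL)) :
    algIndex (S : V.toSubmodule →ₗ[ℝ] W.toSubmodule) = relDim V W := by
  rw [← h.algIndex_transfer]
  refine h.isEssInverse.algIndex_eq
    (isCompactOperator_congr (hS.clm_comp W.toSubmodule.orthogonalProjectionOnto) fun x => ?_)
  refine Subtype.ext ?_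
  change orthProj W ((S x : H) - x) = S x - orthProj W x
  rw [map_sub, orthProj_of_mem (S x).2]

/-- The composite of the projections `V → W → Z` need not be the projection `V → Z`, but it too is
the inclusion of `V` modulo compact operators. Additivity is therefore that of the index. -/
theorem CompactPerturbation.relDim_add {V W Z : ClosedSubmodule ℝ H}
    (h : CompactPerturbation V W) (h' : CompactPerturbation W Z) :
    relDim V Z = relDim V W + relDim W Z := by
  have hS : IsCompactOperator (Z.toSubmodule.subtypeL ∘L (transfer W Z ∘L transfer V W) -
      V.toSubmodule.subtypeL) := by
    have h1 := IsCompactOperator.comp_clm h'.symm (orthProj W ∘L V.toSubmodule.subtypeL)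
    have h2 := IsCompactOperator.comp_clm h.symm V.toSubmodule.subtypeL
    refine isCompactOperator_congr (h1.add h2) fun x => ?_
    change orthProj Z (orthProj W x) - orthProj W (orthProj W x) +
      (orthProj W x - orthProj V x) = orthProj Z (orthProj W x) - x
    rw [orthProj_orthProj, orthProj_of_mem x.2]
    abel
  have h3 := (h.trans h').algIndex_eq_relDim _ hS
  rw [← h3, ContinuousLinearMap.toLinearMap_comp, algIndex_comp h'.isEssInverse.algFredholm
    h.isEssInverse.algFredholm, h.algIndex_transfer, h'.algIndex_transfer, add_comm]

theorem relDim_symm (V W : ClosedSubmodule ℝ H) : relDim W V = -relDim V W := by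
  rw [relDim, relDim, inf_comm W.toSubmodule, inf_comm W.toSubmoduleᗮ]
  ring

theorem relDim_self (V : ClosedSubmodule ℝ H) : relDim V V = 0 := by
  have := relDim_symm V V
  omega

theorem toSubmodule_map_equiv (g : H ≃L[ℝ] H) (V : ClosedSubmodule ℝ H) :
    (V.map (g : H →L[ℝ] H)).toSubmodule = V.toSubmodule.map ((g : H →L[ℝ] H) : H →ₗ[ℝ] H) := by
  have hcl : IsClosed ((V.toSubmodule.map ((g : H →L[ℝ] H) : H →ₗ[ℝ] H) : Submodule ℝ H) : Set H) :=
    (V.mapEquiv g).isClosed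
  exact hcl.submodule_topologicalClosure_eq

theorem mem_map_equiv (g : H ≃L[ℝ] H) (V : ClosedSubmodule ℝ H) (x : H) :
    x ∈ (V.map (g : H →L[ℝ] H)).toSubmodule ↔ g.symm x ∈ V.toSubmodule := by
  rw [toSubmodule_map_equiv]
  exact Submodule.mem_map_equiv (e := g.toLinearEquiv) V.toSubmodule

theorem map_map_equiv (g g' : H ≃L[ℝ] H) (V : ClosedSubmodule ℝ H) :
    (V.map (g : H →L[ℝ] H)).map (g' : H →L[ℝ] H) = V.map ((g.trans g' : H ≃L[ℝ] H) : H →L[ℝ] H) := by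
  apply ClosedSubmodule.toSubmodule_injective
  ext x
  rw [mem_map_equiv, mem_map_equiv, mem_map_equiv]
  rfl

/-- Conjugating `P_V` by `g` does not give an orthogonal projection, so the one-sided criterion is
used: `P_{gV} - P_{gW} P_{gV} = (1 - P_{gW}) g (P_V - P_W P_V) g⁻¹ P_{gV}`. -/
theorem CompactPerturbation.map {V W : ClosedSubmodule ℝ H} (h : CompactPerturbation V W)
    (g : H ≃L[ℝ] H) :
    CompactPerturbation (V.map (g : H →L[ℝ] H)) (W.map (g : H →L[ℝ] H)) := by
  have aux : ∀ {V W : ClosedSubmodule ℝ H}, CompactPerturbation V W →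
      IsCompactOperator (orthProj (V.map (g : H →L[ℝ] H)) -
        orthProj (W.map (g : H →L[ℝ] H)) ∘L orthProj (V.map (g : H →L[ℝ] H))) := by
    intro V W h
    have h1 := (h.compact_on.comp_clm
      ((g.symm : H →L[ℝ] H) ∘L orthProj (V.map (g : H →L[ℝ] H)))).clm_comp
      ((ContinuousLinearMap.id ℝ H - orthProj (W.map (g : H →L[ℝ] H))) ∘L (g : H →L[ℝ] H))
    refine isCompactOperator_congr h1 fun x => ?_
    have hv : g.symm (orthProj (V.map (g : H →L[ℝ] H)) x) ∈ V.toSubmodule :=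
      (mem_map_equiv g V _).1 (orthProj_mem _ _)
    have hw : ∀ y, orthProj (W.map (g : H →L[ℝ] H)) (g (orthProj W y)) = g (orthProj W y) :=
      fun y => orthProj_of_mem ((mem_map_equiv g W _).2 (by simpa using orthProj_mem W y))
    simp [orthProj_of_mem hv, hw]
  exact .of_compact_on (aux h) (aux h.symm)

/-- The restriction of a linear isomorphism to a closed subspace and its image. -/
def mapRestrict (g : H ≃L[ℝ] H) (V : ClosedSubmodule ℝ H) :
    V.toSubmodule →L[ℝ] (V.map (g : H →L[ℝ] H)).toSubmodule :=
  ((g : H →L[ℝ] H) ∘L V.toSubmodule.subtypeL).codRestrict _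
    fun x => (mem_map_equiv g V _).2 (by simp)

/-- The inverse of `mapRestrict`. -/
def mapRestrictInv (g : H ≃L[ℝ] H) (V : ClosedSubmodule ℝ H) :
    (V.map (g : H →L[ℝ] H)).toSubmodule →L[ℝ] V.toSubmodule :=
  ((g.symm : H →L[ℝ] H) ∘L (V.map (g : H →L[ℝ] H)).toSubmodule.subtypeL).codRestrict _
    fun x => (mem_map_equiv g V _).1 x.2

theorem mapRestrict_bijective (g : H ≃L[ℝ] H) (V : ClosedSubmodule ℝ H) :
    Function.Bijective (mapRestrict g V) ∧ Function.Bijective (mapRestrictInv g V) := by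
  have h1 : Function.LeftInverse (mapRestrictInv g V) (mapRestrict g V) :=
    fun x => Subtype.ext (g.symm_apply_apply (x : H))
  have h2 : Function.RightInverse (mapRestrictInv g V) (mapRestrict g V) :=
    fun x => Subtype.ext (g.apply_symm_apply (x : H))
  exact ⟨⟨h1.injective, h2.surjective⟩, ⟨h2.injective, h1.surjective⟩⟩

/-- The conjugate by `g` of the projection `V → W` is again the inclusion modulo compact operators
and has the same index. -/
theorem CompactPerturbation.relDim_map {V W : ClosedSubmodule ℝ H} (h : CompactPerturbation V W)
    (g : H ≃L[ℝ] H) :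
    relDim (V.map (g : H →L[ℝ] H)) (W.map (g : H →L[ℝ] H)) = relDim V W := by
  have hS : IsCompactOperator ((W.map (g : H →L[ℝ] H)).toSubmodule.subtypeL ∘L
      (mapRestrict g W ∘L transfer V W ∘L mapRestrictInv g V) -
      (V.map (g : H →L[ℝ] H)).toSubmodule.subtypeL) := by
    have h1 := (IsCompactOperator.comp_clm h.symm
      (V.toSubmodule.subtypeL ∘L mapRestrictInv g V)).clm_comp (g : H →L[ℝ] H)
    refine isCompactOperator_congr h1 fun x => ?_
    change g (orthProj W (mapRestrictInv g V x : H) - orthProj V (mapRestrictInv g V x : H)) =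
      g (orthProj W (mapRestrictInv g V x : H)) - x
    rw [orthProj_of_mem (mapRestrictInv g V x).2, map_sub]
    congr 1
    exact g.apply_symm_apply (x : H)
  have hb : ∀ U : ClosedSubmodule ℝ H, Function.Bijective (mapRestrict g U).toLinearMap :=
    fun U => (mapRestrict_bijective g U).1
  have hb' : ∀ U : ClosedSubmodule ℝ H, Function.Bijective (mapRestrictInv g U).toLinearMap :=
    fun U => (mapRestrict_bijective g U).2
  rw [← (h.map g).algIndex_eq_relDim _ hS, ContinuousLinearMap.toLinearMap_comp,
    ContinuousLinearMap.toLinearMap_comp,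
    algIndex_comp (.of_bijective (hb W)) (h.isEssInverse.algFredholm.comp (.of_bijective (hb' V))),
    algIndex_comp h.isEssInverse.algFredholm (.of_bijective (hb' V)),
    algIndex_of_bijective (hb W), algIndex_of_bijective (hb' V), h.algIndex_transfer]
  ring

theorem CompactPerturbation.of_le {V W : ClosedSubmodule ℝ H} (h : V ≤ W)
    (hfin : FiniteDimensional ℝ (V.toSubmoduleᗮ ⊓ W.toSubmodule : Submodule ℝ H)) :
    CompactPerturbation V W := by
  refine .of_compact_on ?_ (isCompactOperator_of_finite_range _ ?_)
  · refine isCompactOperator_congr isCompactOperator_zero fun x => ?_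
    simp [orthProj_of_mem (V := W) (h (orthProj_mem V x))]
  · refine Submodule.finiteDimensional_of_le
      (S₂ := (V.toSubmoduleᗮ ⊓ W.toSubmodule : Submodule ℝ H)) ?_
    rintro _ ⟨x, rfl⟩
    refine ⟨V.toSubmodule.sub_starProjection_mem_orthogonal _, ?_⟩
    exact Submodule.sub_mem _ (orthProj_mem W x) (h (orthProj_mem V _))

theorem relDim_of_le {V W : ClosedSubmodule ℝ H} (h : V ≤ W) :
    relDim V W = -(Module.finrank ℝ (V.toSubmoduleᗮ ⊓ W.toSubmodule : Submodule ℝ H) : ℤ) := by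
  have h1 : V.toSubmodule ⊓ W.toSubmoduleᗮ = ⊥ := by
    rw [eq_bot_iff]
    rintro x ⟨hx, hx'⟩
    exact inner_self_eq_zero.1 (hx' x (h hx))
  rw [relDim, h1]
  simp

end RelativeDimension

/-! ### Essential Grassmannians -/

section EssentialGrassmannian

variable {H : Type*} [NormedAddCommGroup H] [InnerProductSpace ℝ H] [CompleteSpace H] {m : ℕ}

/-- Transitivity rests on the additivity of relative dimension. Knowing that the relation is an
equivalence, equality of classes can be read back as the relation itself. -/
theorem essRel_equivalence (m : ℕ) : Equivalence (EssRel (H := H) m) where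
  refl V := ⟨.refl V, by simp [relDim_self]⟩
  symm h := ⟨h.1.symm, by rw [relDim_symm]; exact (dvd_neg).2 h.2⟩
  trans h h' := ⟨h.1.trans h'.1, by rw [h.1.relDim_add h'.1]; exact dvd_add h.2 h'.2⟩

theorem EssGr.mk_eq_mk {V W : ClosedSubmodule ℝ H} :
    EssGr.mk m V = EssGr.mk m W ↔ EssRel m V W :=
  (essRel_equivalence m).quot_mk_eq_iff V W

theorem EssGr.mk_surjective (x : EssGr H m) : ∃ V, EssGr.mk m V = x := Quot.exists_rep x

theorem EssRel.map {V W : ClosedSubmodule ℝ H} (h : EssRel m V W) (g : H ≃L[ℝ] H) :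
    EssRel m (V.map (g : H →L[ℝ] H)) (W.map (g : H →L[ℝ] H)) :=
  ⟨h.1.map g, by rw [h.1.relDim_map g]; exact h.2⟩

theorem EssGr.map_mk (g : H ≃L[ℝ] H) (V : ClosedSubmodule ℝ H) :
    (EssGr.mk m V).map (g : H →L[ℝ] H) = EssGr.mk m (V.map (g : H →L[ℝ] H)) := by
  refine EssGr.mk_eq_mk.2 (EssRel.map ?_ g)
  exact EssGr.mk_eq_mk.1 (Quot.out_eq (EssGr.mk m V))

theorem EssGr.map_map (g g' : H ≃L[ℝ] H) (x : EssGr H m) :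
    (x.map (g : H →L[ℝ] H)).map (g' : H →L[ℝ] H) =
      x.map ((g.trans g' : H ≃L[ℝ] H) : H →L[ℝ] H) := by
  obtain ⟨V, rfl⟩ := x.mk_surjective
  rw [map_mk, map_mk, map_mk, map_map_equiv]

theorem EssGr.map_symm_eq_iff (g : H ≃L[ℝ] H) (x y : EssGr H m) :
    x = y.map (g.symm : H →L[ℝ] H) ↔ x.map (g : H →L[ℝ] H) = y := by
  have hid : ∀ z : EssGr H m, z.map (ContinuousLinearMap.id ℝ H) = z := by
    intro z
    obtain ⟨V, rfl⟩ := z.mk_surjective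
    have := map_mk (m := m) (ContinuousLinearEquiv.refl ℝ H) V
    rw [show ((ContinuousLinearEquiv.refl ℝ H : H ≃L[ℝ] H) : H →L[ℝ] H) =
      ContinuousLinearMap.id ℝ H from rfl] at this
    rw [this, ClosedSubmodule.map_id]
  constructor
  · rintro rfl
    rw [map_map, ContinuousLinearEquiv.symm_trans_self]
    exact hid y
  · rintro rfl
    rw [map_map, ContinuousLinearEquiv.self_trans_symm]
    exact (hid x).symm

theorem EssGr.forget_mk (V : ClosedSubmodule ℝ H) : (EssGr.mk m V).forget = EssGr.mk 1 V := rfl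

theorem EssGr.continuous_mk : Continuous (EssGr.mk (H := H) m) := continuous_quot_mk

end EssentialGrassmannian

/-! ### Smooth dependence of the orthogonal projections -/

section SmoothProjections

variable {H : Type*} [NormedAddCommGroup H] [InnerProductSpace ℝ H] [CompleteSpace H]
  {G : Type*} [NormedAddCommGroup G] [NormedSpace ℝ G]

variable (H) in
/-- The adjoint, as a bounded linear map. -/
def adjointCLM : (H →L[ℝ] H) →L[ℝ] (H →L[ℝ] H) :=
  LinearMap.mkContinuous
    { toFun := fun T => ContinuousLinearMap.adjoint T
      map_add' := fun S T => map_add _ S T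
      map_smul' := fun c T => by simp } 1
    (fun T => by simp)

/-- The operator `P T^* T P + (1 - P)`. -/
def gramOp (P T : H →L[ℝ] H) : H →L[ℝ] H :=
  P * adjointCLM H T * T * P + (1 - P)

/-- The summand `1 - P` makes the quadratic form control all of `H` and not only `V`, so that
inversion takes place in the algebra of operators on `H`. -/
theorem inner_gramOp (V : ClosedSubmodule ℝ H) (T : H →L[ℝ] H) (x : H) :
    inner ℝ (gramOp (orthProj V) T x) x =
      ‖T (orthProj V x)‖ ^ 2 + ‖x - orthProj V x‖ ^ 2 := by
  have hP : ∀ y z, inner ℝ (orthProj V y) z = inner ℝ y (orthProj V z) :=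
    fun y z => V.toSubmodule.inner_starProjection_left_eq_right y z
  have h1 : inner ℝ (x - orthProj V x) x = ‖x - orthProj V x‖ ^ 2 := by
    rw [← real_inner_self_eq_norm_sq, inner_sub_right (x - orthProj V x), ← hP, map_sub,
      orthProj_orthProj]
    simp
  have h2 : gramOp (orthProj V) T x =
      orthProj V (ContinuousLinearMap.adjoint T (T (orthProj V x))) + (x - orthProj V x) := rfl
  rw [h2, inner_add_left, h1, hP, ContinuousLinearMap.adjoint_inner_left,
    real_inner_self_eq_norm_sq]

theorem isUnit_gramOp (V : ClosedSubmodule ℝ H) (g : H ≃L[ℝ] H) :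
    IsUnit (gramOp (orthProj V) (g : H →L[ℝ] H)) := by
  set C : ℝ := ‖(g.symm : H →L[ℝ] H)‖ ^ 2 + 1 with hC
  have hC0 : 0 < C := by positivity
  refine ContinuousLinearMap.isUnit_of_forall_le_norm_inner_map _
    (c := (1 / (2 * C)).toNNReal) (Real.toNNReal_pos.2 (by positivity)) fun x => ?_
  rw [inner_gramOp, Real.norm_of_nonneg (by positivity)]
  rw [Real.coe_toNNReal _ (by positivity), mul_one_div, div_le_iff₀ (by positivity)]
  have h1 : ‖orthProj V x‖ ≤ ‖(g.symm : H →L[ℝ] H)‖ * ‖g (orthProj V x)‖ := by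
    simpa using (g.symm : H →L[ℝ] H).le_opNorm (g (orthProj V x))
  have h2 : ‖x‖ ≤ ‖orthProj V x‖ + ‖x - orthProj V x‖ := by
    simpa using norm_add_le (orthProj V x) (x - orthProj V x)
  have h3 : ‖orthProj V x‖ ^ 2 ≤ ‖(g.symm : H →L[ℝ] H)‖ ^ 2 * ‖g (orthProj V x)‖ ^ 2 := by
    rw [← mul_pow]; gcongr
  have h4 : ‖x‖ ^ 2 ≤ (‖orthProj V x‖ + ‖x - orthProj V x‖) ^ 2 := by gcongr
  have h5 := sq_nonneg (‖orthProj V x‖ - ‖x - orthProj V x‖)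
  have h6 : 0 ≤ ‖(g.symm : H →L[ℝ] H)‖ ^ 2 * ‖x - orthProj V x‖ ^ 2 := by positivity
  have h7 := sq_nonneg ‖g (orthProj V x)‖
  change ‖x‖ ^ 2 ≤ (‖g (orthProj V x)‖ ^ 2 + ‖x - orthProj V x‖ ^ 2) * (2 * C)
  rw [hC]
  nlinarith

/-- The least squares formula `A (A^* A)⁻¹ A^*` for the projection onto the range of `A = g P_V`,
with `A^* A` completed to an invertible operator. The proof checks that the value lies in `g V` and
that the remainder is orthogonal to it. -/
theorem orthProj_map (V : ClosedSubmodule ℝ H) (g : H ≃L[ℝ] H) :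
    orthProj (V.map (g : H →L[ℝ] H)) = (g : H →L[ℝ] H) * orthProj V *
      Ring.inverse (gramOp (orthProj V) (g : H →L[ℝ] H)) * orthProj V *
        adjointCLM H (g : H →L[ℝ] H) := by
  set P := orthProj V with hP
  set T : H →L[ℝ] H := (g : H →L[ℝ] H) with hT
  have hPP : P * P = P := by ext x; exact orthProj_orthProj V x
  have hPG : P * gramOp P T = P * adjointCLM H T * T * P := by
    rw [gramOp, mul_add, mul_sub, mul_one, hPP, sub_self, add_zero]
    simp only [← mul_assoc, hPP]
  have hinv : gramOp P T * Ring.inverse (gramOp P T) = 1 :=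
    Ring.mul_inverse_cancel _ (isUnit_gramOp V g)
  ext y
  refine Submodule.eq_starProjection_of_mem_orthogonal ?_ ?_
  · exact (mem_map_equiv g V _).2 (by simpa [T] using! orthProj_mem V _)
  · intro w hw
    have hw' : g.symm w ∈ V.toSubmodule := (mem_map_equiv g V w).1 hw
    have hz : (P * adjointCLM H T) *
        (1 - T * P * Ring.inverse (gramOp P T) * P * adjointCLM H T) = 0 := by
      rw [mul_sub, mul_one]
      have : P * adjointCLM H T * (T * P * Ring.inverse (gramOp P T) * P * adjointCLM H T) =
          (P * adjointCLM H T * T * P) * Ring.inverse (gramOp P T) * P * adjointCLM H T := by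
        simp only [mul_assoc]
      rw [this, ← hPG, mul_assoc P, hinv, mul_one, hPP, sub_self]
    have hz' : P (ContinuousLinearMap.adjoint T
        (y - (T * P * Ring.inverse (gramOp P T) * P * adjointCLM H T) y)) = 0 :=
      congrArg (fun S : H →L[ℝ] H => S y) hz
    have hw2 : w = T (P (g.symm w)) := by
      rw [hP, orthProj_of_mem hw']
      simp [hT]
    rw [hw2, ← ContinuousLinearMap.adjoint_inner_right, hP]
    have := V.toSubmodule.inner_starProjection_left_eq_right (g.symm w)
      (ContinuousLinearMap.adjoint T
        (y - (T * P * Ring.inverse (gramOp P T) * P * adjointCLM H T) y))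
    refine this.trans ?_
    rw [show V.toSubmodule.starProjection = P from rfl, hz', inner_zero_right]

/-- The explicit formula is built from products, the adjoint and the inverse, which are smooth. -/
theorem contDiffOn_orthProj_map {n : WithTop ℕ∞} {s : Set G} {T : G → (H →L[ℝ] H)}
    (hT : ContDiffOn ℝ n T s) (hinv : ∀ ξ ∈ s, ∃ g : H ≃L[ℝ] H, T ξ = g)
    (V : ClosedSubmodule ℝ H) : ContDiffOn ℝ n (fun ξ => orthProj (V.map (T ξ))) s := by
  have hcongr : ∀ ξ ∈ s, orthProj (V.map (T ξ)) = T ξ * orthProj V *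
      Ring.inverse (gramOp (orthProj V) (T ξ)) * orthProj V * adjointCLM H (T ξ) := by
    intro ξ hξ
    obtain ⟨g, hg⟩ := hinv ξ hξ
    rw [hg, orthProj_map]
  have hA : ContDiffOn ℝ n (fun ξ => adjointCLM H (T ξ)) s :=
    (adjointCLM H).contDiff.comp_contDiffOn hT
  have hG : ContDiffOn ℝ n (fun ξ => gramOp (orthProj V) (T ξ)) s := by
    unfold gramOp
    exact (((contDiffOn_const.mul hA).mul hT).mul contDiffOn_const).add contDiffOn_const
  have hI : ContDiffOn ℝ n (fun ξ => Ring.inverse (gramOp (orthProj V) (T ξ))) s := by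
    intro ξ hξ
    obtain ⟨g, hg⟩ := hinv ξ hξ
    obtain ⟨u, hu⟩ := isUnit_gramOp V g
    have h1 : ContDiffAt ℝ n Ring.inverse (gramOp (orthProj V) (T ξ)) := by
      rw [hg, ← hu]
      exact contDiffAt_ringInverse ℝ u
    exact h1.comp_contDiffWithinAt ξ (hG ξ hξ)
  exact ((((hT.mul contDiffOn_const).mul hI).mul contDiffOn_const).mul hA).congr hcongr

theorem continuousOn_map {s : Set G} {T : G → (H →L[ℝ] H)}
    (hT : ContinuousOn T s) (hinv : ∀ ξ ∈ s, ∃ g : H ≃L[ℝ] H, T ξ = g)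
    (V : ClosedSubmodule ℝ H) : ContinuousOn (fun ξ => V.map (T ξ)) s := by
  have hind : Topology.IsInducing (orthProj (H := H)) := ⟨rfl⟩
  rw [hind.continuousOn_iff]
  exact (contDiffOn_orthProj_map (contDiffOn_zero.2 hT) hinv V).continuousOn

end SmoothProjections

/-! ### Operators with closed range and the index of `T S^*` -/

section IndexFormula

variable {H : Type*} [NormedAddCommGroup H] [InnerProductSpace ℝ H] [CompleteSpace H]
  {E : Type*} [NormedAddCommGroup E] [InnerProductSpace ℝ E] [CompleteSpace E]

/-- The orthogonal complement of a closed subspace. -/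
def perp (V : ClosedSubmodule ℝ H) : ClosedSubmodule ℝ H :=
  ⟨V.toSubmoduleᗮ, V.toSubmodule.isClosed_orthogonal⟩

theorem toSubmodule_perp (V : ClosedSubmodule ℝ H) : (perp V).toSubmodule = V.toSubmoduleᗮ := rfl

theorem orthProj_perp (V : ClosedSubmodule ℝ H) (x : H) : orthProj (perp V) x = x - orthProj V x :=
  V.toSubmodule.starProjection_orthogonal_val x

theorem CompactPerturbation.perp {V W : ClosedSubmodule ℝ H} (h : CompactPerturbation V W) :
    CompactPerturbation (perp V) (perp W) :=
  isCompactOperator_congr h.symm fun x => by simp [orthProj_perp]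

theorem relDim_perp (V W : ClosedSubmodule ℝ H) : relDim (perp V) (perp W) = relDim W V := by
  rw [relDim, relDim, toSubmodule_perp, toSubmodule_perp, Submodule.orthogonal_orthogonal,
    Submodule.orthogonal_orthogonal, inf_comm, inf_comm V.toSubmodule]

/-- The restriction of `T` to the orthogonal complement of its kernel. -/
def restrictCoker (T : H →L[ℝ] E) : (perp (kerGr T)).toSubmodule →L[ℝ] E :=
  T ∘L (perp (kerGr T)).toSubmodule.subtypeL

theorem apply_orthProj_perp_kerGr (T : H →L[ℝ] E) (x : H) :
    T (orthProj (perp (kerGr T)) x) = T x := by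
  have h : T (orthProj (kerGr T) x) = 0 := orthProj_mem (kerGr T) x
  rw [orthProj_perp, map_sub, h, sub_zero]

theorem restrictCoker_comp_proj (T : H →L[ℝ] E) :
    restrictCoker T ∘L (perp (kerGr T)).toSubmodule.orthogonalProjectionOnto = T := by
  ext x
  exact apply_orthProj_perp_kerGr T x

theorem adjoint_eq_restrictCoker (T : H →L[ℝ] E) :
    ContinuousLinearMap.adjoint T = (perp (kerGr T)).toSubmodule.subtypeL ∘L
      ContinuousLinearMap.adjoint (restrictCoker T) := by
  conv_lhs => rw [← restrictCoker_comp_proj T]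
  rw [ContinuousLinearMap.adjoint_comp, Submodule.adjoint_orthogonalProjectionOnto]

theorem restrictCoker_injective (T : H →L[ℝ] E) : Function.Injective (restrictCoker T) := by
  rw [injective_iff_map_eq_zero]
  rintro ⟨x, hx⟩ h
  exact Subtype.ext (inner_self_eq_zero.1 (hx x h))

theorem range_restrictCoker (T : H →L[ℝ] E) :
    LinearMap.range (restrictCoker T).toLinearMap = LinearMap.range (T : H →ₗ[ℝ] E) := by
  apply le_antisymm
  · rintro _ ⟨x, rfl⟩
    exact ⟨x, rfl⟩
  · rintro _ ⟨x, rfl⟩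
    exact ⟨(perp (kerGr T)).toSubmodule.orthogonalProjectionOnto x, apply_orthProj_perp_kerGr T x⟩

/-- An injective operator `R` with closed range is bounded below, so `⟪R^* R x, x⟫ = ‖R x‖²` is
coercive. -/
theorem isUnit_adjoint_comp_restrictCoker {T : H →L[ℝ] E}
    (hT : IsClosed (LinearMap.range (T : H →ₗ[ℝ] E) : Set E)) :
    IsUnit (ContinuousLinearMap.adjoint (restrictCoker T) ∘L restrictCoker T) := by
  have hcl : IsClosed (Set.range (restrictCoker T)) := by
    have h := range_restrictCoker T
    rw [← h] at hT
    exact hT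
  obtain ⟨K, hK, hanti⟩ : ∃ K : NNReal, 0 < K ∧ AntilipschitzWith K (restrictCoker T) := by
    obtain ⟨K, h⟩ := ContinuousLinearMap.antilipschitz_of_injective_of_isClosed_range _
      (restrictCoker_injective T) hcl
    exact ⟨K + 1, by positivity, fun x y => (h x y).trans (by gcongr; simp)⟩
  refine ContinuousLinearMap.isUnit_of_forall_le_norm_inner_map _
    (c := (K ^ 2)⁻¹) (by positivity) fun x => ?_
  have h1 : ‖x‖ ≤ K * ‖restrictCoker T x‖ := by
    simpa using hanti.le_mul_dist x 0
  have h2 : inner ℝ ((ContinuousLinearMap.adjoint (restrictCoker T) ∘L restrictCoker T) x) x =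
      ‖restrictCoker T x‖ ^ 2 := by
    rw [ContinuousLinearMap.comp_apply, ContinuousLinearMap.adjoint_inner_left,
      real_inner_self_eq_norm_sq]
  rw [h2, Real.norm_of_nonneg (by positivity)]
  push_cast
  rw [← div_eq_mul_inv, div_le_iff₀ (by positivity), mul_comm, ← mul_pow]
  gcongr

/-- A pseudo-inverse of an operator with closed range. -/
theorem exists_pseudoInverse {T : H →L[ℝ] E}
    (hT : IsClosed (LinearMap.range (T : H →ₗ[ℝ] E) : Set E)) :
    ∃ B : E →L[ℝ] H, (∀ x, B (T x) = orthProj (perp (kerGr T)) x) ∧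
      (∀ y, B y ∈ (perp (kerGr T)).toSubmodule) ∧
      LinearMap.ker (B : E →ₗ[ℝ] H) = (LinearMap.range (T : H →ₗ[ℝ] E))ᗮ := by
  obtain ⟨u, hu⟩ := isUnit_adjoint_comp_restrictCoker hT
  set U := ContinuousLinearEquiv.ofUnit u
  have hU : ∀ x, U x = ContinuousLinearMap.adjoint (restrictCoker T) (restrictCoker T x) :=
    fun x => congrArg (fun S : _ →L[ℝ] _ => S x) hu
  -- This is `(R^* R)⁻¹ R^*`, the Moore-Penrose inverse, with `R` the restriction of `T` to `(ker
  -- T)^⊥`.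
  refine ⟨(perp (kerGr T)).toSubmodule.subtypeL ∘L (U.symm : _ →L[ℝ] _) ∘L
    ContinuousLinearMap.adjoint (restrictCoker T), fun x => ?_, fun y => ?_, ?_⟩
  · have h1 : T x = restrictCoker T ((perp (kerGr T)).toSubmodule.orthogonalProjectionOnto x) :=
      (apply_orthProj_perp_kerGr T x).symm
    rw [h1]
    change ((U.symm (ContinuousLinearMap.adjoint (restrictCoker T) (restrictCoker T _)) :
      (perp (kerGr T)).toSubmodule) : H) = _
    rw [← hU, U.symm_apply_apply]
    rfl
  · exact Subtype.prop _
  · rw [← range_restrictCoker T, ContinuousLinearMap.orthogonal_range]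
    ext y
    change ((U.symm (ContinuousLinearMap.adjoint (restrictCoker T) y) :
      (perp (kerGr T)).toSubmodule) : H) = 0 ↔
        ContinuousLinearMap.adjoint (restrictCoker T) y = 0
    rw [ZeroMemClass.coe_eq_zero]
    exact U.symm.map_eq_zero_iff

theorem adjoint_restrictCoker_surjective {T : H →L[ℝ] E}
    (hT : IsClosed (LinearMap.range (T : H →ₗ[ℝ] E) : Set E)) :
    Function.Surjective (ContinuousLinearMap.adjoint (restrictCoker T)) := by
  obtain ⟨u, hu⟩ := isUnit_adjoint_comp_restrictCoker hT
  intro y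
  obtain ⟨x, hx⟩ := (ContinuousLinearEquiv.ofUnit u).surjective y
  refine ⟨restrictCoker T x, ?_⟩
  rw [← hx]
  exact (congrArg (fun S : _ →L[ℝ] _ => S x) hu).symm

theorem finrank_ker_adjoint_restrictCoker {T : H →L[ℝ] E}
    (hT : IsClosed (LinearMap.range (T : H →ₗ[ℝ] E) : Set E)) :
    Module.finrank ℝ (LinearMap.ker (ContinuousLinearMap.adjoint (restrictCoker T)).toLinearMap) =
      cokerDim T := by
  have h := range_restrictCoker T
  rw [cokerDim, ← h, ← finrank_coker_eq_ker_adjoint]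
  rw [h]
  exact hT

theorem finite_ker_adjoint_restrictCoker {T : H →L[ℝ] E}
    (hT : IsClosed (LinearMap.range (T : H →ₗ[ℝ] E) : Set E))
    (hfin : FiniteDimensional ℝ (E ⧸ LinearMap.range (T : H →ₗ[ℝ] E))) :
    FiniteDimensional ℝ
      (LinearMap.ker (ContinuousLinearMap.adjoint (restrictCoker T)).toLinearMap) := by
  rw [← ContinuousLinearMap.orthogonal_range, range_restrictCoker]
  have := hT.completeSpace_coe
  exact (Submodule.quotientEquivOfIsCompl _ _
    (Submodule.isCompl_orthogonal (K := LinearMap.range (T : H →ₗ[ℝ] E)))).finiteDimensional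

/-- The outer factors contribute only the two cokernels; the middle one, a projection between the
complements of the kernels, carries the relative dimension. -/
theorem comp_adjoint_eq (T S : H →L[ℝ] E) :
    T ∘L ContinuousLinearMap.adjoint S = restrictCoker T ∘L
      transfer (perp (kerGr S)) (perp (kerGr T)) ∘L
        ContinuousLinearMap.adjoint (restrictCoker S) := by
  rw [adjoint_eq_restrictCoker S]
  conv_lhs => rw [← restrictCoker_comp_proj T]
  rfl

/-- If the kernels of `T` and `S` are compact perturbations of each other, and `T` and `S` have
closed ranges of finite codimension, then `T S^*` is Fredholm, of index
`dim (ker T, ker S) + dim coker S - dim coker T`. -/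
theorem algFredholm_comp_adjoint {T S : H →L[ℝ] E}
    (hS : IsClosed (LinearMap.range (S : H →ₗ[ℝ] E) : Set E))
    (hT' : FiniteDimensional ℝ (E ⧸ LinearMap.range (T : H →ₗ[ℝ] E)))
    (hS' : FiniteDimensional ℝ (E ⧸ LinearMap.range (S : H →ₗ[ℝ] E)))
    (h : CompactPerturbation (kerGr T) (kerGr S)) :
    AlgFredholm ((T ∘L ContinuousLinearMap.adjoint S : E →L[ℝ] E) : E →ₗ[ℝ] E) ∧
      algIndex ((T ∘L ContinuousLinearMap.adjoint S : E →L[ℝ] E) : E →ₗ[ℝ] E) =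
        relDim (kerGr T) (kerGr S) + cokerDim S - cokerDim T := by
  have hsurj : Function.Surjective
      (ContinuousLinearMap.adjoint (restrictCoker S)).toLinearMap :=
    adjoint_restrictCoker_surjective hS
  have hinj : Function.Injective (restrictCoker T).toLinearMap := restrictCoker_injective T
  have h1 : AlgFredholm (restrictCoker T).toLinearMap := by
    constructor
    · rw [LinearMap.ker_eq_bot.2 hinj]
      infer_instance
    · rw [range_restrictCoker]
      exact hT'
  have h2 : AlgFredholm (ContinuousLinearMap.adjoint (restrictCoker S)).toLinearMap := by
    constructor
    · exact finite_ker_adjoint_restrictCoker hS hS'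
    · rw [LinearMap.range_eq_top.2 hsurj]
      infer_instance
  -- Passing to orthogonal complements reverses the arguments of the relative dimension, so the
  -- middle factor has index `dim (ker T, ker S)`.
  have h3 := h.symm.perp.isEssInverse.algFredholm
  have h4 := h.symm.perp.algIndex_transfer
  rw [relDim_perp] at h4
  rw [comp_adjoint_eq, ContinuousLinearMap.toLinearMap_comp, ContinuousLinearMap.toLinearMap_comp]
  refine ⟨h1.comp (h3.comp h2), ?_⟩
  rw [algIndex_comp h1 (h3.comp h2), algIndex_comp h3 h2, h4, algIndex_of_injective hinj,
    algIndex_of_surjective hsurj, finrank_ker_adjoint_restrictCoker hS, range_restrictCoker,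
    cokerDim, cokerDim]
  ring

theorem kerGr_comp_symm (a : H ≃L[ℝ] H) (T : H →L[ℝ] E) :
    kerGr (T ∘L (a.symm : H →L[ℝ] H)) = (kerGr T).map (a : H →L[ℝ] H) := by
  apply ClosedSubmodule.toSubmodule_injective
  ext x
  rw [mem_map_equiv]
  rfl

theorem kerGr_equiv_comp (b : E ≃L[ℝ] E) (T : H →L[ℝ] E) :
    kerGr ((b : E →L[ℝ] E) ∘L T) = kerGr T := by
  apply ClosedSubmodule.toSubmodule_injective
  ext x
  exact b.map_eq_zero_iff

theorem range_comp_equiv (a : H ≃L[ℝ] H) (T : H →L[ℝ] E) :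
    LinearMap.range ((T ∘L (a : H →L[ℝ] H) : H →L[ℝ] E) : H →ₗ[ℝ] E) =
      LinearMap.range (T : H →ₗ[ℝ] E) := by
  ext y
  constructor
  · rintro ⟨x, rfl⟩
    exact ⟨a x, rfl⟩
  · rintro ⟨x, rfl⟩
    exact ⟨a.symm x, congrArg T (a.apply_symm_apply x)⟩

/-- The cokernels of `T` and `b ∘ T` are isomorphic. -/
def cokerEquiv (b : E ≃L[ℝ] E) (T : H →L[ℝ] E) :
    (E ⧸ LinearMap.range (T : H →ₗ[ℝ] E)) ≃ₗ[ℝ]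
      E ⧸ LinearMap.range (((b : E →L[ℝ] E) ∘L T : H →L[ℝ] E) : H →ₗ[ℝ] E) :=
  Submodule.Quotient.equiv _ _ b.toLinearEquiv (LinearMap.range_comp _ _).symm

theorem isClosed_range_equiv_comp (b : E ≃L[ℝ] E) {T : H →L[ℝ] E}
    (hT : IsClosed (LinearMap.range (T : H →ₗ[ℝ] E) : Set E)) :
    IsClosed (LinearMap.range (((b : E →L[ℝ] E) ∘L T : H →L[ℝ] E) : H →ₗ[ℝ] E) : Set E) := by
  have h : (LinearMap.range (((b : E →L[ℝ] E) ∘L T : H →L[ℝ] E) : H →ₗ[ℝ] E) : Set E) =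
      b '' (LinearMap.range (T : H →ₗ[ℝ] E) : Set E) := by
    ext y
    constructor
    · rintro ⟨x, rfl⟩
      exact ⟨T x, ⟨x, rfl⟩, rfl⟩
    · rintro ⟨_, ⟨x, rfl⟩, rfl⟩
      exact ⟨x, rfl⟩
  rw [h]
  exact b.toHomeomorph.isClosedMap _ hT

/-- Other inner products amount to replacing `T` by `T a⁻¹` and `S` by `b S a⁻¹`, followed by
composition with `b`. The kernels are moved by `a`, which preserves their relative dimension, so the
index does not depend on `a` and `b`. -/
theorem isFredholm_comp_adjointVia {T S : H →L[ℝ] E} (a : H ≃L[ℝ] H) (b : E ≃L[ℝ] E)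
    (hS : IsClosed (LinearMap.range (S : H →ₗ[ℝ] E) : Set E))
    (hT' : FiniteDimensional ℝ (E ⧸ LinearMap.range (T : H →ₗ[ℝ] E)))
    (hS' : FiniteDimensional ℝ (E ⧸ LinearMap.range (S : H →ₗ[ℝ] E)))
    (h : CompactPerturbation (kerGr T) (kerGr S)) :
    ContinuousLinearMap.IsFredholm (T ∘L adjointVia a b S) ∧
      fredholmIndex (T ∘L adjointVia a b S) =
        relDim (kerGr T) (kerGr S) + cokerDim S - cokerDim T := by
  set T' : H →L[ℝ] E := T ∘L (a.symm : H →L[ℝ] H) with hTdef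
  set S' : H →L[ℝ] E := (b : E →L[ℝ] E) ∘L S ∘L (a.symm : H →L[ℝ] H) with hSdef
  have hkT : kerGr T' = (kerGr T).map (a : H →L[ℝ] H) := kerGr_comp_symm a T
  have hkS : kerGr S' = (kerGr S).map (a : H →L[ℝ] H) := by
    rw [hSdef, kerGr_equiv_comp, kerGr_comp_symm]
  have hrT : LinearMap.range (T' : H →ₗ[ℝ] E) = LinearMap.range (T : H →ₗ[ℝ] E) :=
    range_comp_equiv a.symm T
  have hrS := range_comp_equiv a.symm S
  have hS1 : IsClosed (LinearMap.range (S' : H →ₗ[ℝ] E) : Set E) :=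
    isClosed_range_equiv_comp b (by rw [hrS]; exact hS)
  have hS2 : FiniteDimensional ℝ (E ⧸ LinearMap.range (S' : H →ₗ[ℝ] E)) := by
    have : FiniteDimensional ℝ (E ⧸ LinearMap.range
        ((S ∘L (a.symm : H →L[ℝ] H) : H →L[ℝ] E) : H →ₗ[ℝ] E)) := by rw [hrS]; exact hS'
    exact (cokerEquiv b (S ∘L (a.symm : H →L[ℝ] H))).finiteDimensional
  have hcT : cokerDim T' = cokerDim T := by rw [cokerDim, hrT, cokerDim]
  have hcS : cokerDim S' = cokerDim S := by
    rw [cokerDim, cokerDim, hSdef, ← (cokerEquiv b (S ∘L (a.symm : H →L[ℝ] H))).finrank_eq, hrS]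
  obtain ⟨h1, h2⟩ := algFredholm_comp_adjoint (T := T') (S := S') hS1 (by rw [hrT]; exact hT') hS2
    (by rw [hkT, hkS]; exact h.map a)
  have hb : Function.Bijective (b : E →L[ℝ] E).toLinearMap := b.bijective
  have hcomp : T ∘L adjointVia a b S = (T' ∘L ContinuousLinearMap.adjoint S') ∘L (b : E →L[ℝ] E) :=
    rfl
  rw [hcomp]
  refine ⟨AlgFredholm.isFredholm (h1.comp (.of_bijective hb)), ?_⟩
  change algIndex ((T' ∘L ContinuousLinearMap.adjoint S').toLinearMap ∘ₗ
    (b : E →L[ℝ] E).toLinearMap) = _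
  rw [algIndex_comp h1 (.of_bijective hb), algIndex_of_bijective hb, h2, hkT, hkS,
    h.relDim_map a, hcT, hcS, add_zero]

end IndexFormula

/-! ### The linear normal form of an operator with closed range of finite codimension -/

section NormalForm

variable {H : Type*} [NormedAddCommGroup H] [InnerProductSpace ℝ H] [CompleteSpace H]
  {E : Type*} [NormedAddCommGroup E] [InnerProductSpace ℝ E] [CompleteSpace E]

/-- Let `B : E → H` have finite dimensional kernel and range in `K^⊥`, let `B L` be the orthogonal
projection onto `K^⊥`, and let `V` be a subspace of `K` of codimension `dim ker B`. Then the kernel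
of `L` is a compact perturbation of `V`, of relative dimension `dim coker L`. -/
theorem relDim_kerGr_eq_cokerDim {K V : ClosedSubmodule ℝ H} {B : E →L[ℝ] H} {L : H →L[ℝ] E}
    (hB : ∀ y, B y ∈ (perp K).toSubmodule)
    (hBfin : FiniteDimensional ℝ (LinearMap.ker (B : E →ₗ[ℝ] H)))
    (hBL : ∀ x, B (L x) = orthProj (perp K) x) (hV : V ≤ K)
    (hVfin : FiniteDimensional ℝ (V.toSubmoduleᗮ ⊓ K.toSubmodule : Submodule ℝ H))
    (hVdim : Module.finrank ℝ (V.toSubmoduleᗮ ⊓ K.toSubmodule : Submodule ℝ H) =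
      Module.finrank ℝ (LinearMap.ker (B : E →ₗ[ℝ] H))) :
    CompactPerturbation (kerGr L) V ∧ relDim (kerGr L) V = cokerDim L := by
  have hmemK : ∀ x, B (L x) = 0 ↔ x ∈ K.toSubmodule := by
    intro x
    rw [hBL, orthProj_perp, sub_eq_zero, eq_comm]
    exact Submodule.starProjection_eq_self_iff
  have hle : kerGr L ≤ K := by
    intro x hx
    have hx' : L x = 0 := hx
    exact (hmemK x).1 (by rw [hx', map_zero])
  set A : Submodule ℝ H := (kerGr L).toSubmoduleᗮ ⊓ K.toSubmodule with hA
  set μ : A →ₗ[ℝ] LinearMap.ker (B : E →ₗ[ℝ] H) :=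
    LinearMap.codRestrict _ ((L : H →ₗ[ℝ] E) ∘ₗ A.subtype) (fun x => (hmemK x).2 x.2.2) with hμ
  have hμinj : Function.Injective μ := by
    rw [injective_iff_map_eq_zero]
    rintro ⟨x, hx⟩ h
    have h' : L x = 0 := congrArg Subtype.val h
    exact Subtype.ext (inner_self_eq_zero.1 (hx.1 x h'))
  have hAfin : FiniteDimensional ℝ A := Module.Finite.of_injective μ hμinj
  set κ : LinearMap.ker (B : E →ₗ[ℝ] H) →ₗ[ℝ] E ⧸ LinearMap.range (L : H →ₗ[ℝ] E) :=
    (LinearMap.range (L : H →ₗ[ℝ] E)).mkQ ∘ₗ Submodule.subtype _ with hκ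
  have hκsurj : Function.Surjective κ := by
    intro z
    obtain ⟨y, rfl⟩ := Submodule.Quotient.mk_surjective _ z
    refine ⟨⟨y - L (B y), ?_⟩, (Submodule.Quotient.eq _).2 ⟨-B y, by simp⟩⟩
    change B (y - L (B y)) = 0
    rw [map_sub, hBL, orthProj_of_mem (hB y), sub_self]
  -- Exactness of `0 → (ker L)^⊥ ∩ K → ker B → coker L → 0`. Hence passing from `ker L` up to `K`
  -- and down to `V` leaves exactly `dim coker L`.
  have hκker : LinearMap.ker κ = LinearMap.range μ := by
    ext ⟨y, hy⟩
    constructor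
    · intro h
      obtain ⟨x, hx⟩ := (Submodule.Quotient.mk_eq_zero _).1 h
      have hx' : L x = y := hx
      have hxK : x ∈ K.toSubmodule := (hmemK x).1 (by rw [hx']; exact hy)
      have h0 : L (orthProj (kerGr L) x) = 0 := orthProj_mem (kerGr L) x
      refine ⟨⟨x - orthProj (kerGr L) x,
        (kerGr L).toSubmodule.sub_starProjection_mem_orthogonal x,
        Submodule.sub_mem _ hxK (hle (orthProj_mem (kerGr L) x))⟩, Subtype.ext ?_⟩
      change L (x - orthProj (kerGr L) x) = y
      rw [map_sub, h0, sub_zero, hx']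
    · rintro ⟨x, hx⟩
      exact (Submodule.Quotient.mk_eq_zero _).2 ⟨x, congrArg Subtype.val hx⟩
  have h1 := κ.finrank_range_add_finrank_ker
  rw [hκker, LinearMap.range_eq_top.2 hκsurj, finrank_top, LinearMap.finrank_range_of_inj hμinj]
    at h1
  have hc1 : CompactPerturbation (kerGr L) K := .of_le hle hAfin
  have hc2 : CompactPerturbation V K := .of_le hV hVfin
  refine ⟨hc1.trans hc2.symm, ?_⟩
  have h2 := relDim_of_le hle
  rw [← hA] at h2
  rw [hc1.relDim_add hc2.symm, relDim_symm V K, h2, relDim_of_le hV, hVdim, cokerDim]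
  omega

theorem exists_submodule_finrank_eq {X : Type*} [AddCommGroup X] [Module ℝ X] {c : ℕ}
    (hc : (c : Cardinal) ≤ Module.rank ℝ X) :
    ∃ F : Submodule ℝ X, FiniteDimensional ℝ F ∧ Module.finrank ℝ F = c := by
  obtain ⟨s, hs, hli⟩ := Module.le_rank_iff_exists_finset.1 hc
  refine ⟨Submodule.span ℝ (s : Set X), FiniteDimensional.span_finset ℝ s, ?_⟩
  rw [finrank_span_finset_eq_card hli, hs]

/-- A closed subspace of dimension at least `c` has a closed subspace of codimension `c`. -/
theorem exists_le_finrank_eq {K : ClosedSubmodule ℝ H} {c : ℕ}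
    (hc : (c : Cardinal) ≤ Module.rank ℝ K.toSubmodule) :
    ∃ V : ClosedSubmodule ℝ H, V ≤ K ∧
      FiniteDimensional ℝ (V.toSubmoduleᗮ ⊓ K.toSubmodule : Submodule ℝ H) ∧
      Module.finrank ℝ (V.toSubmoduleᗮ ⊓ K.toSubmodule : Submodule ℝ H) = c := by
  obtain ⟨F', hF', hdim⟩ := exists_submodule_finrank_eq hc
  set F : Submodule ℝ H := F'.map K.toSubmodule.subtype with hF
  have hFK : F ≤ K.toSubmodule := Submodule.map_subtype_le _ _
  have hFfin : FiniteDimensional ℝ F := by rw [hF]; infer_instance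
  have hFdim : Module.finrank ℝ F = c := by rw [hF, Submodule.finrank_map_subtype_eq, hdim]
  -- The orthogonal complement inside `K` of a subspace `F` of dimension `c`.
  set V : ClosedSubmodule ℝ H := ⟨Fᗮ ⊓ K.toSubmodule,
    (F.isClosed_orthogonal).inter K.isClosed⟩ with hV
  have hVs : V.toSubmodule = Fᗮ ⊓ K.toSubmodule := rfl
  have hVF : (V.toSubmoduleᗮ ⊓ K.toSubmodule : Submodule ℝ H) = F := by
    apply le_antisymm
    · rintro x ⟨hx, hxK⟩
      have hmem : x - F.starProjection x ∈ V.toSubmodule :=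
        ⟨F.sub_starProjection_mem_orthogonal x,
          Submodule.sub_mem _ hxK (hFK (F.starProjection_apply_mem x))⟩
      have h1 : inner ℝ (x - F.starProjection x) x = 0 := hx _ hmem
      have h2 : inner ℝ (x - F.starProjection x) (F.starProjection x) = 0 := by
        rw [real_inner_comm]
        exact hmem.1 _ (F.starProjection_apply_mem x)
      have h3 : inner ℝ (x - F.starProjection x) (x - F.starProjection x) = 0 := by
        rw [inner_sub_right, h1, h2, sub_zero]
      rw [sub_eq_zero.1 (inner_self_eq_zero.1 h3)]
      exact F.starProjection_apply_mem x
    · intro x hx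
      refine ⟨?_, hFK hx⟩
      intro y hy
      rw [real_inner_comm]
      exact hy.1 x hx
  refine ⟨V, ?_, ?_, ?_⟩
  · intro x hx
    exact hx.2
  · rw [hVF]; exact hFfin
  · rw [hVF, hFdim]

theorem finrank_add_of_le {V K : ClosedSubmodule ℝ H} (hV : V ≤ K)
    (hK : FiniteDimensional ℝ K.toSubmodule) :
    Module.finrank ℝ V.toSubmodule +
      Module.finrank ℝ (V.toSubmoduleᗮ ⊓ K.toSubmodule : Submodule ℝ H) =
        Module.finrank ℝ K.toSubmodule :=
  Submodule.finrank_add_inf_finrank_orthogonal hV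

theorem finite_of_le_of_finite {V K : ClosedSubmodule ℝ H} (hV : V ≤ K)
    (hVfin : FiniteDimensional ℝ V.toSubmodule)
    (hfin : FiniteDimensional ℝ (V.toSubmoduleᗮ ⊓ K.toSubmodule : Submodule ℝ H)) :
    FiniteDimensional ℝ K.toSubmodule := by
  refine Submodule.finiteDimensional_of_le
    (S₂ := V.toSubmodule ⊔ (V.toSubmoduleᗮ ⊓ K.toSubmodule)) fun x hx => ?_
  have h : x = orthProj V x + (x - orthProj V x) := by abel
  rw [h]
  exact Submodule.add_mem_sup (orthProj_mem V x)
    ⟨V.toSubmodule.sub_starProjection_mem_orthogonal x,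
      Submodule.sub_mem _ hx (hV (orthProj_mem V x))⟩

theorem extDim_of_finite {X : Type*} [AddCommGroup X] [Module ℝ X] [FiniteDimensional ℝ X] :
    extDim X = (Module.finrank ℝ X : ℝ) := by
  have h : Cardinal.toENat (Module.rank ℝ X) = (Module.finrank ℝ X : ℕ∞) := by
    rw [← Module.finrank_eq_rank, map_natCast]
  rw [extDim, h]
  rfl

theorem extDim_of_not_finite {X : Type*} [AddCommGroup X] [Module ℝ X]
    (h : ¬ FiniteDimensional ℝ X) : extDim X = ⊤ := by
  have h1 : Cardinal.toENat (Module.rank ℝ X) = ⊤ := by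
    rw [Cardinal.toENat_eq_top]
    by_contra h2
    exact h (Module.rank_lt_aleph0_iff.1 (not_le.1 h2))
  rw [extDim, h1]
  simp

/-- `V` has dimension `ν ∈ ℕ ∪ {∞}` and infinite codimension. -/
structure HasDim (V : ClosedSubmodule ℝ H) (ν : EReal) : Prop where
  extDim_eq : extDim V.toSubmodule = ν
  not_finite_orthogonal : ¬ FiniteDimensional ℝ V.toSubmoduleᗮ

/-- An infinite dimensional cokernel would make the index `-∞`. -/
theorem IsSemiFredholm.finite_coker {T : H →L[ℝ] E} (hT : IsSemiFredholm T)
    (hind : 0 ≤ semiFredholmIndex T) : FiniteDimensional ℝ (E ⧸ LinearMap.range (T : H →ₗ[ℝ] E)) := by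
  by_contra h
  rcases hT.finite with h1 | h1
  · rw [semiFredholmIndex, extDim_of_not_finite h, EReal.sub_top] at hind
    exact absurd hind (by simp)
  · exact h h1

/-- A non-negative index leaves room in the kernel for a subspace of codimension `dim coker T`. Its
dimension is the index, hence will be the same at all points of `M`. -/
theorem exists_hasDim_le_kerGr {T : H →L[ℝ] E} (hE : ¬ FiniteDimensional ℝ E)
    (hT : IsSemiFredholm T) (hind : 0 ≤ semiFredholmIndex T) :
    ∃ V : ClosedSubmodule ℝ H, HasDim V (semiFredholmIndex T) ∧ V ≤ kerGr T ∧
      FiniteDimensional ℝ (V.toSubmoduleᗮ ⊓ (kerGr T).toSubmodule : Submodule ℝ H) ∧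
      Module.finrank ℝ (V.toSubmoduleᗮ ⊓ (kerGr T).toSubmodule : Submodule ℝ H) = cokerDim T := by
  have hfin := hT.finite_coker hind
  -- Otherwise the range of `T` would be finite dimensional, and so would `E`, the cokernel being
  -- finite dimensional.
  have hco : ¬ FiniteDimensional ℝ (kerGr T).toSubmoduleᗮ := by
    intro h
    have h1 : FiniteDimensional ℝ (LinearMap.range (T : H →ₗ[ℝ] E)) := by
      rw [← range_restrictCoker]
      have : FiniteDimensional ℝ (perp (kerGr T)).toSubmodule := h
      infer_instance
    exact hE (Module.Finite.of_submodule_quotient (LinearMap.range (T : H →ₗ[ℝ] E)))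
  have hperp : ∀ V : ClosedSubmodule ℝ H, V ≤ kerGr T → ¬ FiniteDimensional ℝ V.toSubmoduleᗮ := by
    intro V hV h
    exact hco (Submodule.finiteDimensional_of_le (Submodule.orthogonal_le hV))
  have hν : semiFredholmIndex T = extDim (kerGr T).toSubmodule - (cokerDim T : ℝ) := by
    rw [semiFredholmIndex, extDim_of_finite (X := E ⧸ _)]
    rfl
  by_cases hK : FiniteDimensional ℝ (kerGr T).toSubmodule
  · rw [extDim_of_finite, ← EReal.coe_sub] at hν
    have hle : cokerDim T ≤ Module.finrank ℝ (kerGr T).toSubmodule := by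
      rw [hν, EReal.coe_nonneg, sub_nonneg] at hind
      exact_mod_cast hind
    obtain ⟨V, hV, h1, h2⟩ := exists_le_finrank_eq (K := kerGr T) (c := cokerDim T) (by
      rw [← Module.finrank_eq_rank]
      exact_mod_cast hle)
    refine ⟨V, ⟨?_, hperp V hV⟩, hV, h1, h2⟩
    have hVfin : FiniteDimensional ℝ V.toSubmodule := Submodule.finiteDimensional_of_le hV
    have h3 := finrank_add_of_le hV hK
    rw [hν, extDim_of_finite, ← h3, h2, EReal.coe_eq_coe_iff]
    push_cast
    ring
  · rw [extDim_of_not_finite hK, EReal.top_sub_coe] at hν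
    obtain ⟨V, hV, h1, h2⟩ := exists_le_finrank_eq (K := kerGr T) (c := cokerDim T) (by
      refine (Cardinal.natCast_lt_aleph0).le.trans ?_
      by_contra h
      exact hK (Module.rank_lt_aleph0_iff.1 (not_le.1 h)))
    refine ⟨V, ⟨?_, hperp V hV⟩, hV, h1, h2⟩
    rw [hν]
    exact extDim_of_not_finite fun h => hK (finite_of_le_of_finite hV h h1)

end NormalForm

/-! ### Isomorphisms of separable Hilbert spaces -/

section SeparableHilbert

variable {X Y : Type*} [NormedAddCommGroup X] [InnerProductSpace ℝ X] [CompleteSpace X]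
  [NormedAddCommGroup Y] [InnerProductSpace ℝ Y] [CompleteSpace Y]

/-- Distinct orthonormal vectors are at distance `√2`, so the balls of radius `1/2` around them are
disjoint open sets. -/
theorem countable_of_orthonormal [TopologicalSpace.SeparableSpace X] {ι : Type*} {v : ι → X}
    (hv : Orthonormal ℝ v) : Countable ι := by
  refine Pairwise.countable_of_isOpen_disjoint (s := fun i => Metric.ball (v i) (1 / 2)) ?_
    (fun i => Metric.isOpen_ball) (fun i => ⟨v i, Metric.mem_ball_self (by norm_num)⟩)
  intro i j hij
  refine Metric.ball_disjoint_ball ?_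
  have h1 : ‖v i - v j‖ ^ 2 = 2 := by
    rw [@norm_sub_sq ℝ, hv.1 i, hv.1 j, hv.2 hij]
    simp
    norm_num
  rw [dist_eq_norm]
  nlinarith [norm_nonneg (v i - v j)]

theorem exists_hilbertBasis_nat [TopologicalSpace.SeparableSpace X]
    (hX : ¬ FiniteDimensional ℝ X) : Nonempty (HilbertBasis ℕ ℝ X) := by
  obtain ⟨w, b, -⟩ := exists_hilbertBasis ℝ X
  have hcount : Countable w := countable_of_orthonormal b.orthonormal
  have hinf : Infinite w := by
    by_contra h
    rw [not_infinite_iff_finite] at h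
    have := Fintype.ofFinite w
    exact hX b.toOrthonormalBasis.toBasis.finiteDimensional_of_finite
  obtain ⟨e⟩ : Nonempty (ℕ ≃ w) := by
    obtain ⟨_⟩ := nonempty_denumerable w
    exact ⟨(Denumerable.eqv w).symm⟩
  refine ⟨HilbertBasis.mk (v := b ∘ e) (b.orthonormal.comp e e.injective) ?_⟩
  rw [Set.range_comp, e.range_eq_univ, Set.image_univ, b.dense_span]

theorem nonempty_equiv_of_extDim_eq [TopologicalSpace.SeparableSpace X]
    [TopologicalSpace.SeparableSpace Y] (h : extDim X = extDim Y) : Nonempty (X ≃L[ℝ] Y) := by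
  by_cases hX : FiniteDimensional ℝ X <;> by_cases hY : FiniteDimensional ℝ Y
  · rw [extDim_of_finite, extDim_of_finite, EReal.coe_eq_coe_iff, Nat.cast_inj] at h
    exact ⟨ContinuousLinearEquiv.ofFinrankEq h⟩
  · rw [extDim_of_finite, extDim_of_not_finite hY] at h
    exact absurd h (EReal.coe_ne_top _)
  · rw [extDim_of_finite (X := Y), extDim_of_not_finite hX] at h
    exact absurd h.symm (EReal.coe_ne_top _)
  · obtain ⟨b⟩ := exists_hilbertBasis_nat hX
    obtain ⟨b'⟩ := exists_hilbertBasis_nat hY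
    exact ⟨(b.repr.trans b'.repr.symm).toContinuousLinearEquiv⟩

/-- The operator given by `a : A → B` and `a' : A^⊥ → B^⊥`. -/
def blockMap {A B : ClosedSubmodule ℝ X} (a : A.toSubmodule →L[ℝ] B.toSubmodule)
    (a' : (perp A).toSubmodule →L[ℝ] (perp B).toSubmodule) : X →L[ℝ] X :=
  B.toSubmodule.subtypeL ∘L a ∘L A.toSubmodule.orthogonalProjectionOnto +
    (perp B).toSubmodule.subtypeL ∘L a' ∘L (perp A).toSubmodule.orthogonalProjectionOnto

/-- In a separable Hilbert space any two closed subspaces of the same dimension and of infinite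
codimension correspond under a linear isomorphism. -/
theorem HasDim.exists_map_eq [TopologicalSpace.SeparableSpace X] {V W : ClosedSubmodule ℝ X}
    {ν : EReal} (hV : HasDim V ν) (hW : HasDim W ν) :
    ∃ g : X ≃L[ℝ] X, V.map (g : X →L[ℝ] X) = W := by
  have hsep : ∀ S : Submodule ℝ X, TopologicalSpace.SeparableSpace S := fun S => by
    have : SecondCountableTopology X := UniformSpace.secondCountable_of_separable X
    infer_instance
  have := hsep V.toSubmodule
  have := hsep W.toSubmodule
  have := hsep (perp V).toSubmodule
  have := hsep (perp W).toSubmodule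
  obtain ⟨e⟩ := nonempty_equiv_of_extDim_eq (hV.extDim_eq.trans hW.extDim_eq.symm)
  obtain ⟨e'⟩ : Nonempty ((perp V).toSubmodule ≃L[ℝ] (perp W).toSubmodule) :=
    nonempty_equiv_of_extDim_eq
      ((extDim_of_not_finite hV.not_finite_orthogonal).trans (extDim_of_not_finite hW.not_finite_orthogonal).symm)
  have hG : ∀ {A B : ClosedSubmodule ℝ X} (a : A.toSubmodule ≃L[ℝ] B.toSubmodule)
      (a' : (perp A).toSubmodule ≃L[ℝ] (perp B).toSubmodule),
      Function.LeftInverse (blockMap a.symm.toContinuousLinearMap a'.symm.toContinuousLinearMap)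
        (blockMap a.toContinuousLinearMap a'.toContinuousLinearMap) := by
    intro A B a a' x
    set y := A.toSubmodule.orthogonalProjectionOnto x with hy
    set z := (perp A).toSubmodule.orthogonalProjectionOnto x with hz
    have h1 : B.toSubmodule.orthogonalProjectionOnto ((a y : X) + a' z) = a y := by
      rw [map_add, Submodule.orthogonalProjectionOnto_mem_subspace_eq_self,
        Submodule.orthogonalProjectionOnto_apply_of_mem_orthogonal (a' z).2, add_zero]
    have h2 : (perp B).toSubmodule.orthogonalProjectionOnto ((a y : X) + a' z) = a' z := by
      rw [map_add, Submodule.orthogonalProjectionOnto_mem_subspace_eq_self,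
        Submodule.orthogonalProjectionOnto_apply_of_mem_orthogonal, zero_add]
      exact Submodule.le_orthogonal_orthogonal _ (a y).2
    change ((a.symm (B.toSubmodule.orthogonalProjectionOnto ((a y : X) + a' z)) : X)) +
      (a'.symm ((perp B).toSubmodule.orthogonalProjectionOnto ((a y : X) + a' z)) : X) = x
    rw [h1, h2, a.symm_apply_apply, a'.symm_apply_apply]
    change orthProj A x + orthProj (perp A) x = x
    rw [orthProj_perp]
    abel
  have hmem : ∀ {A B : ClosedSubmodule ℝ X} (a : A.toSubmodule ≃L[ℝ] B.toSubmodule)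
      (a' : (perp A).toSubmodule ≃L[ℝ] (perp B).toSubmodule),
      ∀ x ∈ A.toSubmodule, blockMap a.toContinuousLinearMap a'.toContinuousLinearMap x ∈ B.toSubmodule := by
    intro A B a a' x hx
    have h2 : (perp A).toSubmodule.orthogonalProjectionOnto x = 0 :=
      Submodule.orthogonalProjectionOnto_apply_of_mem_orthogonal
        (Submodule.le_orthogonal_orthogonal _ hx)
    change (a (A.toSubmodule.orthogonalProjectionOnto x) : X) +
      (a' ((perp A).toSubmodule.orthogonalProjectionOnto x) : X) ∈ B.toSubmodule
    rw [h2, map_zero, Submodule.coe_zero, add_zero]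
    exact Subtype.prop _
  refine ⟨ContinuousLinearEquiv.equivOfInverse (blockMap e.toContinuousLinearMap e'.toContinuousLinearMap)
    (blockMap e.symm.toContinuousLinearMap e'.symm.toContinuousLinearMap) (hG e e') (hG e.symm e'.symm), ?_⟩
  apply ClosedSubmodule.toSubmodule_injective
  ext x
  rw [mem_map_equiv]
  constructor
  · intro hx
    have h1 : blockMap e.toContinuousLinearMap e'.toContinuousLinearMap
      (blockMap e.symm.toContinuousLinearMap e'.symm.toContinuousLinearMap x) ∈ W.toSubmodule :=
      hmem e e' _ hx
    have h2 : blockMap e.toContinuousLinearMap e'.toContinuousLinearMap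
      (blockMap e.symm.toContinuousLinearMap e'.symm.toContinuousLinearMap x) = x :=
      hG e.symm e'.symm x
    rwa [h2] at h1
  · intro hx
    exact hmem e.symm e'.symm x hx

end SeparableHilbert

/-! ### Pre-compact sets -/

section Precompact

theorem isPrecompact_of_subset {X : Type*} [TopologicalSpace X] [T2Space X] {A K : Set X}
    (hK : IsCompact K) (h : A ⊆ K) : IsPrecompact A :=
  hK.closure_of_subset h

theorem IsPrecompact.image {X Y : Type*} [TopologicalSpace X] [TopologicalSpace Y] [T2Space Y]
    {A : Set X} (hA : IsPrecompact A) {f : X → Y} (hf : Continuous f) : IsPrecompact (f '' A) :=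
  isPrecompact_of_subset (IsCompact.image hA hf) (image_mono subset_closure)

/-- Pre-compactness may be tested in a chart, for sets that stay away from the boundary of its
domain and of its image. -/
theorem isPrecompact_image_chart_iff {N E : Type*} [TopologicalSpace N] [T2Space N]
    [TopologicalSpace E] [T2Space E] (η : OpenPartialHomeomorph N E) {C : Set N} (hC : IsClosed C)
    (hCη : C ⊆ η.source) {D : Set E} (hD : IsClosed D) (hDη : D ⊆ η.target) {S : Set N}
    (hSC : S ⊆ C) (hSD : η '' S ⊆ D) : IsPrecompact S ↔ IsPrecompact (η '' S) := by
  constructor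
  · intro h
    have hcl : closure S ⊆ C := closure_minimal hSC hC
    exact isPrecompact_of_subset (IsCompact.image_of_continuousOn h
      (η.continuousOn.mono (hcl.trans hCη))) (image_mono subset_closure)
  · intro h
    have hcl : closure (η '' S) ⊆ D := closure_minimal hSD hD
    refine isPrecompact_of_subset (IsCompact.image_of_continuousOn h
      (η.symm.continuousOn.mono (hcl.trans hDη))) fun x hx => ?_
    exact ⟨η x, subset_closure ⟨x, hx, rfl⟩, η.left_inv (hCη (hSC hx))⟩

variable {X Y Z : Type*} [NormedAddCommGroup X] [InnerProductSpace ℝ X] [CompleteSpace X]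
  [NormedAddCommGroup Y] [InnerProductSpace ℝ Y] [CompleteSpace Y]
  [NormedAddCommGroup Z] [InnerProductSpace ℝ Z] [CompleteSpace Z]

theorem isPrecompact_image_of_bounded {S : X →L[ℝ] Y} (hS : IsCompactOperator S) {A : Set X}
    (hA : Bornology.IsBounded A) : IsPrecompact (S '' A) :=
  IsCompactOperator.isCompact_closure_image_of_bounded (f := (S : X →ₗ[ℝ] Y)) hS hA

/-- If `R = C P + S` with a compact operator `S`, then `R` maps those bounded sets to pre-compact
ones which `P` maps to pre-compact ones. -/
theorem isPrecompact_image_of_decomposition {R : X →L[ℝ] Y} {P : X →L[ℝ] Z} (C : Z →L[ℝ] Y)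
    {S : X →L[ℝ] Y} (hS : IsCompactOperator S) (hR : ∀ x, R x = C (P x) + S x) {A : Set X}
    (hA : Bornology.IsBounded A) (hP : IsPrecompact (P '' A)) : IsPrecompact (R '' A) := by
  have h1 : IsPrecompact (C '' (P '' A)) := hP.image C.continuous
  have h2 := isPrecompact_image_of_bounded hS hA
  refine isPrecompact_of_subset (IsCompact.add h1 h2) ?_
  rintro _ ⟨x, hx, rfl⟩
  rw [hR]
  exact Set.add_mem_add (subset_closure ⟨_, ⟨x, hx, rfl⟩, rfl⟩) (subset_closure ⟨x, hx, rfl⟩)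

theorem idempotent_sub_mem {Q : X →L[ℝ] X} (hQ : IsIdempotentElem Q) (x : X) :
    x - Q x ∈ (kerGr Q).toSubmodule := by
  have h : Q (Q x) = Q x := congrArg (fun S : X →L[ℝ] X => S x) hQ
  change Q (x - Q x) = 0
  rw [map_sub, h, sub_self]

/-- Projectors with equal kernels satisfy `Q' Q = Q'` and `Q Q' = Q`, so each image is a continuous
image of the other. -/
theorem isPrecompact_image_iff_of_kerGr_eq {Q Q' : X →L[ℝ] X} (hQ : IsIdempotentElem Q)
    (hQ' : IsIdempotentElem Q') (h : kerGr Q' = kerGr Q) (A : Set X) :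
    IsPrecompact (Q '' A) ↔ IsPrecompact (Q' '' A) := by
  have aux : ∀ {Q Q' : X →L[ℝ] X}, IsIdempotentElem Q → kerGr Q' = kerGr Q →
      IsPrecompact (Q '' A) → IsPrecompact (Q' '' A) := by
    intro Q Q' hQ h hA
    have h1 : Q' '' (Q '' A) = Q' '' A := by
      rw [image_image]
      refine image_congr fun x _ => ?_
      have h2 : x - Q x ∈ (kerGr Q').toSubmodule := h ▸ idempotent_sub_mem hQ x
      have h3 : Q' (x - Q x) = 0 := h2
      rw [map_sub, sub_eq_zero] at h3
      exact h3.symm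
    rw [← h1]
    exact hA.image Q'.continuous
  exact ⟨aux hQ h, aux hQ' h.symm⟩

end Precompact

/-! ### Differentials of charts -/

section ChartDifferentials

variable {H : Type*} [NormedAddCommGroup H] [InnerProductSpace ℝ H] [CompleteSpace H]
  {E : Type*} [NormedAddCommGroup E] [InnerProductSpace ℝ E] [CompleteSpace E]
  {M : Type*} [TopologicalSpace M] [ChartedSpace H M]
  {N : Type*} [TopologicalSpace N] [ChartedSpace E N] {k : ℕ∞}

theorem mdifferentiable_of_mem_maximalAtlas (hk : 1 ≤ k) {φ : OpenPartialHomeomorph M H}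
    (hφ : φ ∈ IsManifold.maximalAtlas 𝓘(ℝ, H) (k : WithTop ℕ∞) M) :
    φ.MDifferentiable 𝓘(ℝ, H) 𝓘(ℝ, H) := by
  have hk0 : (k : WithTop ℕ∞) ≠ 0 := by
    have : k ≠ 0 := (zero_lt_one.trans_le hk).ne'
    exact_mod_cast this
  exact ⟨(contMDiffOn_of_mem_maximalAtlas hφ).mdifferentiableOn hk0,
    (contMDiffOn_symm_of_mem_maximalAtlas hφ).mdifferentiableOn hk0⟩

theorem exists_equiv_diff_chart (hk : 1 ≤ k) {φ : OpenPartialHomeomorph M H}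
    (hφ : φ ∈ IsManifold.maximalAtlas 𝓘(ℝ, H) (k : WithTop ℕ∞) M) {p : M} (hp : p ∈ φ.source) :
    ∃ g : H ≃L[ℝ] H, diff φ p = (g : H →L[ℝ] H) ∧ diff φ.symm (φ p) = (g.symm : H →L[ℝ] H) := by
  have hd := mdifferentiable_of_mem_maximalAtlas hk hφ
  exact ⟨hd.mfderiv hp, rfl, rfl⟩

theorem exists_equiv_diff_chart_symm (hk : 1 ≤ k) {φ : OpenPartialHomeomorph M H}
    (hφ : φ ∈ IsManifold.maximalAtlas 𝓘(ℝ, H) (k : WithTop ℕ∞) M) {ξ : H} (hξ : ξ ∈ φ.target) :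
    ∃ g : H ≃L[ℝ] H, diff φ (φ.symm ξ) = (g : H →L[ℝ] H) ∧
      diff φ.symm ξ = (g.symm : H →L[ℝ] H) := by
  have h := exists_equiv_diff_chart hk hφ (φ.map_target hξ)
  rwa [φ.right_inv hξ] at h

theorem diff_comp_chart_symm (hk : 1 ≤ k) {φ : OpenPartialHomeomorph M H}
    (hφ : φ ∈ IsManifold.maximalAtlas 𝓘(ℝ, H) (k : WithTop ℕ∞) M) {f : M → N} {ξ : H}
    (hξ : ξ ∈ φ.target) (hf : MDifferentiableAt 𝓘(ℝ, H) 𝓘(ℝ, E) f (φ.symm ξ)) :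
    diff (E := E) (f ∘ φ.symm) ξ = diff (H := H) (E := E) f (φ.symm ξ) ∘L
      diff (H := H) (E := H) φ.symm ξ :=
  mfderiv_comp ξ hf ((mdifferentiable_of_mem_maximalAtlas hk hφ).mdifferentiableAt_symm hξ)

theorem diff_chart_comp (hk : 1 ≤ k) {η : OpenPartialHomeomorph N E}
    (hη : η ∈ IsManifold.maximalAtlas 𝓘(ℝ, E) (k : WithTop ℕ∞) N) {f : M → N} {p : M}
    (hp : f p ∈ η.source) (hf : MDifferentiableAt 𝓘(ℝ, H) 𝓘(ℝ, E) f p) :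
    diff (H := H) (E := E) (η ∘ f) p =
      diff (H := E) (E := E) η (f p) ∘L diff (H := H) (E := E) f p :=
  mfderiv_comp p ((mdifferentiable_of_mem_maximalAtlas hk hη).mdifferentiableAt hp) hf

theorem diff_eq_fderiv (f : H → E) (x : H) : diff f x = fderiv ℝ f x := mfderiv_eq_fderiv

end ChartDifferentials

/-! ### Adapted charts -/

section AdaptedCharts

variable {H : Type*} [NormedAddCommGroup H] [InnerProductSpace ℝ H] [CompleteSpace H]
  {E : Type*} [NormedAddCommGroup E] [InnerProductSpace ℝ E] [CompleteSpace E]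

/-- A map `F` with a differential of closed range becomes, up to the kernel of a pseudo-inverse
`B` of the differential, a linear projection after a local change of coordinates. -/
theorem exists_straightening {k : ℕ∞} (hk : 1 ≤ k) {F : H → E} {O : Set H} (hO : IsOpen O)
    {x₀ : H} (hx₀ : x₀ ∈ O) (hF : ContDiffOn ℝ (k : WithTop ℕ∞) F O) {K : ClosedSubmodule ℝ H}
    {B : E →L[ℝ] H} (hB : ∀ y, B y ∈ (perp K).toSubmodule)
    (hBF : ∀ x, B (fderiv ℝ F x₀ x) = orthProj (perp K) x) (g : H ≃L[ℝ] H) :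
    ∃ D : OpenPartialHomeomorph H H, x₀ ∈ D.source ∧ D.source ⊆ O ∧
      ContDiffOn ℝ (k : WithTop ℕ∞) D D.source ∧
      ContDiffOn ℝ (k : WithTop ℕ∞) D.symm D.target ∧ Bornology.IsBounded D.target ∧
      ∀ ξ ∈ D.target, B (F (D.symm ξ)) = orthProj (perp K) (g.symm ξ) := by
  have hk1 : (1 : WithTop ℕ∞) ≤ (k : WithTop ℕ∞) := by exact_mod_cast hk
  have hk0 : (k : WithTop ℕ∞) ≠ 0 := (zero_lt_one.trans_le hk1).ne'
  -- Its derivative at `x₀` is `P_{K^⊥} + P_K = 1`, so it is a local diffeomorphism there.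
  set Ψ : H → H := fun x => B (F x) + orthProj K x with hΨ
  have hΨC : ContDiffOn ℝ (k : WithTop ℕ∞) Ψ O :=
    (B.contDiff.comp_contDiffOn hF).add (orthProj K).contDiff.contDiffOn
  have hΨat : ∀ x ∈ O, ContDiffAt ℝ (k : WithTop ℕ∞) Ψ x := fun x hx =>
    hΨC.contDiffAt (hO.mem_nhds hx)
  have hder : HasFDerivAt Ψ ((ContinuousLinearEquiv.refl ℝ H : H ≃L[ℝ] H) : H →L[ℝ] H) x₀ := by
    have h1 : HasFDerivAt F (fderiv ℝ F x₀) x₀ :=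
      ((hF.contDiffAt (hO.mem_nhds hx₀)).differentiableAt hk0).hasFDerivAt
    have h2 := (B.hasFDerivAt.comp x₀ h1).add ((orthProj K).hasFDerivAt (x := x₀))
    refine h2.congr_fderiv ?_
    ext x
    change B (fderiv ℝ F x₀ x) + orthProj K x = x
    rw [hBF, orthProj_perp]
    abel
  set R := (hΨat x₀ hx₀).toOpenPartialHomeomorph Ψ hder hk0 with hR
  have hRcoe : ∀ x, R x = Ψ x := fun x => rfl
  have hxR : x₀ ∈ R.source := (hΨat x₀ hx₀).mem_toOpenPartialHomeomorph_source hder hk0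
  have hfc : ContinuousOn (fderiv ℝ Ψ) O := hΨC.continuousOn_fderiv_of_isOpen hO hk1
  have hO1 : IsOpen (O ∩ fderiv ℝ Ψ ⁻¹' range ((↑) : (H ≃L[ℝ] H) → H →L[ℝ] H)) :=
    hfc.isOpen_inter_preimage hO (ContinuousLinearEquiv.isOpen)
  have hO2 : IsOpen (O ∩ Ψ ⁻¹' Metric.ball (Ψ x₀) 1) :=
    hΨC.continuousOn.isOpen_inter_preimage hO Metric.isOpen_ball
  -- The first condition keeps the derivative invertible at every point, which gives `C^k`
  -- regularity of the inverse on the whole target; the second makes the target bounded.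
  set O' : Set H := (O ∩ fderiv ℝ Ψ ⁻¹' range ((↑) : (H ≃L[ℝ] H) → H →L[ℝ] H)) ∩
    (O ∩ Ψ ⁻¹' Metric.ball (Ψ x₀) 1) with hO'
  have hO'o : IsOpen O' := hO1.inter hO2
  have hxO' : x₀ ∈ O' := ⟨⟨hx₀, ⟨ContinuousLinearEquiv.refl ℝ H, hder.fderiv.symm⟩⟩,
    ⟨hx₀, Metric.mem_ball_self one_pos⟩⟩
  set D : OpenPartialHomeomorph H H :=
    (R.restrOpen O' hO'o).trans g.toHomeomorph.toOpenPartialHomeomorph with hD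
  have hsrc : D.source = R.source ∩ O' := by simp [hD]
  have hDcoe : ∀ x, D x = g (Ψ x) := fun x => rfl
  have hDsymm : ∀ ξ, D.symm ξ = R.symm (g.symm ξ) := fun ξ => rfl
  refine ⟨D, ?_, ?_, ?_, ?_, ?_, ?_⟩
  · rw [hsrc]; exact ⟨hxR, hxO'⟩
  · rw [hsrc]; exact fun x hx => hx.2.1.1
  · have h1 : ContDiffOn ℝ (k : WithTop ℕ∞) (fun x => g (Ψ x)) D.source :=
      g.contDiff.comp_contDiffOn (hΨC.mono (by rw [hsrc]; exact fun x hx => hx.2.1.1))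
    exact h1
  · intro ξ hξ
    have hmem : D.symm ξ ∈ R.source ∩ O' := by rw [← hsrc]; exact D.map_target hξ
    obtain ⟨e, he⟩ := hmem.2.1.2
    have hgt : g.symm ξ ∈ R.target := by
      have h1 : R (D.symm ξ) = g.symm ξ := by
        rw [hRcoe]
        apply g.injective
        rw [← hDcoe, D.right_inv hξ, g.apply_symm_apply]
      rw [← h1]
      exact R.map_source hmem.1
    have h2 : ContDiffAt ℝ (k : WithTop ℕ∞) R.symm (g.symm ξ) := by
      refine R.contDiffAt_symm hgt (f₀' := e) ?_ ?_
      · rw [← hDsymm, he]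
        exact ((hΨat _ hmem.2.1.1).differentiableAt hk0).hasFDerivAt
      · rw [← hDsymm]
        exact hΨat _ hmem.2.1.1
    have h3 : ContDiffAt ℝ (k : WithTop ℕ∞) (fun ξ => R.symm (g.symm ξ)) ξ :=
      h2.comp ξ g.symm.contDiff.contDiffAt
    exact h3.contDiffWithinAt
  · have hb : Bornology.IsBounded ((g : H →L[ℝ] H) '' Metric.ball (Ψ x₀) 1) :=
      (g : H →L[ℝ] H).lipschitz.isBounded_image Metric.isBounded_ball
    refine hb.subset fun ξ hξ => ?_
    have hmem : D.symm ξ ∈ R.source ∩ O' := by rw [← hsrc]; exact D.map_target hξ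
    exact ⟨Ψ (D.symm ξ), hmem.2.2.2, (hDcoe _).symm.trans (D.right_inv hξ)⟩
  · intro ξ hξ
    have h1 : g.symm ξ = B (F (D.symm ξ)) + orthProj K (D.symm ξ) := by
      apply g.injective
      rw [g.apply_symm_apply]
      exact (D.right_inv hξ).symm.trans (hDcoe _)
    rw [h1, map_add, orthProj_of_mem (hB _), orthProj_perp, orthProj_orthProj, sub_self, add_zero]

theorem cokerDim_comp_equiv (a : H ≃L[ℝ] H) (T : H →L[ℝ] E) :
    cokerDim (T ∘L (a : H →L[ℝ] H)) = cokerDim T := by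
  rw [cokerDim, range_comp_equiv, cokerDim]

theorem cokerDim_equiv_comp (b : E ≃L[ℝ] E) (T : H →L[ℝ] E) :
    cokerDim ((b : E →L[ℝ] E) ∘L T) = cokerDim T := by
  rw [cokerDim, cokerDim, ← (cokerEquiv b T).finrank_eq]

variable {M : Type*} [TopologicalSpace M] [ChartedSpace H M]
  {N : Type*} [TopologicalSpace N] [T2Space N] [RegularSpace N] [ChartedSpace E N]

/-- Existence of adapted charts. -/
theorem exists_isAdaptedChart {k : ℕ∞} (hk : 1 ≤ k) [IsManifold 𝓘(ℝ, H) (k : WithTop ℕ∞) M]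
    [IsManifold 𝓘(ℝ, E) (k : WithTop ℕ∞) N] {U : Set M} (hU : IsOpen U) {f : M → N}
    (hf : ContMDiffOn 𝓘(ℝ, H) 𝓘(ℝ, E) (k : WithTop ℕ∞) f U) {p : M} (hp : p ∈ U)
    {T : H →L[ℝ] E} (hT : diff f p = T)
    (hcl : IsClosed (LinearMap.range (T : H →ₗ[ℝ] E) : Set E))
    (hfin : FiniteDimensional ℝ (E ⧸ LinearMap.range (T : H →ₗ[ℝ] E)))
    {V : ClosedSubmodule ℝ H} (hV : V ≤ kerGr T)
    (hVfin : FiniteDimensional ℝ (V.toSubmoduleᗮ ⊓ (kerGr T).toSubmodule : Submodule ℝ H))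
    (hVdim : Module.finrank ℝ (V.toSubmoduleᗮ ⊓ (kerGr T).toSubmodule : Submodule ℝ H) =
      cokerDim T)
    {Q : H →L[ℝ] H} (hQ : IsIdempotentElem Q) {g : H ≃L[ℝ] H}
    (hg : V.map (g : H →L[ℝ] H) = kerGr Q) :
    ∃ φ, IsAdaptedChart (E := E) k U f Q φ ∧ p ∈ φ.source := by
  have hk1 : (1 : WithTop ℕ∞) ≤ (k : WithTop ℕ∞) := by exact_mod_cast hk
  have hk0 : (k : WithTop ℕ∞) ≠ 0 := (zero_lt_one.trans_le hk1).ne'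
  have hmd : ∀ q ∈ U, MDifferentiableAt 𝓘(ℝ, H) 𝓘(ℝ, E) f q := fun q hq =>
    (hf.mdifferentiableOn hk0).mdifferentiableAt (hU.mem_nhds hq)
  set χ : OpenPartialHomeomorph M H := chartAt H p with hχ
  set η : OpenPartialHomeomorph N E := chartAt E (f p) with hη
  have hχm : χ ∈ IsManifold.maximalAtlas 𝓘(ℝ, H) (k : WithTop ℕ∞) M :=
    IsManifold.chart_mem_maximalAtlas p
  have hηm : η ∈ IsManifold.maximalAtlas 𝓘(ℝ, E) (k : WithTop ℕ∞) N :=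
    IsManifold.chart_mem_maximalAtlas (f p)
  have hpχ : p ∈ χ.source := mem_chart_source H p
  have hpη : f p ∈ η.source := mem_chart_source E (f p)
  -- a closed neighbourhood of `f p` and a ball around its image
  obtain ⟨C, hCn, hCc, hCη⟩ := exists_mem_nhds_isClosed_subset (η.open_source.mem_nhds hpη)
  obtain ⟨r, hr, hrη⟩ := Metric.nhds_basis_closedBall.mem_iff.1
    (η.open_target.mem_nhds (η.map_source hpη))
  -- the local expression of `f`
  set F : H → E := fun x => η (f (χ.symm x)) with hFdef
  have hGo : IsOpen (interior C ∩ η ⁻¹' Metric.ball (η (f p)) r ∩ η.source) := by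
    have h1 : IsOpen (η.source ∩ η ⁻¹' Metric.ball (η (f p)) r) :=
      η.isOpen_inter_preimage Metric.isOpen_ball
    have h2 : interior C ∩ η ⁻¹' Metric.ball (η (f p)) r ∩ η.source =
        interior C ∩ (η.source ∩ η ⁻¹' Metric.ball (η (f p)) r) := by
      ext; simp only [mem_inter_iff]; tauto
    rw [h2]
    exact isOpen_interior.inter h1
  set G : Set N := interior C ∩ η ⁻¹' Metric.ball (η (f p)) r ∩ η.source with hG
  have hUG : IsOpen (U ∩ f ⁻¹' G) := hf.continuousOn.isOpen_inter_preimage hU hGo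
  set O : Set H := χ.target ∩ χ.symm ⁻¹' (U ∩ f ⁻¹' G) with hO
  have hOo : IsOpen O := χ.symm.isOpen_inter_preimage hUG
  have hpG : f p ∈ G := ⟨⟨mem_interior_iff_mem_nhds.2 hCn, Metric.mem_ball_self hr⟩, hpη⟩
  have hx₀ : χ p ∈ O := ⟨χ.map_source hpχ, by
    change χ.symm (χ p) ∈ U ∩ f ⁻¹' G
    rw [χ.left_inv hpχ]; exact ⟨hp, hpG⟩⟩
  have hF : ContDiffOn ℝ (k : WithTop ℕ∞) F O := by
    rw [← contMDiffOn_iff_contDiffOn]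
    refine (contMDiffOn_of_mem_maximalAtlas hηm).comp
      (hf.comp ((contMDiffOn_symm_of_mem_maximalAtlas hχm).mono inter_subset_left) ?_) ?_
    · exact fun x hx => hx.2.1
    · exact fun x hx => hx.2.2.2
  have hFT : fderiv ℝ F (χ p) = T := by
    have h1 : HasFDerivWithinAt F (diff (E := E) f p) univ (χ p) := by
      have h2 : HasFDerivWithinAt (writtenInExtChartAt 𝓘(ℝ, H) 𝓘(ℝ, E) p f) (diff f p)
        (range 𝓘(ℝ, H)) (extChartAt 𝓘(ℝ, H) p p) := (hmd p hp).hasMFDerivAt.2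
      rwa [show range 𝓘(ℝ, H) = univ by simp] at h2
    rw [← hT]
    exact (hasFDerivWithinAt_univ.1 h1).fderiv
  obtain ⟨B, hBT, hBK, hBker⟩ := exists_pseudoInverse hcl
  have hcomplete := hcl.completeSpace_coe
  have e := Submodule.quotientEquivOfIsCompl _ _
    (Submodule.isCompl_orthogonal (K := LinearMap.range (T : H →ₗ[ℝ] E)))
  have hBfin : FiniteDimensional ℝ (LinearMap.ker (B : E →ₗ[ℝ] H)) := by
    rw [hBker]
    exact e.finiteDimensional
  have hBdim : Module.finrank ℝ (LinearMap.ker (B : E →ₗ[ℝ] H)) = cokerDim T := by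
    rw [hBker, cokerDim, e.finrank_eq]
  obtain ⟨D, hxD, hDO, hDs, hDt, hDb, hDB⟩ := exists_straightening hk hOo hx₀ hF hBK
    (by rw [hFT]; exact hBT) g
  set φ : OpenPartialHomeomorph M H := χ.trans D with hφ
  have hφs : φ.source = χ.source ∩ χ ⁻¹' D.source := χ.trans_source D
  have hφt : φ.target = D.target ∩ D.symm ⁻¹' χ.target := χ.trans_target D
  have hφt' : φ.target = D.target := by
    rw [hφt]
    exact inter_eq_left.2 fun ξ hξ => (hDO (D.map_target hξ)).1
  have hφsymm : ∀ ξ, φ.symm ξ = χ.symm (D.symm ξ) := fun ξ => rfl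
  have hφO : ∀ ξ ∈ φ.target, D.symm ξ ∈ O := fun ξ hξ => hDO (D.map_target (hφt' ▸ hξ))
  have hφU : ∀ ξ ∈ φ.target, φ.symm ξ ∈ U := fun ξ hξ => (hφO ξ hξ).2.1
  have hφG : ∀ ξ ∈ φ.target, f (φ.symm ξ) ∈ G := fun ξ hξ => (hφO ξ hξ).2.2
  have hφm : φ ∈ IsManifold.maximalAtlas 𝓘(ℝ, H) (k : WithTop ℕ∞) M := by
    refine φ.mem_maximalAtlas_of_contMDiffOn ?_ ?_
    · refine (contMDiffOn_iff_contDiffOn.2 hDs).comp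
        ((contMDiffOn_of_mem_maximalAtlas hχm).mono ?_) ?_
      · rw [hφs]; exact inter_subset_left
      · rw [hφs]; exact inter_subset_right
    · rw [hφt']
      refine (contMDiffOn_symm_of_mem_maximalAtlas hχm).comp (contMDiffOn_iff_contDiffOn.2 hDt) ?_
      exact fun ξ hξ => (hDO (D.map_target hξ)).1
  -- the expression of `f` in the new chart
  set h : H → E := fun ξ => η (f (φ.symm ξ)) with hh
  have hhB : ∀ ξ ∈ φ.target, B (h ξ) = orthProj (perp (kerGr T)) (g.symm ξ) := fun ξ hξ =>
    hDB ξ (hφt' ▸ hξ)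
  have hdiff : ∀ ξ ∈ φ.target, ∃ b : E ≃L[ℝ] E, ∃ a : H ≃L[ℝ] H,
      fderiv ℝ h ξ = (b : E →L[ℝ] E) ∘L diff (E := E) (f ∘ φ.symm) ξ ∧
      diff (E := E) (f ∘ φ.symm) ξ = diff (H := H) (E := E) f (φ.symm ξ) ∘L (a : H →L[ℝ] H) := by
    intro ξ hξ
    obtain ⟨b, hb, -⟩ := exists_equiv_diff_chart hk hηm (hφG ξ hξ).2
    obtain ⟨a, -, ha⟩ := exists_equiv_diff_chart_symm hk hφm hξ
    have hm1 := hmd _ (hφU ξ hξ)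
    have hm2 : MDifferentiableAt 𝓘(ℝ, H) 𝓘(ℝ, E) (f ∘ φ.symm) ξ :=
      hm1.comp ξ ((mdifferentiable_of_mem_maximalAtlas hk hφm).mdifferentiableAt_symm hξ)
    refine ⟨b, a.symm, ?_, ?_⟩
    · rw [← hb, ← diff_eq_fderiv]
      exact diff_chart_comp hk hηm (hφG ξ hξ).2 hm2
    · rw [← ha]
      exact diff_comp_chart_symm hk hφm hξ hm1
  -- Differentiating `B h = P_{(ker T)^⊥} g⁻¹` shows that `L = Dh(ξ) g` satisfies `B L = P_{(ker
  -- T)^⊥}` at every `ξ`, with the same `B`. The linear normal form thus applies throughout the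
  -- chart and not only at the base point.
  have hnormal : ∀ ξ ∈ φ.target, CompactPerturbation (kerGr (fderiv ℝ h ξ)) (kerGr Q) ∧
      relDim (kerGr (fderiv ℝ h ξ)) (kerGr Q) = cokerDim (fderiv ℝ h ξ) := by
    intro ξ hξ
    have hhd : DifferentiableAt ℝ h ξ := by
      have h1 : MDifferentiableAt 𝓘(ℝ, H) 𝓘(ℝ, E) h ξ :=
        ((mdifferentiable_of_mem_maximalAtlas hk hηm).mdifferentiableAt (hφG ξ hξ).2).comp ξ
          ((hmd _ (hφU ξ hξ)).comp ξ
            ((mdifferentiable_of_mem_maximalAtlas hk hφm).mdifferentiableAt_symm hξ))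
      exact mdifferentiableAt_iff_differentiableAt.1 h1
    set L : H →L[ℝ] E := fderiv ℝ h ξ ∘L (g : H →L[ℝ] H) with hL
    have hBL : ∀ x, B (L x) = orthProj (perp (kerGr T)) x := by
      have h1 : HasFDerivAt (fun ξ => B (h ξ)) (B ∘L fderiv ℝ h ξ) ξ :=
        B.hasFDerivAt.comp ξ hhd.hasFDerivAt
      have h2 : HasFDerivAt (fun ξ => B (h ξ))
          (orthProj (perp (kerGr T)) ∘L (g.symm : H →L[ℝ] H)) ξ := by
        refine (orthProj (perp (kerGr T)) ∘L (g.symm : H →L[ℝ] H)).hasFDerivAt.congr_of_eventuallyEq ?_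
        filter_upwards [φ.open_target.mem_nhds hξ] with ζ hζ using hhB ζ hζ
      have h3 := h1.unique h2
      intro x
      have h4 := congrArg (fun S : H →L[ℝ] H => S (g x)) h3
      simpa [hL] using h4
    obtain ⟨h1, h2⟩ := relDim_kerGr_eq_cokerDim hBK hBfin hBL hV hVfin (hVdim.trans hBdim.symm)
    have h3 : kerGr (fderiv ℝ h ξ) = (kerGr L).map (g : H →L[ℝ] H) := by
      rw [← kerGr_comp_symm, hL]
      congr 1
      ext x
      simp
    rw [h3, ← hg]
    refine ⟨h1.map g, ?_⟩
    rw [h1.relDim_map g, h2, hL, cokerDim_comp_equiv]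
  refine ⟨φ, ⟨hφm, ?_, ?_, ?_, ?_, ?_⟩, ?_⟩
  · intro q hq
    have := hφU _ (φ.map_source hq)
    rwa [φ.left_inv hq] at this
  · rw [hφt']; exact hDb
  · intro ξ hξ
    obtain ⟨b, a, hb, ha⟩ := hdiff ξ hξ
    have h1 := (hnormal ξ hξ).1
    rwa [hb, kerGr_equiv_comp] at h1
  · intro ξ hξ
    obtain ⟨b, a, hb, ha⟩ := hdiff ξ hξ
    have h1 := (hnormal ξ hξ).2
    rwa [hb, kerGr_equiv_comp, cokerDim_equiv_comp, ha, cokerDim_comp_equiv, ← ha] at h1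
  · intro A hA
    have hAb : Bornology.IsBounded A := hDb.subset (hφt' ▸ hA)
    have hhA : η '' (f '' (φ.symm '' A)) = h '' A := by
      rw [image_image, image_image]
    have hhb : h '' A ⊆ Metric.closedBall (η (f p)) r := by
      rintro _ ⟨ξ, hξ, rfl⟩
      exact Metric.ball_subset_closedBall (hφG ξ (hA hξ)).1.2
    have hBA : B '' (h '' A) = (orthProj (perp (kerGr T)) ∘L (g.symm : H →L[ℝ] H)) '' A := by
      rw [image_image]
      exact image_congr fun ξ hξ => hhB ξ (hA hξ)
    rw [isPrecompact_image_chart_iff η hCc hCη Metric.isClosed_closedBall hrη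
      (S := f '' (φ.symm '' A)) ?_ (by rw [hhA]; exact hhb), hhA]
    · have hcp : CompactPerturbation V (kerGr T) := .of_le hV hVfin
      constructor
      -- With `K = ker T`: `Q` vanishes on `g V`, so `Q` is `Q g P_{K^⊥} g⁻¹` plus the compact
      -- operator `Q g (P_K - P_V P_K) g⁻¹`; the set `A` is bounded.
      · intro hpre
        have h1 : IsPrecompact ((orthProj (perp (kerGr T)) ∘L (g.symm : H →L[ℝ] H)) '' A) := by
          rw [← hBA]; exact hpre.image B.continuous
        have hS := (hcp.symm.compact_on.comp_clm (g.symm : H →L[ℝ] H)).clm_comp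
          (Q ∘L (g : H →L[ℝ] H))
        refine isPrecompact_image_of_decomposition (Q ∘L (g : H →L[ℝ] H))
          (S := (Q ∘L (g : H →L[ℝ] H)) ∘L (orthProj (kerGr T) - orthProj V ∘L orthProj (kerGr T))
            ∘L (g.symm : H →L[ℝ] H)) hS (fun ξ => ?_) hAb h1
        have h2 : Q (g (orthProj V (orthProj (kerGr T) (g.symm ξ)))) = 0 := by
          have h3 : g (orthProj V (orthProj (kerGr T) (g.symm ξ))) ∈ (kerGr Q).toSubmodule := by
            rw [← hg, mem_map_equiv, g.symm_apply_apply]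
            exact orthProj_mem V _
          exact h3
        have h4 : ξ = g (orthProj (perp (kerGr T)) (g.symm ξ)) + g (orthProj (kerGr T) (g.symm ξ)) := by
          rw [← map_add, orthProj_perp, sub_add_cancel, g.apply_symm_apply]
        conv_lhs => rw [h4]
        simp [h2]
      · intro hpre
        have h1 : IsPrecompact (B '' (h '' A)) := by
          rw [hBA]
          -- The range of `1 - Q` is `g V`, contained in `g (ker T)`, which `P_{(ker T)^⊥} g⁻¹`
          -- annihilates.
          have h2 : (orthProj (perp (kerGr T)) ∘L (g.symm : H →L[ℝ] H)) '' (Q '' A) =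
              (orthProj (perp (kerGr T)) ∘L (g.symm : H →L[ℝ] H)) '' A := by
            rw [image_image]
            refine image_congr fun ξ _ => ?_
            have h3 : g.symm (ξ - Q ξ) ∈ (kerGr T).toSubmodule := by
              refine hV ?_
              have h4 := idempotent_sub_mem hQ ξ
              rwa [← hg, mem_map_equiv] at h4
            have h5 : orthProj (perp (kerGr T)) (g.symm (ξ - Q ξ)) = 0 := by
              rw [orthProj_perp, orthProj_of_mem h3, sub_self]
            rw [map_sub, map_sub, sub_eq_zero] at h5
            exact h5.symm
          rw [← h2]
          exact hpre.image (orthProj (perp (kerGr T)) ∘L (g.symm : H →L[ℝ] H)).continuous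
        -- `1 - T B` takes values in the finite dimensional space `ker B`, so the bounded set `h A`
        -- is recovered from `B (h A)` up to a compact error.
        have hS : IsCompactOperator (ContinuousLinearMap.id ℝ E - T ∘L B) := by
          refine isCompactOperator_of_finite_range _ (Submodule.finiteDimensional_of_le
            (S₂ := LinearMap.ker (B : E →ₗ[ℝ] H)) ?_)
          rintro _ ⟨y, rfl⟩
          change B (y - T (B y)) = 0
          rw [map_sub, hBT, orthProj_of_mem (hBK y), sub_self]
        have h2 := isPrecompact_image_of_decomposition (R := ContinuousLinearMap.id ℝ E) (P := B) T
          hS (fun y => by simp) (Metric.isBounded_closedBall.subset hhb) h1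
        simpa using h2
    · rintro _ ⟨_, ⟨ξ, hξ, rfl⟩, rfl⟩
      exact interior_subset (hφG ξ (hA hξ)).1.1
  · rw [hφs]
    exact ⟨hpχ, hxD⟩

end AdaptedCharts

/-! ### Maps with pre-compact images on slices -/

section Slices

variable {H : Type*} [NormedAddCommGroup H] [InnerProductSpace ℝ H] [CompleteSpace H]
  {E : Type*} [NormedAddCommGroup E] [InnerProductSpace ℝ E] [CompleteSpace E]
  {M : Type*} [TopologicalSpace M] [ChartedSpace H M]
  {N : Type*} [TopologicalSpace N] [ChartedSpace E N]
  {N' : Type*} [TopologicalSpace N'] [ChartedSpace E N'] {k : ℕ∞}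

/-- The `ε`-neighbourhood of `ξ` in the affine space `ξ + V`. -/
def slice (V : ClosedSubmodule ℝ H) (ξ : H) (ε : ℝ) : Set H :=
  {x | x - ξ ∈ V.toSubmodule ∧ ‖x - ξ‖ < ε}

theorem norm_orthProj_le (V : ClosedSubmodule ℝ H) (x : H) : ‖orthProj V x‖ ≤ ‖x‖ :=
  V.toSubmodule.norm_starProjection_apply_le x

/-- The differential of a map which is totally bounded on a slice `ξ + V` is compact on `V`. -/
theorem isCompactOperator_of_totallyBounded_slice {F : H → E} {T : H →L[ℝ] E} {ξ : H}
    (hF : HasFDerivAt F T ξ) {V : ClosedSubmodule ℝ H} {ε : ℝ} (hε : 0 < ε)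
    (hS : TotallyBounded (F '' slice V ξ ε)) : IsCompactOperator (T ∘L orthProj V) := by
  refine (isCompactOperator_iff_isCompact_closure_image_ball
    ((T ∘L orthProj V : H →L[ℝ] E) : H →ₗ[ℝ] E) zero_lt_one).2 ?_
  refine isCompact_iff_totallyBounded_isComplete.2 ⟨TotallyBounded.closure ?_,
    isClosed_closure.isComplete⟩
  refine Metric.totallyBounded_iff.2 fun δ hδ => ?_
  have hδ' : 0 < δ / 4 := by positivity
  obtain ⟨r, hr, hrF⟩ := Metric.eventually_nhds_iff.1
    ((hasFDerivAt_iff_isLittleO_nhds_zero.1 hF).def hδ')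
  set t := min r ε / 2 with ht
  have hm : 0 < min r ε := lt_min hr hε
  have ht0 : 0 < t := by positivity
  have htr : t < r := by linarith [min_le_left r ε]
  have htε : t < ε := by linarith [min_le_right r ε]
  -- At the scale `t` the difference quotient `t⁻¹ (F (ξ + t v) - F ξ)` is within `δ/4` of `T v`. A
  -- finite net of the image of the slice, with radius shrunk by the factor `t`, therefore rescales
  -- to a finite net of the values `T v`.
  obtain ⟨Y, hYf, hY⟩ := Metric.totallyBounded_iff.1 hS (t * (δ / 4)) (by positivity)
  refine ⟨(fun y => t⁻¹ • (y - F ξ)) '' Y, hYf.image _, ?_⟩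
  rintro _ ⟨x, hx, rfl⟩
  have hx1 : ‖x‖ < 1 := by simpa using hx
  set v := orthProj V x with hv
  have hv1 : ‖v‖ ≤ 1 := (norm_orthProj_le V x).trans hx1.le
  have htv : ‖t • v‖ ≤ t := by
    rw [norm_smul, Real.norm_of_nonneg ht0.le]
    nlinarith
  have hmem : F (ξ + t • v) ∈ F '' slice V ξ ε := by
    refine mem_image_of_mem F ⟨?_, ?_⟩
    · rw [add_sub_cancel_left]
      exact V.toSubmodule.smul_mem t (orthProj_mem V x)
    · rw [add_sub_cancel_left]
      exact htv.trans_lt htε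
  obtain ⟨y, hyY, hy⟩ := mem_iUnion₂.1 (hY hmem)
  refine mem_iUnion₂.2 ⟨_, mem_image_of_mem _ hyY, ?_⟩
  have h1 : ‖F (ξ + t • v) - F ξ - T (t • v)‖ ≤ δ / 4 * ‖t • v‖ :=
    hrF (by rw [dist_zero_right]; exact htv.trans_lt htr)
  have h2 : ‖F (ξ + t • v) - y‖ < t * (δ / 4) := by rwa [Metric.mem_ball, dist_eq_norm] at hy
  have h3 : T v - t⁻¹ • (y - F ξ) =
      t⁻¹ • ((F (ξ + t • v) - y) - (F (ξ + t • v) - F ξ - T (t • v))) := by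
    rw [map_smul, smul_sub, smul_sub, smul_sub, smul_sub, smul_sub, inv_smul_smul₀ ht0.ne']
    abel
  have h4 : ‖(F (ξ + t • v) - y) - (F (ξ + t • v) - F ξ - T (t • v))‖ ≤ t * (δ / 2) := by
    refine (norm_sub_le _ _).trans ?_
    nlinarith
  rw [Metric.mem_ball, dist_eq_norm]
  change ‖T v - t⁻¹ • (y - F ξ)‖ < δ
  rw [h3, norm_smul, norm_inv, Real.norm_of_nonneg ht0.le]
  calc t⁻¹ * _ ≤ t⁻¹ * (t * (δ / 2)) := by gcongr
    _ = δ / 2 := by field_simp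
    _ < δ := by linarith

theorem isCompactOperator_diff_of_isPrecompact_slice [IsManifold 𝓘(ℝ, E) (k : WithTop ℕ∞) N]
    [RegularSpace N] (hk : 1 ≤ k) {G : H → N} {ξ : H}
    (hG : MDifferentiableAt 𝓘(ℝ, H) 𝓘(ℝ, E) G ξ) {V : ClosedSubmodule ℝ H} {ε : ℝ} (hε : 0 < ε)
    (hS : IsPrecompact (G '' slice V ξ ε)) :
    IsCompactOperator (diff (H := H) (E := E) G ξ ∘L orthProj V) := by
  set η : OpenPartialHomeomorph N E := chartAt E (G ξ) with hη
  have hηm : η ∈ IsManifold.maximalAtlas 𝓘(ℝ, E) (k : WithTop ℕ∞) N :=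
    IsManifold.chart_mem_maximalAtlas (G ξ)
  have hGη : G ξ ∈ η.source := mem_chart_source E (G ξ)
  obtain ⟨C, hCn, hCc, hCη⟩ := exists_mem_nhds_isClosed_subset (η.open_source.mem_nhds hGη)
  obtain ⟨r, hr, hrC⟩ := Metric.nhds_basis_ball.mem_iff.1 (hG.continuousAt hCn)
  -- Intersecting with the closed set `C` keeps the compact closure inside the domain of the chart.
  have hcpt : IsCompact (η '' (closure (G '' slice V ξ ε) ∩ C)) :=
    (hS.inter_right hCc).image_of_continuousOn (η.continuousOn.mono (inter_subset_right.trans hCη))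
  have htb : TotallyBounded ((η ∘ G) '' slice V ξ (min r ε)) := by
    refine hcpt.totallyBounded.subset ?_
    rintro _ ⟨x, hx, rfl⟩
    refine mem_image_of_mem η ⟨subset_closure (mem_image_of_mem G
      ⟨hx.1, hx.2.trans_le (min_le_right _ _)⟩), hrC ?_⟩
    rw [Metric.mem_ball, dist_eq_norm]
    exact hx.2.trans_le (min_le_left _ _)
  obtain ⟨b, hb, -⟩ := exists_equiv_diff_chart hk hηm hGη
  have hd := diff_chart_comp hk hηm hGη hG
  have hF : HasFDerivAt (η ∘ G) (diff (H := H) (E := E) (η ∘ G) ξ) ξ := by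
    have h1 : MDifferentiableAt 𝓘(ℝ, H) 𝓘(ℝ, E) (η ∘ G) ξ :=
      ((mdifferentiable_of_mem_maximalAtlas hk hηm).mdifferentiableAt hGη).comp ξ hG
    rw [diff_eq_fderiv]
    exact h1.differentiableAt.hasFDerivAt
  have h := isCompactOperator_of_totallyBounded_slice hF (lt_min hr hε) htb
  have h2 := h.clm_comp (b.symm : E →L[ℝ] E)
  refine isCompactOperator_congr h2 fun x => ?_
  rw [hd, hb]
  exact b.symm_apply_apply _

/-- On a slice parallel to `ker Q` the map `Q` is constant, so `f` and therefore `f'` have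
pre-compact image, and the differential of `f'` is compact along the slice. The kernel of the
differential of `f`, read in the chart, differs from `ker Q` by a compact perturbation. -/
theorem IsAdaptedChart.isCompactOperator_diff_comp_orthProj
    [IsManifold 𝓘(ℝ, E) (k : WithTop ℕ∞) N'] [RegularSpace N'] (hk : 1 ≤ k) {U U' : Set M}
    {f : M → N} {f' : M → N'} {Q : H →L[ℝ] H} {φ : OpenPartialHomeomorph M H}
    (hφ : IsAdaptedChart (E := E) k U f Q φ) {p : M} (hp : p ∈ φ.source) (hU' : IsOpen U')
    (hpU' : p ∈ U') (hf : MDifferentiableAt 𝓘(ℝ, H) 𝓘(ℝ, E) f p)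
    (hf' : MDifferentiableAt 𝓘(ℝ, H) 𝓘(ℝ, E) f' p)
    (hcomp : ∀ A : Set M, A ⊆ U ∩ U' → IsPrecompact (f '' A) → IsPrecompact (f' '' A)) :
    IsCompactOperator (diff (H := H) (E := E) f' p ∘L
      orthProj (kerGr (diff (H := H) (E := E) f p))) := by
  have hξ : φ p ∈ φ.target := φ.map_source hp
  have hps : φ.symm (φ p) = p := φ.left_inv hp
  obtain ⟨ε, hε, hεU⟩ := Metric.nhds_basis_ball.mem_iff.1
    ((φ.symm.isOpen_inter_preimage hU').mem_nhds
      (show φ p ∈ φ.symm.source ∩ φ.symm ⁻¹' U' from ⟨hξ, by rwa [mem_preimage, hps]⟩))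
  have hsl : slice (kerGr Q) (φ p) ε ⊆ φ.symm.source ∩ φ.symm ⁻¹' U' := fun x hx => hεU <| by
    rw [Metric.mem_ball, dist_eq_norm]; exact hx.2
  have hQ : IsPrecompact (Q '' slice (kerGr Q) (φ p) ε) := by
    refine isPrecompact_of_subset (isCompact_singleton (x := Q (φ p))) ?_
    rintro _ ⟨x, hx, rfl⟩
    have h : Q (x - φ p) = 0 := hx.1
    rwa [map_sub, sub_eq_zero] at h
  have h1 := (hφ.precompact_iff _ fun x hx => (hsl hx).1).2 hQ
  have h2 : IsPrecompact ((f' ∘ φ.symm) '' slice (kerGr Q) (φ p) ε) := by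
    rw [image_comp]
    refine hcomp _ ?_ h1
    rintro _ ⟨x, hx, rfl⟩
    exact ⟨hφ.source_subset (φ.map_target (hsl hx).1), (hsl hx).2⟩
  obtain ⟨g, -, hg⟩ := exists_equiv_diff_chart hk hφ.mem_maximalAtlas hp
  have hd := diff_comp_chart_symm hk hφ.mem_maximalAtlas hξ (hps.symm ▸ hf)
  have hd' := diff_comp_chart_symm hk hφ.mem_maximalAtlas hξ (hps.symm ▸ hf')
  have hmd : MDifferentiableAt 𝓘(ℝ, H) 𝓘(ℝ, E) (f' ∘ φ.symm) (φ p) :=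
    MDifferentiableAt.comp _ (hps.symm ▸ hf')
      ((mdifferentiable_of_mem_maximalAtlas hk hφ.mem_maximalAtlas).mdifferentiableAt_symm hξ)
  have h3 := isCompactOperator_diff_of_isPrecompact_slice hk hmd hε h2
  have h4 := hφ.compactPerturbation _ hξ
  rw [hps, hg] at hd hd'
  rw [hd, kerGr_comp_symm] at h4
  rw [hd'] at h3
  set K := kerGr (diff (H := H) (E := E) f p)
  set S := diff (H := H) (E := E) f' p
  have h5 : IsCompactOperator ((S ∘L (g.symm : H →L[ℝ] H)) ∘L orthProj (K.map (g : H →L[ℝ] H))) := by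
    have h6 : IsCompactOperator ((S ∘L (g.symm : H →L[ℝ] H)) ∘L
        (orthProj (K.map (g : H →L[ℝ] H)) - orthProj (kerGr Q))) :=
      IsCompactOperator.clm_comp h4 (S ∘L (g.symm : H →L[ℝ] H))
    refine isCompactOperator_congr (h6.add h3) fun x => ?_
    simp
  have h7 := h5.comp_clm ((g : H →L[ℝ] H) ∘L orthProj K)
  refine isCompactOperator_congr h7 fun x => ?_
  have h8 : g (orthProj K x) ∈ (K.map (g : H →L[ℝ] H)).toSubmodule := by
    rw [mem_map_equiv, g.symm_apply_apply]; exact orthProj_mem K x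
  change S (g.symm (orthProj (K.map (g : H →L[ℝ] H)) (g (orthProj K x)))) = S (orthProj K x)
  rw [orthProj_of_mem h8, g.symm_apply_apply]

/-- A pseudo-inverse of `S` turns compactness of `S P_{ker T}` into compactness of `(1 - P_{ker S})
P_{ker T}`, and symmetrically. -/
theorem CompactPerturbation.of_isCompactOperator_comp {T S : H →L[ℝ] E}
    (hT : IsClosed (LinearMap.range (T : H →ₗ[ℝ] E) : Set E))
    (hS : IsClosed (LinearMap.range (S : H →ₗ[ℝ] E) : Set E))
    (h₁ : IsCompactOperator (S ∘L orthProj (kerGr T)))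
    (h₂ : IsCompactOperator (T ∘L orthProj (kerGr S))) :
    CompactPerturbation (kerGr T) (kerGr S) := by
  have aux : ∀ {T S : H →L[ℝ] E}, IsClosed (LinearMap.range (S : H →ₗ[ℝ] E) : Set E) →
      IsCompactOperator (S ∘L orthProj (kerGr T)) →
      IsCompactOperator (orthProj (kerGr T) - orthProj (kerGr S) ∘L orthProj (kerGr T)) := by
    intro T S hS h
    obtain ⟨B, hB, -, -⟩ := exists_pseudoInverse hS
    refine isCompactOperator_congr (h.clm_comp B) fun x => ?_
    change B (S (orthProj (kerGr T) x)) = _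
    rw [hB, orthProj_perp]
    rfl
  exact .of_compact_on (aux hS h₁) (aux hT h₂)

end Slices

/-! ### Smoothness of essential subbundles which are constant in suitable charts -/

section Smoothness

variable {H : Type*} [NormedAddCommGroup H] [InnerProductSpace ℝ H] [CompleteSpace H]
  {M : Type*} [TopologicalSpace M] [ChartedSpace H M] {k : ℕ∞}
  [IsManifold 𝓘(ℝ, H) (k : WithTop ℕ∞) M]

theorem contDiffOn_chart_comp_symm {φ χ : OpenPartialHomeomorph M H}
    (hφ : φ ∈ IsManifold.maximalAtlas 𝓘(ℝ, H) (k : WithTop ℕ∞) M)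
    (hχ : χ ∈ IsManifold.maximalAtlas 𝓘(ℝ, H) (k : WithTop ℕ∞) M) :
    ContDiffOn ℝ (k : WithTop ℕ∞) (φ ∘ χ.symm) (χ.target ∩ χ.symm ⁻¹' φ.source) := by
  rw [← contMDiffOn_iff_contDiffOn]
  exact (contMDiffOn_of_mem_maximalAtlas hφ).comp
    ((contMDiffOn_symm_of_mem_maximalAtlas hχ).mono inter_subset_left) fun x hx => hx.2

/-- In an arbitrary chart `φ` the section is the class of `D(φ ∘ χ⁻¹) V`. The derivative of the
transition map is `C^{k-1}`, which is where one order of regularity is lost. -/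
theorem isEssentialSubbundle_of_charts (hk : 1 ≤ k) {m : ℕ} {ℰ : M → EssGr H m}
    {V : ClosedSubmodule ℝ H}
    (h : ∀ p : M, ∃ χ ∈ IsManifold.maximalAtlas 𝓘(ℝ, H) (k : WithTop ℕ∞) M, p ∈ χ.source ∧
      ∀ q ∈ χ.source, (ℰ q).map (diff χ q) = EssGr.mk m V) :
    IsEssentialSubbundle k (k - 1) ℰ := by
  intro φ hφ
  have key : ∀ ξ ∈ φ.target, ∃ s, IsOpen s ∧ ξ ∈ s ∧ s ⊆ φ.target ∧ ∃ T : H → H →L[ℝ] H,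
      ContDiffOn ℝ ((k - 1 : ℕ∞) : WithTop ℕ∞) T s ∧
      (∀ ζ ∈ s, ∃ g : H ≃L[ℝ] H, T ζ = g) ∧
      ∀ ζ ∈ s, localExpr ℰ φ ζ = EssGr.mk m (V.map (T ζ)) := by
    intro ξ hξ
    obtain ⟨χ, hχ, hξχ, hχV⟩ := h (φ.symm ξ)
    set s : Set H := φ.target ∩ φ.symm ⁻¹' χ.source
    set t : Set H := χ.target ∩ χ.symm ⁻¹' φ.source
    have hst : MapsTo (χ ∘ φ.symm) s t := fun ζ hζ => ⟨χ.map_source hζ.2, by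
      change χ.symm (χ (φ.symm ζ)) ∈ φ.source
      rw [χ.left_inv hζ.2]
      exact φ.map_target hζ.1⟩
    have hto : IsOpen t := χ.symm.isOpen_inter_preimage φ.open_source
    have hk' : ((k - 1 : ℕ∞) : WithTop ℕ∞) + 1 ≤ (k : WithTop ℕ∞) := by
      exact_mod_cast (tsub_add_cancel_of_le hk).le
    have hk'' : ((k - 1 : ℕ∞) : WithTop ℕ∞) ≤ (k : WithTop ℕ∞) := by
      exact_mod_cast tsub_le_self
    have hmφ := mdifferentiable_of_mem_maximalAtlas hk hφ
    have hmχ := mdifferentiable_of_mem_maximalAtlas hk hχ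
    have hT : ∀ ζ ∈ s, ∃ g g' : H ≃L[ℝ] H, diff φ (φ.symm ζ) = (g : H →L[ℝ] H) ∧
        diff χ (φ.symm ζ) = (g' : H →L[ℝ] H) ∧
        fderiv ℝ (φ ∘ χ.symm) ((χ ∘ φ.symm) ζ) = (g'.symm.trans g : H ≃L[ℝ] H) := by
      intro ζ hζ
      obtain ⟨g, hg, -⟩ := exists_equiv_diff_chart hk hφ (φ.map_target hζ.1)
      obtain ⟨g', hg', hg's⟩ := exists_equiv_diff_chart hk hχ hζ.2
      refine ⟨g, g', hg, hg', ?_⟩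
      have hl := χ.left_inv hζ.2
      have hd := diff_comp_chart_symm (E := H) hk hχ (f := φ) (χ.map_source hζ.2)
        (by rw [hl]; exact hmφ.mdifferentiableAt (φ.map_target hζ.1))
      rw [hl, hg, hg's, diff_eq_fderiv] at hd
      rw [Function.comp_apply, hd]
      rfl
    refine ⟨s, φ.symm.isOpen_inter_preimage χ.open_source, ⟨hξ, hξχ⟩, inter_subset_left,
      fun ζ => fderiv ℝ (φ ∘ χ.symm) ((χ ∘ φ.symm) ζ), ?_, ?_, ?_⟩
    · exact ((contDiffOn_chart_comp_symm hφ hχ).fderiv_of_isOpen hto hk').comp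
        ((contDiffOn_chart_comp_symm hχ hφ).of_le hk'') hst
    · intro ζ hζ
      obtain ⟨g, g', -, -, hgg⟩ := hT ζ hζ
      exact ⟨_, hgg⟩
    · intro ζ hζ
      obtain ⟨g, g', hg, hg', hgg⟩ := hT ζ hζ
      have h1 := hχV _ hζ.2
      rw [hg'] at h1
      have h2 := (EssGr.map_symm_eq_iff g' _ _).2 h1
      change (ℰ (φ.symm ζ)).map (diff φ (φ.symm ζ)) = _
      beta_reduce
      rw [hgg, hg, h2, EssGr.map_mk, EssGr.map_mk, map_map_equiv]
  constructor
  · intro ξ hξ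
    obtain ⟨s, hso, hξs, hsφ, T, hT, hinv, hloc⟩ := key ξ hξ
    have h1 : ContinuousOn (localExpr ℰ φ) s :=
      (EssGr.continuous_mk.comp_continuousOn (continuousOn_map hT.continuousOn hinv V)).congr hloc
    exact (h1.continuousAt (hso.mem_nhds hξs)).continuousWithinAt
  · intro ξ hξ
    obtain ⟨s, hso, hξs, hsφ, T, hT, hinv, hloc⟩ := key ξ hξ
    have h1 : ContDiffOn ℝ ((k - 1 : ℕ∞) : WithTop ℕ∞)
        (fun ζ => (localExpr ℰ φ ζ).toCalkin) s := by
      refine ((compactOperator (RingHom.id ℝ) H H).mkQL.contDiff.comp_contDiffOn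
        (contDiffOn_orthProj_map hT hinv V)).congr fun ζ hζ => ?_
      rw [hloc ζ hζ]
      rfl
    exact (h1.contDiffAt (hso.mem_nhds hξs)).contDiffWithinAt

end Smoothness

/-! ### Adapted charts and essential subbundles -/

section AdaptedCharts

variable {H : Type*} [NormedAddCommGroup H] [InnerProductSpace ℝ H] [CompleteSpace H]
  {E : Type*} [NormedAddCommGroup E] [InnerProductSpace ℝ E] [CompleteSpace E]
  {M : Type*} [TopologicalSpace M] [ChartedSpace H M]
  {N : Type*} [TopologicalSpace N] [ChartedSpace E N] {k : ℕ∞}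

theorem map_equiv_symm_map (g : H ≃L[ℝ] H) (V : ClosedSubmodule ℝ H) :
    (V.map (g : H →L[ℝ] H)).map (g.symm : H →L[ℝ] H) = V := by
  apply ClosedSubmodule.toSubmodule_injective
  ext x
  rw [mem_map_equiv, mem_map_equiv, g.symm_symm, g.symm_apply_apply]

/-- Relative dimension of the pullbacks of one subspace by two isomorphisms. -/
theorem relDim_map_symm_map_symm {K L V : ClosedSubmodule ℝ H} {g h : H ≃L[ℝ] H}
    (hK : CompactPerturbation (K.map (g : H →L[ℝ] H)) V)
    (hL : CompactPerturbation (L.map (h : H →L[ℝ] H)) V) (hKL : CompactPerturbation K L) :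
    CompactPerturbation (V.map (g.symm : H →L[ℝ] H)) (V.map (h.symm : H →L[ℝ] H)) ∧
      relDim (V.map (g.symm : H →L[ℝ] H)) (V.map (h.symm : H →L[ℝ] H)) =
        relDim K L + relDim (L.map (h : H →L[ℝ] H)) V - relDim (K.map (g : H →L[ℝ] H)) V := by
  have hK' := hK.map g.symm
  have hL' := hL.map h.symm
  have hKd := hK.relDim_map g.symm
  have hLd := hL.relDim_map h.symm
  rw [map_equiv_symm_map] at hK' hL' hKd hLd
  refine ⟨hK'.symm.trans (hKL.trans hL'), ?_⟩
  rw [hK'.symm.relDim_add (hKL.trans hL'), hKL.relDim_add hL', relDim_symm K, hKd, hLd]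
  ring

theorem IsAdaptedChart.map_kerGr (hk : 1 ≤ k) {U : Set M} {f : M → N} {Q : H →L[ℝ] H}
    {φ : OpenPartialHomeomorph M H} (hφ : IsAdaptedChart (E := E) k U f Q φ) {p : M}
    (hp : p ∈ φ.source) (hf : MDifferentiableAt 𝓘(ℝ, H) 𝓘(ℝ, E) f p) :
    CompactPerturbation ((kerGr (diff (H := H) (E := E) f p)).map (diff φ p)) (kerGr Q) ∧
      relDim ((kerGr (diff (H := H) (E := E) f p)).map (diff φ p)) (kerGr Q) =
        cokerDim (diff (H := H) (E := E) f p) := by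
  have hξ : φ p ∈ φ.target := φ.map_source hp
  have hps : φ.symm (φ p) = p := φ.left_inv hp
  obtain ⟨g, hg, hgs⟩ := exists_equiv_diff_chart hk hφ.mem_maximalAtlas hp
  have hd := diff_comp_chart_symm hk hφ.mem_maximalAtlas hξ (hps.symm ▸ hf)
  have h1 := hφ.compactPerturbation _ hξ
  have h2 := hφ.relDim_eq _ hξ
  rw [hps, hgs] at hd
  rw [hd, kerGr_comp_symm] at h1 h2
  rw [hps] at h2
  rw [hg]
  exact ⟨h1, h2⟩

theorem IsAdaptedChart.isPrecompact_image_iff {U : Set M} {f : M → N} {Q : H →L[ℝ] H}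
    {φ : OpenPartialHomeomorph M H} (hφ : IsAdaptedChart (E := E) k U f Q φ) {A : Set M}
    (hA : A ⊆ φ.source) : IsPrecompact (Q '' (φ '' A)) ↔ IsPrecompact (f '' A) := by
  rw [← hφ.precompact_iff (φ '' A) (by rintro _ ⟨x, hx, rfl⟩; exact φ.map_source (hA hx)),
    show φ.symm '' (φ '' A) = A from φ.toPartialEquiv.symm_image_image_of_subset_source hA]

theorem kerGr_orthProj_perp (V : ClosedSubmodule ℝ H) : kerGr (orthProj (perp V)) = V := by
  apply ClosedSubmodule.toSubmodule_injective
  ext x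
  change orthProj (perp V) x = 0 ↔ _
  rw [orthProj_perp]
  refine ⟨fun h => ?_, fun h => ?_⟩
  · rw [sub_eq_zero.1 h]
    exact orthProj_mem V x
  · rw [orthProj_of_mem h, sub_self]

theorem isIdempotentElem_orthProj (V : ClosedSubmodule ℝ H) : IsIdempotentElem (orthProj V) := by
  ext x
  exact orthProj_of_mem (orthProj_mem V x)

end AdaptedCharts

end EssentialSubbundle

end

/-! ### The main theorem. -/

open EssentialSubbundle in
theorem mainTheorem11
    {H : Type*} [NormedAddCommGroup H] [InnerProductSpace ℝ H] [CompleteSpace H]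
    [TopologicalSpace.SeparableSpace H] (hH : ¬ FiniteDimensional ℝ H)
    {E : Type*} [NormedAddCommGroup E] [InnerProductSpace ℝ E] [CompleteSpace E]
    (hE : ¬ FiniteDimensional ℝ E)
    (k : ℕ∞) (hk : 1 ≤ k)
    {M : Type*} [TopologicalSpace M] [T2Space M] [ParacompactSpace M]
    [ChartedSpace H M] [IsManifold 𝓘(ℝ, H) (k : WithTop ℕ∞) M]
    {ι : Type*} {N : ι → Type*} [∀ i, TopologicalSpace (N i)] [∀ i, T2Space (N i)]
    [∀ i, ParacompactSpace (N i)] [∀ i, ChartedSpace E (N i)]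
    [∀ i, IsManifold 𝓘(ℝ, E) (k : WithTop ℕ∞) (N i)]
    -- an open covering of `M`, and `C^k` maps `f i` from `U i` to `N i`
    (U : ι → Set M) (hUo : ∀ i, IsOpen (U i)) (hU : ⋃ i, U i = Set.univ)
    (f : ∀ i, M → N i)
    (hf : ∀ i, ContMDiffOn 𝓘(ℝ, H) 𝓘(ℝ, E) (k : WithTop ℕ∞) (f i) (U i))
    -- the maps `f i` are semi-Fredholm, with the same constant non-negative index
    (hsf : ∀ i, ∀ p ∈ U i, IsSemiFredholm (mfderiv 𝓘(ℝ, H) 𝓘(ℝ, E) (f i) p))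
    (ν : EReal) (hν : 0 ≤ ν)
    (hind : ∀ i, ∀ p ∈ U i, semiFredholmIndex (mfderiv 𝓘(ℝ, H) 𝓘(ℝ, E) (f i) p) = ν)
    (hcomp : ∀ i j, ∀ A : Set M, A ⊆ U i ∩ U j →
      (IsPrecompact (f i '' A) ↔ IsPrecompact (f j '' A)))
    -- arbitrary Hilbert inner products on the tangent spaces, `⟪a p v, a p w⟫` on `T_p M` and
    -- `⟪b i q v, b i q w⟫` on `T_q (N i)`, with respect to which adjoints are taken
    (a : ∀ p : M, TangentSpace 𝓘(ℝ, H) p ≃L[ℝ] H)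
    (b : ∀ i, ∀ q : N i, TangentSpace 𝓘(ℝ, E) q ≃L[ℝ] E) :
    ∃ ℰ : M → EssGr H 1,
      -- the kernels of the differentials define a `C^{k-1}` essential subbundle
      (∀ i, ∀ p ∈ U i, ℰ p = EssGr.mk 1 (kerGr (diff (H := H) (E := E) (f i) p))) ∧
      IsEssentialSubbundle k (k - 1) ℰ ∧
      -- `D f_i(p) D f_j(p)^*` is Fredholm
      (∀ i j, ∀ p ∈ U i ∩ U j, ContinuousLinearMap.IsFredholm
        (mfderiv 𝓘(ℝ, H) 𝓘(ℝ, E) (f i) p ∘L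
          adjointVia (a p) (b j (f j p)) (mfderiv 𝓘(ℝ, H) 𝓘(ℝ, E) (f j) p))) ∧
      -- there is a projector with adapted charts, for all the maps `f i`, around all points
      (∃ Q : H →L[ℝ] H, IsIdempotentElem Q ∧
        ∀ i, ∀ p ∈ U i, ∃ φ, IsAdaptedChart (E := E) k (U i) (f i) Q φ ∧ p ∈ φ.source) ∧
      -- and for each such projector the following holds
      (∀ Q : H →L[ℝ] H, IsIdempotentElem Q →
        (∀ i, ∀ p ∈ U i, ∃ φ, IsAdaptedChart (E := E) k (U i) (f i) Q φ ∧ p ∈ φ.source) →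
        IsStrongIntegrableStructure k ℰ (kerGr Q) (adaptedAtlas (E := E) k U f Q) ∧
        (∀ φ ∈ adaptedAtlas (E := E) k U f Q, ∀ i, φ.source ⊆ U i →
          ∀ A : Set M, A ⊆ φ.source →
            (IsPrecompact (Q '' (φ '' A)) ↔ IsPrecompact (f i '' A))) ∧
        -- `ℰ` lifts, along the atlas, to an `(m)`-essential subbundle iff all indices are `0 mod m`
        (∀ m : ℕ,
          (∃ ℰ' : M → EssGr H m, IsEssentialSubbundle k (k - 1) ℰ' ∧
            (∀ p, (ℰ' p).forget = ℰ p) ∧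
            (∀ φ ∈ adaptedAtlas (E := E) k U f Q, ∀ p ∈ φ.source,
              (ℰ' p).map (diff φ p) = EssGr.mk m (kerGr Q))) ↔
          ∀ i j, ∀ p ∈ U i ∩ U j, fredholmIndex
            (mfderiv 𝓘(ℝ, H) 𝓘(ℝ, E) (f i) p ∘L
              adjointVia (a p) (b j (f j p)) (mfderiv 𝓘(ℝ, H) 𝓘(ℝ, E) (f j) p))
              ≡ 0 [ZMOD (m : ℤ)])) := by
  have hk0 : (k : WithTop ℕ∞) ≠ 0 := by
    have : k ≠ 0 := (zero_lt_one.trans_le hk).ne'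
    exact_mod_cast this
  have hmd : ∀ i, ∀ p ∈ U i, MDifferentiableAt 𝓘(ℝ, H) 𝓘(ℝ, E) (f i) p := fun i p hp =>
    ((hf i).mdifferentiableOn hk0).mdifferentiableAt ((hUo i).mem_nhds hp)
  have hcov : ∀ p : M, ∃ i, p ∈ U i := fun p => mem_iUnion.1 (hU ▸ mem_univ p)
  have hsf' : ∀ i, ∀ p ∈ U i, IsSemiFredholm (diff (H := H) (E := E) (f i) p) := hsf
  have hind' : ∀ i, ∀ p ∈ U i, semiFredholmIndex (diff (H := H) (E := E) (f i) p) = ν := hind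
  have hfin : ∀ i, ∀ p ∈ U i, FiniteDimensional ℝ
      (E ⧸ LinearMap.range (diff (H := H) (E := E) (f i) p : H →ₗ[ℝ] E)) := fun i p hp =>
    (hsf' i p hp).finite_coker (hν.trans_eq (hind' i p hp).symm)
  have hdim : ∀ i, ∀ p ∈ U i, ∃ V : ClosedSubmodule ℝ H, HasDim V ν ∧
      V ≤ kerGr (diff (H := H) (E := E) (f i) p) ∧
      FiniteDimensional ℝ (V.toSubmoduleᗮ ⊓
        (kerGr (diff (H := H) (E := E) (f i) p)).toSubmodule : Submodule ℝ H) ∧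
      Module.finrank ℝ (V.toSubmoduleᗮ ⊓
        (kerGr (diff (H := H) (E := E) (f i) p)).toSubmodule : Submodule ℝ H) =
          cokerDim (diff (H := H) (E := E) (f i) p) := by
    intro i p hp
    have h := exists_hasDim_le_kerGr hE (hsf' i p hp) (hν.trans_eq (hind' i p hp).symm)
    rwa [hind' i p hp] at h
  -- existence of a projector with adapted charts
  have hQex : ∃ Q : H →L[ℝ] H, IsIdempotentElem Q ∧
      ∀ i, ∀ p ∈ U i, ∃ φ, IsAdaptedChart (E := E) k (U i) (f i) Q φ ∧ p ∈ φ.source := by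
    rcases isEmpty_or_nonempty M with hM | ⟨⟨p₀⟩⟩
    · exact ⟨0, by simp [IsIdempotentElem], fun i p => isEmptyElim p⟩
    obtain ⟨i₀, hi₀⟩ := hcov p₀
    -- The model `V₀` is taken from a single point; at every other point the subspace of the kernel
    -- has the same dimension `ν` and is carried onto `V₀` by an isomorphism `g`.
    obtain ⟨V₀, hV₀, -⟩ := hdim i₀ p₀ hi₀
    refine ⟨orthProj (perp V₀), isIdempotentElem_orthProj _, fun i p hp => ?_⟩
    obtain ⟨V, hV, hVle, hVfin, hVdim⟩ := hdim i p hp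
    obtain ⟨g, hg⟩ := hV.exists_map_eq hV₀
    exact exists_isAdaptedChart hk (hUo i) (hf i) hp rfl (hsf' i p hp).isClosed_range
      (hfin i p hp) hVle hVfin hVdim (isIdempotentElem_orthProj _)
      (hg.trans (kerGr_orthProj_perp V₀).symm)
  -- the kernels are compact perturbations of each other
  have hker : ∀ i j, ∀ p ∈ U i ∩ U j, CompactPerturbation
      (kerGr (diff (H := H) (E := E) (f i) p)) (kerGr (diff (H := H) (E := E) (f j) p)) := by
    intro i j p hp
    obtain ⟨Q, -, hQ⟩ := hQex
    have aux : ∀ i j, p ∈ U i ∩ U j → IsCompactOperator (diff (H := H) (E := E) (f j) p ∘L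
        orthProj (kerGr (diff (H := H) (E := E) (f i) p))) := by
      intro i j hp
      obtain ⟨φ, hφ, hpφ⟩ := hQ i p hp.1
      exact hφ.isCompactOperator_diff_comp_orthProj hk hpφ (hUo j) hp.2 (hmd i p hp.1)
        (hmd j p hp.2) fun A hA => (hcomp i j A hA).1
    exact .of_isCompactOperator_comp (hsf' i p hp.1).isClosed_range
      (hsf' j p hp.2).isClosed_range (aux i j hp) (aux j i hp.symm)
  have hfred : ∀ i j, ∀ p ∈ U i ∩ U j, ContinuousLinearMap.IsFredholm
        (mfderiv 𝓘(ℝ, H) 𝓘(ℝ, E) (f i) p ∘L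
          adjointVia (a p) (b j (f j p)) (mfderiv 𝓘(ℝ, H) 𝓘(ℝ, E) (f j) p)) ∧
      fredholmIndex (mfderiv 𝓘(ℝ, H) 𝓘(ℝ, E) (f i) p ∘L
          adjointVia (a p) (b j (f j p)) (mfderiv 𝓘(ℝ, H) 𝓘(ℝ, E) (f j) p)) =
        relDim (kerGr (diff (H := H) (E := E) (f i) p)) (kerGr (diff (H := H) (E := E) (f j) p)) +
          cokerDim (diff (H := H) (E := E) (f j) p) -
          cokerDim (diff (H := H) (E := E) (f i) p) := fun i j p hp =>
    isFredholm_comp_adjointVia (H := H) (E := E) (T := diff (f i) p) (S := diff (f j) p) (a p)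
      (b j (f j p)) (hsf' j p hp.2).isClosed_range (hfin i p hp.1) (hfin j p hp.2) (hker i j p hp)
  choose i₀ hi₀ using hcov
  set ℰ : M → EssGr H 1 := fun p => EssGr.mk 1 (kerGr (diff (H := H) (E := E) (f (i₀ p)) p))
  have hℰ : ∀ i, ∀ p ∈ U i, ℰ p = EssGr.mk 1 (kerGr (diff (H := H) (E := E) (f i) p)) :=
    fun i p hp => EssGr.mk_eq_mk.2 ⟨hker _ _ p ⟨hi₀ p, hp⟩, by simp⟩
  have hmap : ∀ Q : H →L[ℝ] H, ∀ φ ∈ adaptedAtlas (E := E) k U f Q, ∀ p ∈ φ.source,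
      (ℰ p).map (diff φ p) = EssGr.mk 1 (kerGr Q) := by
    rintro Q φ ⟨i, hφ⟩ p hp
    have h := hφ.map_kerGr hk hp (hmd i p (hφ.source_subset hp))
    obtain ⟨g, hg, -⟩ := exists_equiv_diff_chart hk hφ.mem_maximalAtlas hp
    rw [hg] at h
    rw [hℰ i p (hφ.source_subset hp), hg, EssGr.map_mk]
    exact EssGr.mk_eq_mk.2 ⟨h.1, by simp⟩
  have hmore : ∀ Q : H →L[ℝ] H, ∀ φ ∈ adaptedAtlas (E := E) k U f Q, ∀ i,
      ∀ A : Set M, A ⊆ φ.source ∩ U i →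
        (IsPrecompact (Q '' (φ '' A)) ↔ IsPrecompact (f i '' A)) := by
    rintro Q φ ⟨j, hφ⟩ i A hA
    rw [hφ.isPrecompact_image_iff (hA.trans inter_subset_left)]
    exact hcomp j i A fun x hx => ⟨hφ.source_subset (hA hx).1, (hA hx).2⟩
  refine ⟨ℰ, hℰ, ?_, fun i j p hp => (hfred i j p hp).1, hQex, fun Q hQ hQφ => ⟨?_, ?_, ?_⟩⟩
  · obtain ⟨Q, -, hQφ⟩ := hQex
    refine isEssentialSubbundle_of_charts hk (V := kerGr Q) fun p => ?_
    obtain ⟨φ, hφ, hpφ⟩ := hQφ (i₀ p) p (hi₀ p)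
    exact ⟨φ, hφ.mem_maximalAtlas, hpφ, hmap Q φ ⟨_, hφ⟩⟩
  · refine ⟨fun φ ⟨i, hφ⟩ => hφ.mem_maximalAtlas, fun p => ?_, hmap Q, ?_⟩
    · obtain ⟨φ, hφ, hpφ⟩ := hQφ (i₀ p) p (hi₀ p)
      exact ⟨φ, ⟨_, hφ⟩, hpφ⟩
    -- Any projector with kernel `V` may be replaced by `Q`. Both sides are then compared with the
    -- image under `f j` of `ψ⁻¹(A)`, where `ψ` is adapted to `f j`.
    · rintro Q' hQ' hker' φ hφ ψ ⟨j, hψ⟩ A hA -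
      have hAs : ∀ x ∈ A, x ∈ ψ.target ∧ ψ.symm x ∈ φ.source := fun x hx => by
        simpa only [mfld_simps] using hA hx
      have hsub : ψ.symm '' A ⊆ φ.source ∩ U j := by
        rintro _ ⟨x, hx, rfl⟩
        exact ⟨(hAs x hx).2, hψ.source_subset (ψ.map_target (hAs x hx).1)⟩
      rw [← isPrecompact_image_iff_of_kerGr_eq hQ hQ' hker',
        ← isPrecompact_image_iff_of_kerGr_eq hQ hQ' hker',
        ← hψ.precompact_iff A fun x hx => (hAs x hx).1, ← hmore Q φ hφ j _ hsub,
        ← image_comp φ ψ.symm]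
      rfl
  · exact fun φ hφ i hi A hA => hmore Q φ hφ i A fun x hx => ⟨hA hx, hi (hA hx)⟩
  · intro m
    -- Both charts send the kernels to perturbations of `V` whose relative dimension is `dim coker`,
    -- so the cokernel terms in the index formula cancel. The index is the relative dimension of the
    -- two pullbacks of `V`.
    have hrel : ∀ {i j} {φ ψ : OpenPartialHomeomorph M H},
        IsAdaptedChart (E := E) k (U i) (f i) Q φ → IsAdaptedChart (E := E) k (U j) (f j) Q ψ →
        ∀ {p}, p ∈ φ.source → p ∈ ψ.source → ∀ {g h : H ≃L[ℝ] H},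
        diff φ p = (g : H →L[ℝ] H) → diff ψ p = (h : H →L[ℝ] H) →
        (EssRel m ((kerGr Q).map (g.symm : H →L[ℝ] H)) ((kerGr Q).map (h.symm : H →L[ℝ] H)) ↔
          fredholmIndex (mfderiv 𝓘(ℝ, H) 𝓘(ℝ, E) (f i) p ∘L
            adjointVia (a p) (b j (f j p)) (mfderiv 𝓘(ℝ, H) 𝓘(ℝ, E) (f j) p))
              ≡ 0 [ZMOD (m : ℤ)]) := by
      intro i j φ ψ hφ hψ p hpφ hpψ g h hg hh
      have hp : p ∈ U i ∩ U j := ⟨hφ.source_subset hpφ, hψ.source_subset hpψ⟩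
      have h1 := hφ.map_kerGr hk hpφ (hmd i p hp.1)
      have h2 := hψ.map_kerGr hk hpψ (hmd j p hp.2)
      rw [hg] at h1
      rw [hh] at h2
      have h3 := relDim_map_symm_map_symm h1.1 h2.1 (hker i j p hp)
      rw [h1.2, h2.2] at h3
      have h4 := (hfred i j p hp).2
      rw [← h3.2] at h4
      rw [h4, Int.modEq_zero_iff_dvd]
      exact ⟨fun h => h.2, fun h => ⟨h3.1, h⟩⟩
    constructor
    · rintro ⟨ℰ', -, -, hℰ'⟩ i j p hp
      obtain ⟨φ, hφ, hpφ⟩ := hQφ i p hp.1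
      obtain ⟨ψ, hψ, hpψ⟩ := hQφ j p hp.2
      obtain ⟨g, hg, -⟩ := exists_equiv_diff_chart hk hφ.mem_maximalAtlas hpφ
      obtain ⟨h, hh, -⟩ := exists_equiv_diff_chart hk hψ.mem_maximalAtlas hpψ
      refine (hrel hφ hψ hpφ hpψ hg hh).1 (EssGr.mk_eq_mk.1 ?_)
      have h1 := hℰ' φ ⟨i, hφ⟩ p hpφ
      have h2 := hℰ' ψ ⟨j, hψ⟩ p hpψ
      rw [hg, ← EssGr.map_symm_eq_iff, EssGr.map_mk] at h1
      rw [hh, ← EssGr.map_symm_eq_iff, EssGr.map_mk] at h2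
      exact h1.symm.trans h2
    · intro hidx
      have hch : ∀ p : M, ∃ φ : OpenPartialHomeomorph M H, ∃ g : H ≃L[ℝ] H,
          IsAdaptedChart (E := E) k (U (i₀ p)) (f (i₀ p)) Q φ ∧ p ∈ φ.source ∧
            diff φ p = (g : H →L[ℝ] H) := by
        intro p
        obtain ⟨φ, hφ, hpφ⟩ := hQφ (i₀ p) p (hi₀ p)
        obtain ⟨g, hg, -⟩ := exists_equiv_diff_chart hk hφ.mem_maximalAtlas hpφ
        exact ⟨φ, g, hφ, hpφ, hg⟩
      choose χ g hχ hpχ hg using hch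
      -- `V` is pulled back by one chosen adapted chart at each point; vanishing of the indices mod
      -- `m` makes the class independent of the chart.
      set ℰ' : M → EssGr H m := fun p => EssGr.mk m ((kerGr Q).map ((g p).symm : H →L[ℝ] H))
      have hmap' : ∀ φ ∈ adaptedAtlas (E := E) k U f Q, ∀ p ∈ φ.source,
          (ℰ' p).map (diff φ p) = EssGr.mk m (kerGr Q) := by
        rintro φ ⟨j, hφ⟩ p hpφ
        obtain ⟨h, hh, -⟩ := exists_equiv_diff_chart hk hφ.mem_maximalAtlas hpφ
        rw [hh, ← EssGr.map_symm_eq_iff, EssGr.map_mk]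
        exact EssGr.mk_eq_mk.2 ((hrel (hχ p) hφ (hpχ p) hpφ (hg p) hh).2
          (hidx _ _ p ⟨hi₀ p, hφ.source_subset hpφ⟩))
      refine ⟨ℰ', isEssentialSubbundle_of_charts hk fun p =>
        ⟨χ p, (hχ p).mem_maximalAtlas, hpχ p, hmap' (χ p) ⟨_, hχ p⟩⟩, fun p => ?_, hmap'⟩
      have h1 := hmap Q (χ p) ⟨_, hχ p⟩ p (hpχ p)
      rw [hg p, ← EssGr.map_symm_eq_iff] at h1
      rw [h1, EssGr.forget_mk, EssGr.map_mk]
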